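/- Let $n\ge 2$, let $T^n=\{z\in\mathbb C^n: |z_j|=1,\ 1\le j\le n\}$, $\Omega=dz_1\wedge\dots\wedge dz_n$, and, for $r>0$, $A_r=\{z\in\mathbb C^n: e^{-r}<|z_j|<e^{r},\ 1\le j\le n\}$ and $\|f\|_r=\sup\{|f_j(z)|: z\in A_r,\ 1\le j\le n\}$ for $f=(f_1,\dots,f_n)\colon A_r\to\mathbb C^n$. Two subsets $M,N$ of $\mathbb C^n$ are called unimodularly equivalent if there is a biholomorphic map $\Phi$ from an open neighbourhood of $M$ onto an open subset of $\mathbb C^n$ with $\Phi^*\Omega=\Omega$ and $\Phi(M)=N$. For $\rho>0$ and a continuous $2\pi$-periodic function $k\colon\mathbb R\to\mathbb R$ with $\int_0^{2\pi}k(\theta_1)\,d\theta_1=0$, we say that $M$ has the normal form $(\rho,k)$ if there is a function $g$ on the unit circle with $$\frac{d}{d\theta_1}g(e^{i\theta_1})=\rho\,e^{i(\theta_1+k(\theta_1))}$$ such that $\psi(z_1,z')=(\zeta^{-1}g(\zeta z_1),z')$, where $z'=(z_2,\dots,z_n)$ and $\zeta=z_2\cdots z_n$, defines a $C^1$ embedding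 of $T^n$ in $\mathbb C^n$ and $M$ is unimodularly equivalent to $\psi(T^n)$. **Theorem.** There is a number $\epsilon_0>0$, depending only on $n$, such that the following holds. Let $0<r_0<1$, and let $M=\varphi(T^n)$, where $\varphi$ is holomorphic in $A_{r_0}$, restricts to an embedding of $T^n$ in $\mathbb C^n$, and satisfies $\|\varphi-\mathrm{Id}\|_{r_0}\le\epsilon_0 r_0^4$. Let $\rho_0=(2\pi)^{-n}\int_M\nu$ be the normalized total volume of $M$, where $\nu=|\varphi^*\Omega|$ is the positive volume element with $\varphi^*\Omega=e^{i\mu}\nu$, $\mu$ real. 1. There is a real analytic $k$ such that $M$ has the normal form $(\rho_0,k)$, with $\psi$ a real analytic embedding. Moreover, $M$ has the normal form $(\rho,l)$ if and only if $\rho=\rho_0$ and either $l(\theta_1)=k(\theta_1)$ for all $\theta_1$, or $l(\theta_1)=k(\theta_1+\pi)$ for all $\theta_1$. 2. Consequently $\rho_0$ and $k$ (up to this shift) are a complete set of invariants: if $M_1$ and $M_2$ are two such tori (possibly with different values of $r_0$) with normal forms $(\rho_1,k_1)$ and $(\rho_2,k_2)$, where $\rho_j$ is the normalized total volume of $M_j$,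 then $M_1$ and $M_2$ are unimodularly equivalent if and only if $\rho_1=\rho_2$ and either $k_2(\theta_1)=k_1(\theta_1)$ for all $\theta_1$, or $k_2(\theta_1)=k_1(\theta_1+\pi)$ for all $\theta_1$. -/

import Mathlib

open scoped ContDiff

noncomputable section

namespace UnimodularTori

/-- The standard torus `T^n` in `ℂⁿ`: `|z_j| = 1` for all `j`. -/
def torus (n : ℕ) : Set (Fin n → ℂ) := {z | ∀ j, ‖z j‖ = 1}

/-- The annulus `A_r` in `ℂⁿ`: `e^{-r} < |z_j| < e^r` for all `j`. -/
def annulus (n : ℕ) (r : ℝ) : Set (Fin n → ℂ) :=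
  {z | ∀ j, Real.exp (-r) < ‖z j‖ ∧ ‖z j‖ < Real.exp r}

/-- `‖f‖_r = sup { |f_j(z)| : z ∈ A_r, 1 ≤ j ≤ n }`, with values in `[0, ∞]`. -/
def annulusNorm {n : ℕ} (r : ℝ) (f : (Fin n → ℂ) → (Fin n → ℂ)) : ENNReal :=
  ⨆ z ∈ annulus n r, ⨆ j, ‖f z j‖ₑ

/-- The universal covering `θ ↦ (e^{iθ_1}, …, e^{iθ_n})` of the torus. -/
def cover {n : ℕ} (θ : Fin n → ℝ) : Fin n → ℂ := fun j => Complex.exp (Complex.I * (θ j : ℂ))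

/-- The holomorphic `n`-form `Ω = dz_1 ∧ … ∧ dz_n` (a constant form on `ℂⁿ`). -/
def Omega (n : ℕ) : (Fin n → ℂ) [⋀^Fin n]→ₗ[ℂ] ℂ := Matrix.detRowAlternating

/-- `f` restricts to an embedding of class `C^s` of the (compact) torus into `ℂⁿ`: an injective
immersion of class `C^s`, both conditions of differential nature being read on the universal
covering. For `s = ω` the embedding is real analytic. -/
def IsTorusEmbedding {n : ℕ} (s : WithTop ℕ∞) (f : (Fin n → ℂ) → (Fin n → ℂ)) : Prop :=
  ContDiff ℝ s (fun θ : Fin n → ℝ => f (cover θ)) ∧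
  (∀ θ : Fin n → ℝ,
    Function.Injective (fderiv ℝ (fun t : Fin n → ℝ => f (cover t)) θ)) ∧
  Set.InjOn f (torus n)

/-- The coefficient of `f^*Ω` with respect to `dθ_1 ∧ … ∧ dθ_n` on the torus. -/
def pullbackCoeff {n : ℕ} (f : (Fin n → ℂ) → (Fin n → ℂ)) (θ : Fin n → ℝ) : ℂ :=
  Omega n (fun j => fderiv ℝ (fun t : Fin n → ℝ => f (cover t)) θ (Pi.single j 1))

/-- The total volume `∫_M ν` of `M = f(T^n)`, where `f^*Ω = e^{iμ} ν` with `ν` a positive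
`n`-form, that is `ν = |f^*Ω|`. -/
def totalVolume {n : ℕ} (f : (Fin n → ℂ) → (Fin n → ℂ)) : ℝ :=
  ∫ θ in Set.Icc (0 : Fin n → ℝ) (fun _ => 2 * Real.pi), ‖pullbackCoeff f θ‖

/-- The total volume divided by `(2π)^n`, the volume of `T^n` for `dθ_1 ∧ … ∧ dθ_n`. -/
def meanVolume {n : ℕ} (f : (Fin n → ℂ) → (Fin n → ℂ)) : ℝ :=
  totalVolume f / (2 * Real.pi) ^ n

/-- Unimodular equivalence of two subsets of `ℂⁿ`: a biholomorphic map `Φ` from an open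
neighbourhood of `M` onto an open set of `ℂⁿ`, with `Φ^*Ω = Ω` and `Φ(M) = N`. -/
def UnimodularEquiv {n : ℕ} (M N : Set (Fin n → ℂ)) : Prop :=
  ∃ Φ : OpenPartialHomeomorph (Fin n → ℂ) (Fin n → ℂ),
    M ⊆ Φ.source ∧
    DifferentiableOn ℂ Φ Φ.source ∧
    DifferentiableOn ℂ Φ.symm Φ.target ∧
    (∀ z ∈ Φ.source,
      (Omega n).compLinearMap (fderiv ℂ Φ z : (Fin n → ℂ) →ₗ[ℂ] (Fin n → ℂ)) = Omega n) ∧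
    Φ '' M = N

/-- The map `ψ(z_1, z') = (ζ⁻¹ g(ζ z_1), z')` with `ζ = z_2 ⋯ z_n`
(the coordinate `z_1` has index `0`). -/
def normalMap {n : ℕ} [NeZero n] (g : ℂ → ℂ) (z : Fin n → ℂ) : Fin n → ℂ :=
  Function.update z 0
    ((∏ j ∈ Finset.univ.erase (0 : Fin n), z j)⁻¹ *
      g ((∏ j ∈ Finset.univ.erase (0 : Fin n), z j) * z 0))

/-- `M` is unimodularly equivalent to the torus in normal form with data `ρ > 0` and `k`, where
`k` is a continuous real function, `2π`-periodic and of mean zero: for some `g` on the unit circle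
with `d/dθ g(e^{iθ}) = ρ e^{i(θ + k(θ))}`, the map `ψ` built from `g` is a `C^s` embedding of the
torus, and `M` is equivalent to its image. -/
def HasNormalForm {n : ℕ} [NeZero n] (s : WithTop ℕ∞) (M : Set (Fin n → ℂ)) (ρ : ℝ)
    (k : ℝ → ℝ) : Prop :=
  0 < ρ ∧ Continuous k ∧ Function.Periodic k (2 * Real.pi) ∧
  (∫ t in (0 : ℝ)..(2 * Real.pi), k t) = 0 ∧
  ∃ g : ℂ → ℂ,
    (∀ t : ℝ, HasDerivAt (fun u : ℝ => g (Complex.exp (Complex.I * (u : ℂ))))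
      ((ρ : ℂ) * Complex.exp (Complex.I * ((t : ℂ) + (k t : ℂ)))) t) ∧
    IsTorusEmbedding s (normalMap (n := n) g) ∧
    UnimodularEquiv M (normalMap (n := n) g '' torus n)

/-- `φ` is holomorphic on `A_r`, restricts to an embedding of `T^n`, and satisfies
`‖φ - Id‖_r ≤ ε r⁴`. -/
def IsNearIdentity {n : ℕ} (ε r : ℝ) (φ : (Fin n → ℂ) → (Fin n → ℂ)) : Prop :=
  DifferentiableOn ℂ φ (annulus n r) ∧ IsTorusEmbedding ω φ ∧
  annulusNorm r (fun z => φ z - z) ≤ ENNReal.ofReal (ε * r ^ 4)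

end UnimodularTori

end

/-!
The torus is studied through the lift `F = φ ∘ ccover` to a strip around `ℝⁿ` in `ℂⁿ`. Two
holomorphic maps near the torus, both embeddings of the torus, with the same nonvanishing Jacobian
have unimodularly equivalent images (`unimodularEquiv_of_det_eq`), since the transition map between
them is biholomorphic near the first image and preserves `Ω`. Existence of the normal form
therefore amounts to a holomorphic change of the coordinates of the torus after which the Jacobian
is that of a map `ψ`, namely `Iⁿ⁻¹ ρ e^{i(s + k(s))}` with `s` the sum of the angles
(`pullbackCoeff_normalMap`).

*Existence.* As `φ` is close to the identity, the Jacobian of `F` is `Iⁿ e^{i(w_1 + ⋯ + w_n)} p e^{ia}`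
with `p` near `1` and `a` near `0`, both holomorphic, periodic, and real on `ℝⁿ`
(`exists_isPolarJacobian`). The argument `w_1 + ⋯ + w_n + π/2 + a` replaces the first coordinate;
this is invertible near `ℝⁿ` because `a` is small compared with the width of the strip
(`exists_straighten_inverse`). What remains is a positive periodic density, which the triangular
rearrangement of Knothe and Rosenblatt carries to a constant: the `j`-th new coordinate is a
normalized primitive, in the `j`-th variable, of the mean of the density over the later variables.
This involves only means and primitives, so it preserves holomorphy
(`exists_triangular_rearrangement`). Its first component is a function of the argument alone;
its inverse `K` expresses the argument through the first new coordinate, which is in turn made the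
sum of the angles by a unimodular integral linear map, and a translation makes `K t - t` have mean
zero (`exists_normal_coordinates`). The curve with tangent `ρ e^{iK}` closes up because the Jacobian
of a periodic map has mean zero (`integral_det_dmat_eq_zero`); its tangent turns monotonically by
`2π`, so that it is simple and `ψ` is an embedding (`isTorusEmbedding_normalMap`).

*Uniqueness.* An equivalence of the torus with `ψ(Tⁿ)` lifts to a reparametrization `X` of the
universal covering (`exists_reparametrization`), which takes the argument and modulus of `φ^*Ω` to
those of `ψ^*Ω`. Hence the phase `t + l(t)` at the sum of the coordinates of `X` equals the
argument up to a multiple of `π`, the sign of the Jacobian of `X` being free. So the image, under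
the argument, of the volume of the torus is the image of `ρ dt` under the phase
(`HasNormalForm.phase`). Its total mass is `ρ`, up to `(2π)ⁿ`, and it determines the phase up to a
translation of the parameter (`exists_translate_eq`). As `k` and `l` have mean zero, comparing means
shows that this translation is by a multiple of `π`, so that `l` is unique up to a half turn
(`HasNormalForm.unique`). The half turn does occur: a monomial unimodular involution that reverses
the orientation of the torus realizes it (`unimodularEquiv_normalMap_neg`). Completeness
of the invariants follows, as unimodular equivalence is symmetric and transitive.
-/

open scoped ContDiff

noncomputable section

namespace UnimodularTori

open Set Metric Filter Topology MeasureTheory Function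

section
/-! ### Holomorphic functions of several variables -/

section SCV
variable {E G : Type*} [NormedAddCommGroup E] [NormedSpace ℂ E]
  [NormedAddCommGroup G] [NormedSpace ℂ G]

/-- Cauchy estimate, uniform on the concentric ball of half the radius. -/
theorem norm_fderiv_le_of_bounded_on_ball {f : E → G} {c : E} {R M : ℝ} (hR : 0 < R)
    (hf : DifferentiableOn ℂ f (ball c (2 * R))) (hM : ∀ x ∈ ball c (2 * R), ‖f x‖ ≤ M) :
    ∀ x ∈ ball c R, ‖fderiv ℂ f x‖ ≤ 2 * M / R := by
  intro x hx
  have hsub : ball x R ⊆ ball c (2 * R) := by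
    intro y hy
    rw [mem_ball] at *
    linarith [dist_triangle y x c]
  refine Complex.norm_fderiv_le_div_of_mapsTo_ball (hf.mono hsub) (fun y hy => ?_) hR
  rw [mem_closedBall, dist_eq_norm]
  have h1 := hM y (hsub hy)
  have h2 := hM x (hsub (mem_ball_self hR))
  linarith [norm_sub_le (f y) (f x)]

/-- Cauchy estimate at the centre of a ball. -/
theorem norm_fderiv_le_of_bounded {f : E → G} {x : E} {R M : ℝ} (hR : 0 < R)
    (hf : DifferentiableOn ℂ f (ball x R)) (hM : ∀ y ∈ ball x R, ‖f y‖ ≤ M) :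
    ‖fderiv ℂ f x‖ ≤ 2 * M / R := by
  refine Complex.norm_fderiv_le_div_of_mapsTo_ball hf (fun y hy => ?_) hR
  rw [mem_closedBall, dist_eq_norm]
  linarith [norm_sub_le (f y) (f x), hM y hy, hM x (mem_ball_self hR)]

variable [FiniteDimensional ℂ E]

theorem aestronglyMeasurable_fderiv_param {F : E → ℝ → G} {x₀ : E} {s : Set ℝ}
    (hs : MeasurableSet s) {U : Set E} (hU : U ∈ 𝓝 x₀)
    (hm : ∀ x ∈ U, AEStronglyMeasurable (F x) (volume.restrict s))
    (hd : ∀ t ∈ s, DifferentiableAt ℂ (fun x => F x t) x₀) :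
    AEStronglyMeasurable (fun t => fderiv ℂ (fun x => F x t) x₀) (volume.restrict s) := by
  let b := Module.finBasis ℂ E
  have key : ∀ v : E, AEStronglyMeasurable (fun t => fderiv ℂ (fun x => F x t) x₀ v)
      (volume.restrict s) := by
    intro v
    have hlim : Tendsto (fun k : ℕ => x₀ + ((k : ℂ) + 1)⁻¹ • v) atTop (𝓝 x₀) := by
      have := (tendsto_one_div_add_atTop_nhds_zero_nat (𝕜 := ℂ)).smul_const v
      simpa using this.const_add x₀
    obtain ⟨N, hN⟩ := eventually_atTop.1 (hlim.eventually hU)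
    refine aestronglyMeasurable_of_tendsto_ae atTop
      (f := fun (k : ℕ) t => (((k + N : ℕ) : ℂ) + 1) •
        (F (x₀ + (((k + N : ℕ) : ℂ) + 1)⁻¹ • v) t - F x₀ t)) ?_ ?_
    · intro k
      exact ((hm _ (hN _ (by omega))).sub (hm _ (mem_of_mem_nhds hU))).const_smul _
    · refine (ae_restrict_iff' hs).2 (Eventually.of_forall fun t ht => ?_)
      refine (hd t ht).hasFDerivAt.lim v (c := fun k : ℕ => (((k + N : ℕ) : ℂ) + 1)) (l := atTop) ?_
      have : (fun k : ℕ => ‖(((k + N : ℕ) : ℂ) + 1)‖) = fun k : ℕ => ((k + (N + 1) : ℕ) : ℝ) := by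
        funext k
        rw [show (((k + N : ℕ) : ℂ) + 1) = ((k + (N + 1) : ℕ) : ℂ) by push_cast; ring,
          Complex.norm_natCast]
      rw [this]
      exact tendsto_natCast_atTop_atTop.comp (tendsto_add_atTop_nat (N + 1))
  have hsum : (fun t => fderiv ℂ (fun x => F x t) x₀) = fun t => ∑ i,
      ContinuousLinearMap.smulRightL ℂ E G (LinearMap.toContinuousLinearMap (b.coord i))
        (fderiv ℂ (fun x => F x t) x₀ (b i)) := by
    funext t
    ext v
    conv_lhs => rw [← b.sum_repr v, map_sum]
    simp
  rw [hsum]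
  refine Finset.aestronglyMeasurable_fun_sum _ fun i _ => ?_
  exact (ContinuousLinearMap.continuous _).comp_aestronglyMeasurable (key (b i))

/-- Integrals of holomorphic functions depending continuously on a parameter are holomorphic. -/
theorem differentiableOn_intervalIntegral [CompleteSpace G] {F : E → ℝ → G} {U : Set E} (hU : IsOpen U) {a b : ℝ}
    (hc : ContinuousOn (uncurry F) (U ×ˢ uIcc a b))
    (hd : ∀ t ∈ uIcc a b, DifferentiableOn ℂ (fun x => F x t) U) :
    DifferentiableOn ℂ (fun x => ∫ t in a..b, F x t) U := by
  have : ProperSpace E := FiniteDimensional.proper ℂ E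
  intro x₀ hx₀
  obtain ⟨R', hR', hsub'⟩ := Metric.isOpen_iff.1 hU x₀ hx₀
  set R := R' / 4 with hRdef
  have hR : 0 < R := by positivity
  have hsub : closedBall x₀ (2 * R) ⊆ U :=
    (closedBall_subset_ball (by linarith)).trans hsub'
  obtain ⟨M, hM⟩ := ((isCompact_closedBall x₀ (2 * R)).prod
    (isCompact_uIcc (a := a) (b := b))).exists_bound_of_continuousOn
    (hc.mono (prod_mono hsub subset_rfl))
  have hcx : ∀ x ∈ U, ContinuousOn (F x) (uIcc a b) := fun x hx =>
    hc.comp (f := fun t => (x, t)) (by fun_prop) (fun t ht => ⟨hx, ht⟩)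
  have hbs : ball x₀ (2 * R) ⊆ U := ball_subset_closedBall.trans hsub
  have hM0 : 0 ≤ M := (norm_nonneg _).trans (hM (x₀, a) ⟨mem_closedBall_self (by linarith), left_mem_uIcc⟩)
  refine ((intervalIntegral.hasFDerivAt_integral_of_dominated_loc_of_lip (μ := volume)
    (F := F) (F' := fun t => fderiv ℂ (fun x => F x t) x₀) (s := ball x₀ R)
    (bound := fun _ => 2 * M / R) (ball_mem_nhds x₀ hR) ?_ ?_ ?_ ?_ ?_ ?_).2).differentiableAt.differentiableWithinAt
  · filter_upwards [hU.mem_nhds hx₀] with x hx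
    exact ((hcx x hx).mono uIoc_subset_uIcc).aestronglyMeasurable measurableSet_uIoc
  · exact (hcx x₀ hx₀).intervalIntegrable
  · refine aestronglyMeasurable_fderiv_param measurableSet_uIoc (hU.mem_nhds hx₀) ?_ ?_
    · intro x hx
      exact ((hcx x hx).mono uIoc_subset_uIcc).aestronglyMeasurable measurableSet_uIoc
    · intro t ht
      exact (hd t (uIoc_subset_uIcc ht)).differentiableAt (hU.mem_nhds hx₀)
  · refine Eventually.of_forall fun t ht => ?_
    have ht' := uIoc_subset_uIcc ht
    refine Convex.lipschitzOnWith_of_nnnorm_fderiv_le (𝕜 := ℂ) (fun x hx => ?_) (fun x hx => ?_)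
      (convex_ball x₀ R)
    · exact (hd t ht').differentiableAt (hU.mem_nhds (hbs (ball_subset_ball (by linarith) hx)))
    · have := norm_fderiv_le_of_bounded_on_ball hR ((hd t ht').mono hbs)
        (fun y hy => hM (y, t) ⟨ball_subset_closedBall hy, ht'⟩) x hx
      rw [← NNReal.coe_le_coe]
      rw [Real.coe_nnabs, abs_of_nonneg (by positivity)]
      exact this
  · exact intervalIntegrable_const
  · refine Eventually.of_forall fun t ht => ?_
    exact ((hd t (uIoc_subset_uIcc ht)).differentiableAt (hU.mem_nhds hx₀)).hasFDerivAt

/-- Partial derivatives of a holomorphic function are holomorphic, by the Cauchy formula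
`∂_v f(x) = (2πR)⁻¹ ∫ e^{-it} f(x + R e^{it} v) dt`. -/
theorem differentiableOn_fderiv_apply [CompleteSpace G] {f : E → G} {U : Set E} (hU : IsOpen U)
    (hf : DifferentiableOn ℂ f U) (v : E) :
    DifferentiableOn ℂ (fun x => fderiv ℂ f x v) U := by
  intro x₀ hx₀
  obtain ⟨ε, hε, hsub⟩ := Metric.isOpen_iff.1 hU x₀ hx₀
  set R : ℝ := ε / 2 / (‖v‖ + 1) with hRdef
  have hR : 0 < R := by positivity
  have hRv : R * ‖v‖ < ε / 2 := by
    rw [hRdef, div_mul_eq_mul_div, div_lt_iff₀ (by positivity)]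
    nlinarith
  have hin : ∀ x ∈ ball x₀ (ε / 2), ∀ ζ : ℂ, ‖ζ‖ ≤ R → x + ζ • v ∈ U := by
    intro x hx ζ hζ
    apply hsub
    rw [mem_ball, dist_eq_norm] at *
    have : x + ζ • v - x₀ = (x - x₀) + ζ • v := by abel
    rw [this]
    calc _ ≤ ‖x - x₀‖ + ‖ζ‖ * ‖v‖ := by rw [← norm_smul]; exact norm_add_le _ _
      _ ≤ ‖x - x₀‖ + R * ‖v‖ := by gcongr
      _ < ε := by linarith
  have hform : ∀ x ∈ ball x₀ (ε / 2), fderiv ℂ f x v =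
      (2 * Real.pi * Complex.I : ℂ)⁻¹ • ∫ t in (0 : ℝ)..(2 * Real.pi),
        deriv (circleMap 0 R) t • ((circleMap 0 R t) ^ 2)⁻¹ • f (x + circleMap 0 R t • v) := by
    intro x hx
    have hd1 : DifferentiableOn ℂ (fun ζ : ℂ => f (x + ζ • v)) (closedBall 0 R) := by
      intro ζ hζ
      refine DifferentiableAt.differentiableWithinAt ?_
      have h1 : DifferentiableAt ℂ f (x + ζ • v) :=
        hf.differentiableAt (hU.mem_nhds (hin x hx ζ (by simpa using hζ)))
      exact h1.comp (f := fun ζ : ℂ => x + ζ • v) ζ (by fun_prop)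
    have h0 : HasDerivAt (fun ζ : ℂ => f (x + ζ • v)) (fderiv ℂ f x v) 0 := by
      have h1 : HasFDerivAt f (fderiv ℂ f x) (x + (0 : ℂ) • v) := by
        have := hin x hx 0 (by simpa using hR.le)
        simpa using (hf.differentiableAt (hU.mem_nhds (by simpa using this))).hasFDerivAt
      have h2 : HasDerivAt (fun ζ : ℂ => x + ζ • v) v 0 := by
        simpa using ((hasDerivAt_id (0 : ℂ)).smul_const v).const_add x
      exact h1.comp_hasDerivAt (0 : ℂ) h2
    rw [← h0.deriv]
    have := (hd1.diffContOnCl_ball subset_rfl).deriv_eq_smul_circleIntegral hR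
    rw [eq_inv_smul_iff₀ Complex.two_pi_I_ne_zero, ← this]
    simp only [circleIntegral, sub_zero, one_div]
  have hmain : DifferentiableOn ℂ (fun x => ∫ t in (0 : ℝ)..(2 * Real.pi),
      deriv (circleMap 0 R) t • ((circleMap 0 R t) ^ 2)⁻¹ • f (x + circleMap 0 R t • v))
      (ball x₀ (ε / 2)) := by
    refine differentiableOn_intervalIntegral isOpen_ball ?_ ?_
    · have hc1 : ContinuousOn (fun p : E × ℝ => f (p.1 + circleMap 0 R p.2 • v))
          (ball x₀ (ε / 2) ×ˢ uIcc 0 (2 * Real.pi)) := by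
        refine hf.continuousOn.comp (by fun_prop) ?_
        rintro ⟨x, t⟩ ⟨hx, -⟩
        exact hin x hx _ (by simp [abs_of_pos hR])
      have hne : ∀ t, circleMap 0 R t ≠ 0 := fun t => circleMap_ne_center hR.ne'
      simp only [uncurry_def, deriv_circleMap]
      refine ContinuousOn.smul (by fun_prop) (ContinuousOn.smul ?_ hc1)
      exact Continuous.continuousOn (by
        refine Continuous.inv₀ (by fun_prop) fun p => pow_ne_zero 2 (hne _))
    · intro t _ x hx
      refine DifferentiableAt.differentiableWithinAt ?_
      refine DifferentiableAt.const_smul (DifferentiableAt.const_smul ?_ _) _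
      have h1 : DifferentiableAt ℂ f (x + circleMap 0 R t • v) :=
        hf.differentiableAt (hU.mem_nhds (hin x hx _ (by simp [abs_of_pos hR])))
      exact h1.comp (f := fun x : E => x + circleMap 0 R t • v) x (by fun_prop)
  have hmem : ball x₀ (ε / 2) ∈ 𝓝 x₀ := ball_mem_nhds _ (by linarith)
  refine DifferentiableAt.differentiableWithinAt ?_
  refine DifferentiableAt.congr_of_eventuallyEq
    ((hmain.differentiableAt hmem).const_smul ((2 * Real.pi * Complex.I : ℂ)⁻¹)) ?_
  filter_upwards [hmem] with x hx using hform x hx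

theorem differentiableOn_fderiv [CompleteSpace G] {f : E → G} {U : Set E} (hU : IsOpen U)
    (hf : DifferentiableOn ℂ f U) : DifferentiableOn ℂ (fderiv ℂ f) U := by
  let b := Module.finBasis ℂ E
  have hsum : fderiv ℂ f = fun x => ∑ i,
      ContinuousLinearMap.smulRightL ℂ E G (LinearMap.toContinuousLinearMap (b.coord i))
        (fderiv ℂ f x (b i)) := by
    funext x
    ext v
    conv_lhs => rw [← b.sum_repr v, map_sum]
    simp
  rw [hsum]
  refine DifferentiableOn.fun_sum fun i _ => ?_
  exact (ContinuousLinearMap.differentiable _).comp_differentiableOn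
    (differentiableOn_fderiv_apply hU hf (b i))

theorem contDiffOn_one_of_differentiableOn [CompleteSpace G] {f : E → G} {U : Set E}
    (hU : IsOpen U) (hf : DifferentiableOn ℂ f U) : ContDiffOn ℂ 1 f U := by
  rw [show (1 : WithTop ℕ∞) = 0 + 1 from rfl, contDiffOn_succ_iff_fderiv_of_isOpen hU]
  exact ⟨hf, by simp, contDiffOn_zero.2 (differentiableOn_fderiv hU hf).continuousOn⟩

end SCV

/-! ### Strips around the real space -/

/-- The complexified strip `|Im w_j| < δ` around `ℝⁿ` in `ℂⁿ`. -/
def strip (n : ℕ) (δ : ℝ) : Set (Fin n → ℂ) := {w | ∀ j, |(w j).im| < δ}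

/-- The inclusion `ℝⁿ ⊆ ℂⁿ`. -/
def toC {n : ℕ} (x : Fin n → ℝ) : Fin n → ℂ := fun j => (x j : ℂ)

variable {n : ℕ} {δ : ℝ}

theorem isOpen_strip : IsOpen (strip n δ) := by
  simp only [strip, ofPred_forall]
  exact isOpen_iInter_of_finite fun j =>
    isOpen_lt (by fun_prop) continuous_const

theorem convex_strip : Convex ℝ (strip n δ) := by
  intro x hx y hy a b ha hb hab j
  simp only [Pi.add_apply, Pi.smul_apply, Complex.add_im, Complex.real_smul, Complex.mul_im,
    Complex.ofReal_re, Complex.ofReal_im, zero_mul, add_zero]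
  have h1 := abs_lt.1 (hx j)
  have h2 := abs_lt.1 (hy j)
  rw [abs_lt]
  rcases eq_or_lt_of_le ha with rfl | ha'
  · have : b = 1 := by linarith
    subst this
    constructor <;> linarith
  · constructor <;> nlinarith

theorem toC_mem_strip (hδ : 0 < δ) (x : Fin n → ℝ) : toC x ∈ strip n δ := by
  intro j; simpa [toC] using hδ

/-- A holomorphic function on a strip is determined by its values on `ℝⁿ`: every point lies on a
complex line `ζ ↦ Re w + ζ Im w` whose real points are in `ℝⁿ`. -/
theorem eqOn_strip_of_eq_real {G : Type*} [NormedAddCommGroup G] [NormedSpace ℂ G] [CompleteSpace G]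
    (hδ : 0 < δ) {f g : (Fin n → ℂ) → G}
    (hf : DifferentiableOn ℂ f (strip n δ)) (hg : DifferentiableOn ℂ g (strip n δ))
    (h : ∀ x : Fin n → ℝ, f (toC x) = g (toC x)) : EqOn f g (strip n δ) := by
  intro w hw
  let γ : ℂ → (Fin n → ℂ) := fun ζ j => ((w j).re : ℂ) + ζ * ((w j).im : ℂ)
  have hγd : Differentiable ℂ γ := by
    rw [differentiable_pi]
    intro j
    fun_prop
  let U : Set ℂ := γ ⁻¹' strip n δ
  have hUo : IsOpen U := isOpen_strip.preimage hγd.continuous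
  have hUc : Convex ℝ U := by
    intro x hx y hy a b ha hb hab
    have : γ (a • x + b • y) = a • γ x + b • γ y := by
      funext j
      simp only [γ, Pi.add_apply, Pi.smul_apply, Complex.real_smul]
      have : (a : ℂ) + b = 1 := by exact_mod_cast hab
      linear_combination (-(w j).re : ℂ) * this
    simp only [U, mem_preimage]
    rw [this]
    exact convex_strip hx hy ha hb hab
  have hreal : ∀ t : ℝ, γ t = toC (fun j => (w j).re + t * (w j).im) := by
    intro t; funext j; simp [γ, toC]
  have h0 : (0 : ℂ) ∈ U := by
    have := hreal 0
    simp only [U, mem_preimage]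
    rw [← Complex.ofReal_zero, hreal]
    exact toC_mem_strip hδ _
  have hI : γ Complex.I = w := by
    funext j
    simp only [γ]
    rw [mul_comm]
    exact Complex.re_add_im _
  have hIU : Complex.I ∈ U := by
    simp only [U, mem_preimage, hI]; exact hw
  have hfa : AnalyticOnNhd ℂ (f ∘ γ) U :=
    (hf.comp hγd.differentiableOn (fun x hx => hx)).analyticOnNhd hUo
  have hga : AnalyticOnNhd ℂ (g ∘ γ) U :=
    (hg.comp hγd.differentiableOn (fun x hx => hx)).analyticOnNhd hUo
  have hfreq : ∃ᶠ z in 𝓝[≠] (0 : ℂ), (f ∘ γ) z = (g ∘ γ) z := by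
    have hT : Tendsto (fun t : ℝ => (t : ℂ)) (𝓝[≠] 0) (𝓝[≠] 0) := by
      refine tendsto_nhdsWithin_iff.2 ⟨?_, ?_⟩
      · exact (Complex.continuous_ofReal.tendsto' 0 0 (by simp)).mono_left nhdsWithin_le_nhds
      · filter_upwards [self_mem_nhdsWithin] with t ht
        simpa using ht
    refine hT.frequently (Eventually.frequently (Eventually.of_forall fun t => ?_))
    simp [Function.comp, hreal, h]
  have := hfa.eqOn_of_preconnected_of_frequently_eq hga hUc.isPreconnected h0 hfreq hIU
  simpa [Function.comp, hI] using this

end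

section
/-! ### Periodic densities and their triangular rearrangement -/

variable {n : ℕ} {δ : ℝ}

/-- Mean value of a function on `ℂⁿ` over a period of the real line in the `j`-th direction. -/
def sliceMean (j : Fin n) (f : (Fin n → ℂ) → ℂ) (x : Fin n → ℂ) : ℂ :=
  (2 * Real.pi : ℂ)⁻¹ * ∫ s in (0 : ℝ)..(2 * Real.pi), f (update x j (s : ℂ))

/-- Primitive of a function on `ℂⁿ` in the `j`-th variable, vanishing for `x_j = 0`. -/
def slicePrim (j : Fin n) (f : (Fin n → ℂ) → ℂ) (x : Fin n → ℂ) : ℂ :=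
  x j * ∫ u in (0 : ℝ)..1, f (update x j ((u : ℂ) * x j))

theorem update_ofReal_mem_strip (hδ : 0 < δ) {x : Fin n → ℂ} (hx : x ∈ strip n δ) (j : Fin n)
    (s : ℝ) : update x j (s : ℂ) ∈ strip n δ := by
  intro i
  by_cases h : i = j
  · subst h; simp [hδ]
  · simpa [h] using hx i

theorem update_smul_mem_strip {x : Fin n → ℂ} (hx : x ∈ strip n δ) (j : Fin n)
    {u : ℝ} (hu : u ∈ Icc (0 : ℝ) 1) : update x j ((u : ℂ) * x j) ∈ strip n δ := by
  intro i
  by_cases h : i = j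
  · subst h
    simp only [update_self, Complex.mul_im, Complex.ofReal_re, Complex.ofReal_im, zero_mul,
      add_zero, abs_mul, abs_of_nonneg hu.1]
    exact (mul_le_of_le_one_left (abs_nonneg _) hu.2).trans_lt (hx i)
  · simpa [h] using hx i

theorem update_toC (x : Fin n → ℝ) (j : Fin n) (s : ℝ) :
    update (toC x) j (s : ℂ) = toC (update x j s) := by
  funext i
  by_cases h : i = j
  · subst h; simp [toC]
  · simp [toC, h]

theorem differentiable_update (j : Fin n) : Differentiable ℂ
    (fun p : (Fin n → ℂ) × ℂ => update p.1 j p.2) := by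
  rw [differentiable_pi]
  intro i
  by_cases h : i = j
  · subst h; simp
  · simp only [update_of_ne h]; fun_prop

theorem differentiableOn_sliceMean (hδ : 0 < δ) {f : (Fin n → ℂ) → ℂ}
    (hf : DifferentiableOn ℂ f (strip n δ)) (j : Fin n) :
    DifferentiableOn ℂ (sliceMean j f) (strip n δ) := by
  refine DifferentiableOn.const_mul (differentiableOn_intervalIntegral isOpen_strip ?_ ?_) _
  · refine hf.continuousOn.comp (f := fun p : (Fin n → ℂ) × ℝ => update p.1 j (p.2 : ℂ)) ?_ ?_
    · exact ((differentiable_update j).continuous.comp (by fun_prop :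
        Continuous fun p : (Fin n → ℂ) × ℝ => (p.1, (p.2 : ℂ)))).continuousOn
    · rintro ⟨x, t⟩ ⟨hx, -⟩
      exact update_ofReal_mem_strip hδ hx j t
  · intro t _
    refine hf.comp (f := fun x => update x j (t : ℂ)) ?_
      (fun x hx => update_ofReal_mem_strip hδ hx j t)
    exact ((differentiable_update j).comp (by fun_prop :
      Differentiable ℂ fun x : Fin n → ℂ => (x, (t : ℂ)))).differentiableOn

theorem differentiableOn_slicePrim {f : (Fin n → ℂ) → ℂ}
    (hf : DifferentiableOn ℂ f (strip n δ)) (j : Fin n) :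
    DifferentiableOn ℂ (slicePrim j f) (strip n δ) := by
  refine DifferentiableOn.mul (by fun_prop) (differentiableOn_intervalIntegral isOpen_strip ?_ ?_)
  · refine hf.continuousOn.comp
      (f := fun p : (Fin n → ℂ) × ℝ => update p.1 j ((p.2 : ℂ) * p.1 j)) ?_ ?_
    · exact ((differentiable_update j).continuous.comp (by fun_prop :
        Continuous fun p : (Fin n → ℂ) × ℝ => (p.1, (p.2 : ℂ) * p.1 j))).continuousOn
    · rintro ⟨x, t⟩ ⟨hx, ht⟩
      rw [uIcc_of_le zero_le_one] at ht
      exact update_smul_mem_strip hx j ht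
  · intro t ht
    rw [uIcc_of_le zero_le_one] at ht
    refine hf.comp (f := fun x => update x j ((t : ℂ) * x j)) ?_
      (fun x hx => update_smul_mem_strip hx j ht)
    exact ((differentiable_update j).comp (by fun_prop :
      Differentiable ℂ fun x : Fin n → ℂ => (x, (t : ℂ) * x j))).differentiableOn

theorem hasDerivAt_slicePrim {f : (Fin n → ℂ) → ℂ}
    (hf : DifferentiableOn ℂ f (strip n δ)) (j : Fin n) {x : Fin n → ℂ} (hx : x ∈ strip n δ) :
    HasDerivAt (fun z => slicePrim j f (update x j z)) (f x) (x j) := by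
  set S : Set ℂ := {z | |z.im| < δ} with hS
  have hSo : IsOpen S := isOpen_lt (by fun_prop) continuous_const
  have hup : ∀ z ∈ S, update x j z ∈ strip n δ := by
    intro z hz i
    by_cases h : i = j
    · subst h; simpa [hS] using hz
    · simpa [h] using hx i
  have hSc : Convex ℝ S := by
    have : S = (fun z : ℂ => z.im) ⁻¹' (Ioo (-δ) δ) := by
      ext z; simp [hS, abs_lt]
    rw [this]
    exact (convex_Ioo _ _).linear_preimage Complex.imLm
  have hud : Differentiable ℂ (fun z : ℂ => update x j z) :=
    (differentiable_update j).comp (by fun_prop : Differentiable ℂ fun z : ℂ => (x, z))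
  obtain ⟨g, hg⟩ := hSc.exists_forall_hasDerivWithinAt
    (f := fun z => f (update x j z)) (𝕜 := ℂ) (hf.comp hud.differentiableOn hup)
  have hg' : ∀ z ∈ S, HasDerivAt g (f (update x j z)) z := fun z hz =>
    (hg z hz).hasDerivAt (hSo.mem_nhds hz)
  have hxj : x j ∈ S := hx j
  have h0 : 0 < δ := (abs_nonneg _).trans_lt hxj
  have hkey : ∀ z ∈ S, slicePrim j f (update x j z) = g z - g 0 := by
    intro z hz
    have hsm : ∀ u ∈ Icc (0 : ℝ) 1, (u : ℂ) * z ∈ S := by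
      intro u hu
      have := update_smul_mem_strip (hup z hz) j hu j
      rw [update_self, update_self] at this
      exact this
    have hftc := intervalIntegral.integral_eq_sub_of_hasDerivAt (a := 0) (b := 1)
      (f := fun u : ℝ => g ((u : ℂ) * z)) (f' := fun u : ℝ => z * f (update x j ((u : ℂ) * z)))
      ?_ ?_
    · simp only [slicePrim, update_self, update_idem]
      rw [← intervalIntegral.integral_const_mul]
      simpa using hftc
    · intro u hu
      rw [uIcc_of_le zero_le_one] at hu
      have h1 := hg' _ (hsm u hu)
      have h2 : HasDerivAt (fun u : ℝ => (u : ℂ) * z) z u := by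
        simpa using ((hasDerivAt_id u).ofReal_comp).mul_const z
      have := h1.scomp u h2
      simpa [Function.comp_def, smul_eq_mul] using this
    · refine ContinuousOn.intervalIntegrable ?_
      rw [uIcc_of_le zero_le_one]
      refine ContinuousOn.mul continuousOn_const ?_
      refine hf.continuousOn.comp (f := fun u : ℝ => update x j ((u : ℂ) * z)) ?_ ?_
      · exact (hud.continuous.comp (by fun_prop : Continuous fun u : ℝ => (u : ℂ) * z)).continuousOn
      · exact fun u hu => hup _ (hsm u hu)
  have hfin : HasDerivAt (fun z => g z - g 0) (f x) (x j) := by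
    simpa using (hg' _ hxj).sub_const (g 0)
  refine hfin.congr_of_eventuallyEq ?_
  filter_upwards [hSo.mem_nhds hxj] with z hz using hkey z hz

theorem slicePrim_toC (j : Fin n) (f : (Fin n → ℂ) → ℂ) (x : Fin n → ℝ) :
    slicePrim j f (toC x) = ∫ s in (0 : ℝ)..x j, f (toC (update x j s)) := by
  have h := intervalIntegral.smul_integral_comp_mul_right (a := 0) (b := 1)
    (fun s : ℝ => f (toC (update x j s))) (x j)
  simp only [zero_mul, one_mul] at h
  rw [← h, slicePrim, Complex.real_smul]
  congr 1
  refine intervalIntegral.integral_congr fun u _ => ?_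
  simp only [← update_toC]
  simp [toC]

theorem sliceMean_toC (j : Fin n) (f : (Fin n → ℂ) → ℂ) (x : Fin n → ℝ) :
    sliceMean j f (toC x) =
      (2 * Real.pi : ℂ)⁻¹ * ∫ s in (0 : ℝ)..(2 * Real.pi), f (toC (update x j s)) := by
  simp only [sliceMean, update_toC]

theorem intervalIntegral_im_eq_zero {f : ℝ → ℂ} {a b : ℝ} (hf : ∀ t, (f t).im = 0) :
    (∫ t in a..b, f t).im = 0 := by
  have : f = fun t => ((f t).re : ℂ) := by
    funext t; exact Complex.ext (by simp) (by simp [hf t])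
  rw [this, intervalIntegral.integral_ofReal, Complex.ofReal_im]

theorem intervalIntegral_re_pos {f : ℝ → ℂ} {a b : ℝ} (hab : a < b) (hc : ContinuousOn f (Icc a b))
    (hf : ∀ t, 0 < (f t).re) : 0 < (∫ t in a..b, f t).re := by
  have hi : IntervalIntegrable f volume a b := ContinuousOn.intervalIntegrable (by
    rwa [uIcc_of_le hab.le])
  have := intervalIntegral.intervalIntegral_re (𝕜 := ℂ) (f := f) (a := a) (b := b) (μ := volume) hi
  have h2 : (∫ t in a..b, f t).re = ∫ t in a..b, (f t).re := by
    simpa using this.symm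
  rw [h2]
  refine intervalIntegral.intervalIntegral_pos_of_pos_on ?_ (fun t _ => hf t) hab
  refine ContinuousOn.intervalIntegrable ?_
  rw [uIcc_of_le hab.le]
  exact Complex.continuous_re.comp_continuousOn hc

/-- The point `2πm` of the period lattice `2πℤⁿ`. -/
def lat (m : Fin n → ℤ) : Fin n → ℝ := fun j => 2 * Real.pi * m j

/-- Conditions on the holomorphic extension of a positive `2πℤⁿ`-periodic density on `ℝⁿ`. -/
structure IsDensity (δ : ℝ) (f : (Fin n → ℂ) → ℂ) : Prop where
  differentiableOn : DifferentiableOn ℂ f (strip n δ)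
  re_pos : ∀ w ∈ strip n δ, 0 < (f w).re
  im_eq_zero : ∀ x : Fin n → ℝ, (f (toC x)).im = 0
  periodic : ∀ (x : Fin n → ℝ) (m : Fin n → ℤ), f (toC (x + lat m)) = f (toC x)

theorem update_add_lat (x : Fin n → ℝ) (m : Fin n → ℤ) (j : Fin n) (s : ℝ) :
    update (x + lat m) j s = update x j s + lat (update m j 0) := by
  funext i
  by_cases h : i = j
  · subst h; simp [lat]
  · simp [lat, h]

theorem continuous_update_ofReal (x : Fin n → ℂ) (j : Fin n) :
    Continuous fun s : ℝ => update x j (s : ℂ) :=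
  (differentiable_update j).continuous.comp (by fun_prop : Continuous fun s : ℝ => (x, (s : ℂ)))

namespace IsDensity
variable {f : (Fin n → ℂ) → ℂ}

theorem update_lat (hf : IsDensity δ f) (x : Fin n → ℝ) (m : Fin n → ℤ) (j : Fin n) (s : ℝ) :
    f (toC (update (x + lat m) j s)) = f (toC (update x j s)) := by
  rw [update_add_lat, hf.periodic]

theorem sliceMean (hδ : 0 < δ) (hf : IsDensity δ f) (j : Fin n) :
    IsDensity δ (sliceMean j f) where
  differentiableOn := differentiableOn_sliceMean hδ hf.differentiableOn j
  re_pos := by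
    intro w hw
    have h1 : ((2 * Real.pi : ℂ)⁻¹) = (((2 * Real.pi)⁻¹ : ℝ) : ℂ) := by push_cast; rfl
    rw [UnimodularTori.sliceMean, h1, Complex.re_ofReal_mul]
    refine mul_pos (by positivity) (intervalIntegral_re_pos (by positivity) ?_ fun t =>
      hf.re_pos _ (update_ofReal_mem_strip hδ hw j t))
    exact hf.differentiableOn.continuousOn.comp (continuous_update_ofReal w j).continuousOn
      fun t _ => update_ofReal_mem_strip hδ hw j t
  im_eq_zero := by
    intro x
    have h1 : ((2 * Real.pi : ℂ)⁻¹) = (((2 * Real.pi)⁻¹ : ℝ) : ℂ) := by push_cast; rfl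
    rw [sliceMean_toC, h1, Complex.im_ofReal_mul,
      intervalIntegral_im_eq_zero fun t => hf.im_eq_zero _, mul_zero]
  periodic := by
    intro x m
    simp only [sliceMean_toC, hf.update_lat]

theorem continuous_update (hδ : 0 < δ) (hf : IsDensity δ f) (x : Fin n → ℝ) (j : Fin n) :
    Continuous fun s : ℝ => f (toC (update x j s)) := by
  simp only [← update_toC]
  exact hf.differentiableOn.continuousOn.comp_continuous (continuous_update_ofReal _ j)
    fun t => update_ofReal_mem_strip hδ (toC_mem_strip hδ x) j t

theorem slicePrim_add_lat (hδ : 0 < δ) (hf : IsDensity δ f) (j : Fin n) (x : Fin n → ℝ)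
    (m : Fin n → ℤ) : slicePrim j f (toC (x + lat m)) =
      slicePrim j f (toC x) + 2 * Real.pi * m j * UnimodularTori.sliceMean j f (toC x) := by
  have hper : Function.Periodic (fun s : ℝ => f (toC (update x j s))) (2 * Real.pi) := by
    intro s
    have h : update x j (s + 2 * Real.pi) = update x j s + lat (Pi.single j 1) := by
      funext i
      by_cases h : i = j
      · subst h; simp [lat]
      · simp [lat, h]
    simp only [h, hf.periodic]
  have hint : ∀ a b, IntervalIntegrable (fun s : ℝ => f (toC (update x j s))) volume a b :=
    fun a b => (hf.continuous_update hδ x j).intervalIntegrable a b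
  rw [slicePrim_toC, slicePrim_toC, sliceMean_toC]
  simp only [hf.update_lat]
  have h1 : (x + lat m) j = x j + m j • (2 * Real.pi) := by
    simp [lat]; ring
  rw [h1, ← intervalIntegral.integral_add_adjacent_intervals (hint 0 (x j)) (hint _ _),
    hper.intervalIntegral_add_zsmul_eq (m j) (x j) hint]
  rw [hper.intervalIntegral_add_eq (x j) 0, zero_add]
  congr 1
  have : (Real.pi : ℂ) ≠ 0 := by exact_mod_cast Real.pi_ne_zero
  rw [zsmul_eq_mul]
  field_simp

end IsDensity

theorem sliceMean_congr {k : Fin n} {f : (Fin n → ℂ) → ℂ} {x y : Fin n → ℂ}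
    (hf : ∀ x y : Fin n → ℂ, (∀ i : Fin n, (i : ℕ) < k + 1 → x i = y i) → f x = f y)
    (h : ∀ i : Fin n, (i : ℕ) < k → x i = y i) : sliceMean k f x = sliceMean k f y := by
  simp only [sliceMean]
  congr 1
  refine intervalIntegral.integral_congr fun s _ => hf _ _ fun i hi => ?_
  by_cases hik : i = k
  · subst hik; simp
  · have : (i : ℕ) < k := by
      have : (i : ℕ) ≠ k := fun h => hik (Fin.ext h)
      omega
    simp [hik, h i this]

theorem slicePrim_congr {k : Fin n} {f : (Fin n → ℂ) → ℂ} {x y : Fin n → ℂ}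
    (hf : ∀ x y : Fin n → ℂ, (∀ i : Fin n, (i : ℕ) < k + 1 → x i = y i) → f x = f y)
    (h : ∀ i : Fin n, (i : ℕ) < k + 1 → x i = y i) : slicePrim k f x = slicePrim k f y := by
  simp only [slicePrim]
  rw [h k (by omega)]
  congr 1
  refine intervalIntegral.integral_congr fun s _ => hf _ _ fun i hi => ?_
  by_cases hik : i = k
  · subst hik; simp
  · simp [hik, h i hi]

/-- The successive means of a density over its last `k` variables. -/
def tailMean (q : (Fin n → ℂ) → ℂ) : ℕ → (Fin n → ℂ) → ℂ
  | 0 => q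
  | k + 1 => if h : k < n then sliceMean ⟨n - 1 - k, by omega⟩ (tailMean q k) else tailMean q k

theorem isDensity_tailMean (hδ : 0 < δ) {q : (Fin n → ℂ) → ℂ} (hq : IsDensity δ q) (k : ℕ) :
    IsDensity δ (tailMean q k) := by
  induction k with
  | zero => exact hq
  | succ k ih =>
    simp only [tailMean]
    split
    · exact ih.sliceMean hδ _
    · exact ih

theorem tailMean_congr (q : (Fin n → ℂ) → ℂ) (k : ℕ) (hk : k ≤ n) (x y : Fin n → ℂ)
    (h : ∀ i : Fin n, (i : ℕ) < n - k → x i = y i) : tailMean q k x = tailMean q k y := by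
  induction k generalizing x y with
  | zero =>
    have : x = y := funext fun i => h i (by omega)
    rw [this]
  | succ k ih =>
    simp only [tailMean, dif_pos (show k < n by omega)]
    refine sliceMean_congr (fun x y h => ih (by omega) x y fun i hi => h i ?_) fun i hi => h i ?_
    · simp only; omega
    · simp only at hi; omega

theorem tailMean_sub (q : (Fin n → ℂ) → ℂ) (j : Fin n) :
    tailMean q (n - j) = sliceMean j (tailMean q (n - (j + 1))) := by
  have h : n - (j : ℕ) = (n - (j + 1)) + 1 := by omega
  rw [h]
  simp only [tailMean, dif_pos (show n - ((j : ℕ) + 1) < n by omega)]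
  congr 1
  apply Fin.ext
  simp only
  omega

/-- The Knothe–Rosenblatt rearrangement: a positive periodic density `q` on `ℝⁿ` with holomorphic
extension to a strip is, up to the constant `ρ`, the Jacobian of a triangular map `Y` that commutes
with the period lattice. The `j`-th component of `Y` is the conditional distribution function of the
`j`-th variable, the preceding ones being fixed. -/
theorem exists_triangular_rearrangement (hδ : 0 < δ) {q : (Fin n → ℂ) → ℂ} (hq : IsDensity δ q) :
    ∃ (ρ : ℝ) (Y : (Fin n → ℂ) → (Fin n → ℂ)), 0 < ρ ∧ DifferentiableOn ℂ Y (strip n δ) ∧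
      (∀ x j, (Y (toC x) j).im = 0) ∧
      (∀ (x : Fin n → ℝ) (m : Fin n → ℤ), Y (toC (x + lat m)) = Y (toC x) + toC (lat m)) ∧
      (∀ j x y, (∀ i ≤ j, x i = y i) → Y x j = Y y j) ∧
      (∀ (x : Fin n → ℝ) j, 0 < (fderiv ℂ Y (toC x) (Pi.single j 1) j).re ∧
        (fderiv ℂ Y (toC x) (Pi.single j 1) j).im = 0) ∧
      (∀ w ∈ strip n δ, (ρ : ℂ) * ∏ j, fderiv ℂ Y w (Pi.single j 1) j = q w) := by
  set Q : ℕ → (Fin n → ℂ) → ℂ := fun j => tailMean q (n - j) with hQdef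
  have hQ : ∀ j, IsDensity δ (Q j) := fun j => isDensity_tailMean hδ hq _
  have hQne : ∀ j, ∀ w ∈ strip n δ, Q j w ≠ 0 := by
    intro j w hw h
    have := (hQ j).re_pos w hw
    rw [h] at this
    simp at this
  have hQc : ∀ j ≤ n, ∀ x y : Fin n → ℂ, (∀ i : Fin n, (i : ℕ) < j → x i = y i) → Q j x = Q j y := by
    intro j hj x y h
    refine tailMean_congr q (n - j) (by omega) x y fun i hi => h i (by omega)
  have hQm : ∀ j : Fin n, Q j = sliceMean j (Q (j + 1)) := fun j => tailMean_sub q j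
  set Y : (Fin n → ℂ) → (Fin n → ℂ) := fun x j => slicePrim j (Q (j + 1)) x / Q j x with hYdef
  have hYd : DifferentiableOn ℂ Y (strip n δ) := by
    rw [differentiableOn_pi]
    intro j
    simp only [hYdef, div_eq_mul_inv]
    exact (differentiableOn_slicePrim (hQ _).differentiableOn j).mul
      ((hQ _).differentiableOn.fun_inv (hQne _))
  have hdiag : ∀ w ∈ strip n δ, ∀ j : Fin n,
      fderiv ℂ Y w (Pi.single j 1) j = Q (j + 1) w / Q j w := by
    intro w hw j
    have h1 : HasFDerivAt Y (fderiv ℂ Y w) (update w j (w j)) := by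
      rw [update_eq_self]
      exact (hYd.differentiableAt (isOpen_strip.mem_nhds hw)).hasFDerivAt
    have h2 := h1.comp_hasDerivAt (w j) (hasDerivAt_update w j (w j))
    have h3 := (hasDerivAt_pi.1 h2) j
    have h4 := (hasDerivAt_slicePrim (hQ (j + 1)).differentiableOn j hw).div_const (Q j w)
    refine h3.unique (h4.congr_of_eventuallyEq (Eventually.of_forall fun z => ?_))
    simp only [comp, hYdef]
    congr 1
    refine hQc j (by omega) _ _ fun i hi => ?_
    rw [update_of_ne]
    rintro rfl
    exact lt_irrefl _ hi
  have hQreal : ∀ j x, Q j (toC x) = ((Q j (toC x)).re : ℂ) := fun j x =>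
    Complex.ext (by simp) (by simp [(hQ j).im_eq_zero x])
  have hconst : ∀ w, Q 0 w = Q 0 (toC 0) := fun w => hQc 0 (by omega) _ _ (by simp)
  refine ⟨(Q 0 (toC 0)).re, Y, (hQ 0).re_pos _ (toC_mem_strip hδ 0), hYd, ?_, ?_, ?_, ?_, ?_⟩
  · intro x j
    simp only [hYdef]
    rw [hQreal j x, Complex.div_ofReal_im, slicePrim_toC, intervalIntegral_im_eq_zero, zero_div]
    exact fun t => (hQ _).im_eq_zero _
  · intro x m
    funext j
    simp only [hYdef, Pi.add_apply]
    rw [(hQ (j + 1)).slicePrim_add_lat hδ, (hQ j).periodic, ← hQm, add_div,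
      mul_div_cancel_right₀ _ (hQne j _ (toC_mem_strip hδ x))]
    simp [toC, lat]
  · intro j x y h
    simp only [hYdef]
    rw [hQc j (by omega) x y fun i hi => h i (by exact_mod_cast hi.le),
      slicePrim_congr (hQc (j + 1) (by omega)) fun i hi => h i (by
        rw [Fin.le_def]; omega)]
  · intro x j
    rw [hdiag _ (toC_mem_strip hδ x) j, hQreal j x, Complex.div_ofReal_re, Complex.div_ofReal_im,
      (hQ _).im_eq_zero, zero_div]
    exact ⟨div_pos ((hQ _).re_pos _ (toC_mem_strip hδ x)) ((hQ _).re_pos _ (toC_mem_strip hδ x)),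
      rfl⟩
  · intro w hw
    rw [← hQreal 0 0, ← hconst w, Finset.prod_congr rfl fun j _ => hdiag w hw j,
      Fin.prod_univ_eq_prod_range (fun j => Q (j + 1) w / Q j w) n]
    have : ∀ k, Q 0 w * ∏ j ∈ Finset.range k, Q (j + 1) w / Q j w = Q k w := by
      intro k
      induction k with
      | zero => simp
      | succ k ih => rw [Finset.prod_range_succ, ← mul_assoc, ih, mul_div_cancel₀ _ (hQne k w hw)]
    rw [this n]
    simp [hQdef, tailMean]

end

section
/-! ### Integration over the torus -/

variable {n : ℕ} {δ : ℝ}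

@[simp] theorem lat_zero : lat (0 : Fin n → ℤ) = 0 := by funext j; simp [lat]

theorem lat_add (m m' : Fin n → ℤ) : lat (m + m') = lat m + lat m' := by
  funext j; simp [lat]; ring

theorem lat_neg (m : Fin n → ℤ) : lat (-m) = -lat m := by
  funext j; simp [lat]

theorem lat_sub (m m' : Fin n → ℤ) : lat (m - m') = lat m - lat m' := by
  rw [sub_eq_add_neg, lat_add, lat_neg, sub_eq_add_neg]

/-- The period lattice `2πℤⁿ` as a subgroup of `ℝⁿ`. -/
def latticeSubgroup (n : ℕ) : AddSubgroup (Fin n → ℝ) where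
  carrier := range lat
  zero_mem' := ⟨0, lat_zero⟩
  add_mem' := by rintro _ _ ⟨m, rfl⟩ ⟨m', rfl⟩; exact ⟨m + m', lat_add m m'⟩
  neg_mem' := by rintro _ ⟨m, rfl⟩; exact ⟨-m, lat_neg m⟩

instance : Countable (latticeSubgroup n) := (countable_range (lat (n := n))).to_subtype

/-- The half-open period box `[0, 2π)ⁿ`. -/
def box (n : ℕ) : Set (Fin n → ℝ) := univ.pi fun _ => Ico 0 (2 * Real.pi)

theorem measurableSet_box : MeasurableSet (box n) :=
  MeasurableSet.univ_pi fun _ => measurableSet_Ico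

theorem box_ae_eq_Icc :
    box n =ᵐ[volume] Icc (0 : Fin n → ℝ) (fun _ => 2 * Real.pi) :=
  Measure.univ_pi_Ico_ae_eq_Icc

theorem exists_add_lat_mem_box (x : Fin n → ℝ) : ∃ m : Fin n → ℤ, x + lat m ∈ box n := by
  choose m hm using fun j => (existsUnique_add_zsmul_mem_Ico Real.two_pi_pos (x j) 0).exists
  refine ⟨m, fun j _ => ?_⟩
  have := hm j
  simpa [lat, mul_comm] using this

theorem lat_eq_zero_of_mem_box {x : Fin n → ℝ} {m : Fin n → ℤ} (hx : x ∈ box n)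
    (hm : x + lat m ∈ box n) : m = 0 := by
  funext j
  have h1 : x j ∈ Ico 0 (2 * Real.pi) := hx j (mem_univ j)
  have h2 : x j + 2 * Real.pi * m j ∈ Ico 0 (2 * Real.pi) := hm j (mem_univ j)
  have hp := Real.two_pi_pos
  have h3 : (m j : ℝ) < 1 := by
    by_contra h
    nlinarith [h1.1, h2.2]
  have h4 : -1 < (m j : ℝ) := by
    by_contra h
    nlinarith [h1.2, h2.1]
  have h5 : m j < 1 := by exact_mod_cast h3
  have h6 : -1 < m j := by exact_mod_cast h4
  simp only [Pi.zero_apply]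
  omega

/-- `X` induces a bijection of the quotient of `ℝⁿ` by the period lattice. -/
structure IsLatticeBijective (X : (Fin n → ℝ) → (Fin n → ℝ)) : Prop where
  map_add : ∀ x m, ∃ m', X (x + lat m) = X x + lat m'
  injective : ∀ x y m, X x = X y + lat m → ∃ m', x = y + lat m'
  surjective : ∀ y, ∃ x m, X x = y + lat m

theorem isAddFundamentalDomain_of_forall {s : Set (Fin n → ℝ)} (hs : MeasurableSet s)
    (hex : ∀ x, ∃ m, x + lat m ∈ s)
    (hu : ∀ x m, x ∈ s → x + lat m ∈ s → lat m = 0) :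
    IsAddFundamentalDomain (latticeSubgroup n) s volume := by
  refine IsAddFundamentalDomain.mk' hs.nullMeasurableSet fun x => ?_
  obtain ⟨m, hm⟩ := hex x
  refine ⟨⟨lat m, m, rfl⟩, ?_, ?_⟩
  · simpa [AddSubgroup.vadd_def, add_comm] using hm
  · rintro ⟨_, m', rfl⟩ h
    have h' : x + lat m' ∈ s := by simpa [AddSubgroup.vadd_def, add_comm] using h
    have := hu (x + lat m) (m' - m) hm (by rw [lat_sub]; simpa using h')
    rw [lat_sub, sub_eq_zero] at this
    exact Subtype.ext this

theorem isAddFundamentalDomain_box : IsAddFundamentalDomain (latticeSubgroup n) (box n) volume :=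
  isAddFundamentalDomain_of_forall measurableSet_box exists_add_lat_mem_box
    fun x m h h' => by rw [lat_eq_zero_of_mem_box h h', lat_zero]

theorem IsLatticeBijective.injOn_box {X : (Fin n → ℝ) → (Fin n → ℝ)} (hX : IsLatticeBijective X) :
    InjOn X (box n) := by
  intro x hx y hy h
  obtain ⟨m, hm⟩ := hX.injective x y 0 (by simpa using h)
  subst hm
  rw [lat_eq_zero_of_mem_box hy hx, lat_zero, add_zero]

/-- Change of variables on the torus `ℝⁿ / 2πℤⁿ`: the image of the period box is again a
fundamental domain. -/
theorem integral_box_comp {F : Type*} [NormedAddCommGroup F] [NormedSpace ℝ F]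
    {X : (Fin n → ℝ) → (Fin n → ℝ)} (hX : IsLatticeBijective X)
    {X' : (Fin n → ℝ) → (Fin n → ℝ) →L[ℝ] (Fin n → ℝ)} (hd : ∀ x, HasFDerivAt X (X' x) x)
    {f : (Fin n → ℝ) → F} (hf : ∀ x m, f (x + lat m) = f x) :
    ∫ x in box n, |(X' x).det| • f (X x) = ∫ x in box n, f x := by
  have hd' : ∀ x ∈ box n, HasFDerivWithinAt X (X' x) (box n) x := fun x _ =>
    (hd x).hasFDerivWithinAt
  rw [← integral_image_eq_integral_abs_det_fderiv_smul volume measurableSet_box hd' hX.injOn_box]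
  refine IsAddFundamentalDomain.setIntegral_eq (G := latticeSubgroup n)
    (isAddFundamentalDomain_of_forall ?_ ?_ ?_) isAddFundamentalDomain_box ?_
  · exact measurable_image_of_fderivWithin measurableSet_box hd' hX.injOn_box
  · intro y
    obtain ⟨x, m, hx⟩ := hX.surjective y
    obtain ⟨m₁, hm₁⟩ := exists_add_lat_mem_box x
    obtain ⟨m₂, hm₂⟩ := hX.map_add x m₁
    exact ⟨m + m₂, x + lat m₁, hm₁, by rw [hm₂, hx, lat_add, add_assoc]⟩
  · rintro _ m ⟨x, hx, rfl⟩ ⟨y, hy, hxy⟩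
    obtain ⟨m', rfl⟩ := hX.injective y x m hxy
    rw [lat_eq_zero_of_mem_box hx hy, lat_zero, add_zero] at hxy
    simpa using hxy.symm
  · rintro ⟨_, m, rfl⟩ x
    simpa [AddSubgroup.vadd_def, add_comm] using hf x m

/-- The matrix of a real linear map `ℝⁿ → ℂⁿ`. -/
def dmat (A : (Fin n → ℝ) →L[ℝ] (Fin n → ℂ)) : Matrix (Fin n) (Fin n) ℂ :=
  Matrix.of fun i j => A (Pi.single j 1) i

theorem dmat_comp (A : (Fin n → ℝ) →L[ℝ] (Fin n → ℂ)) (B : (Fin n → ℝ) →L[ℝ] (Fin n → ℝ)) :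
    (dmat (A.comp B)).det = (dmat A).det * (B.det : ℂ) := by
  have h : dmat (A.comp B) = dmat A * (LinearMap.toMatrix' (B : (Fin n → ℝ) →ₗ[ℝ] (Fin n → ℝ))).map
      (Complex.ofRealHom) := by
    ext i j
    simp only [dmat, Matrix.of_apply, ContinuousLinearMap.comp_apply, Matrix.mul_apply,
      Matrix.map_apply, LinearMap.toMatrix'_apply]
    have : B (Pi.single j 1) = ∑ k, (B (Pi.single j 1) k) • (Pi.single k (1 : ℝ) : Fin n → ℝ) := by
      funext l; simp [Finset.sum_apply, Pi.single_apply]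
    rw [this, map_sum, Finset.sum_apply]
    refine Finset.sum_congr rfl fun k _ => ?_
    rw [map_smul]
    simp [mul_comm]
  rw [h, Matrix.det_mul, ← RingHom.mapMatrix_apply, ← RingHom.map_det, LinearMap.det_toMatrix']
  rfl

theorem dmat_comp_left (C : (Fin n → ℂ) →L[ℂ] (Fin n → ℂ)) (A : (Fin n → ℝ) →L[ℝ] (Fin n → ℂ)) :
    (dmat ((C.restrictScalars ℝ).comp A)).det = C.det * (dmat A).det := by
  have h : dmat ((C.restrictScalars ℝ).comp A) =
      LinearMap.toMatrix' (C : (Fin n → ℂ) →ₗ[ℂ] (Fin n → ℂ)) * dmat A := by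
    ext i j
    simp only [dmat, Matrix.of_apply, ContinuousLinearMap.comp_apply, Matrix.mul_apply,
      LinearMap.toMatrix'_apply]
    have : A (Pi.single j 1) = ∑ k, (A (Pi.single j 1) k) • (Pi.single k (1 : ℂ) : Fin n → ℂ) := by
      funext l; simp [Finset.sum_apply, Pi.single_apply]
    rw [this, map_sum, Finset.sum_apply]
    refine Finset.sum_congr rfl fun k _ => ?_
    rw [ContinuousLinearMap.coe_restrictScalars', map_smul, ← this]
    simp [mul_comm]
  rw [h, Matrix.det_mul, LinearMap.det_toMatrix']

theorem pullbackCoeff_eq_det (f : (Fin n → ℂ) → (Fin n → ℂ)) (θ : Fin n → ℝ) :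
    pullbackCoeff f θ = (dmat (fderiv ℝ (fun t : Fin n → ℝ => f (cover t)) θ)).det := by
  rw [← Matrix.det_transpose]
  rfl

theorem norm_fderiv_le_of_periodic {E : Type*} [NormedAddCommGroup E] [NormedSpace ℝ E]
    {u : (Fin n → ℝ) → E} (hu : ContDiff ℝ 1 u) (hp : ∀ x m, u (x + lat m) = u x) :
    ∃ C, ∀ x, ‖fderiv ℝ u x‖ ≤ C := by
  have hc : Continuous (fderiv ℝ u) := hu.continuous_fderiv one_ne_zero
  obtain ⟨C, hC⟩ := (isCompact_Icc (a := (0 : Fin n → ℝ)) (b := fun _ => 2 * Real.pi)).exists_bound_of_continuousOn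
    hc.continuousOn
  refine ⟨C, fun x => ?_⟩
  obtain ⟨m, hm⟩ := exists_add_lat_mem_box x
  have h1 : fderiv ℝ u (x + lat m) = fderiv ℝ u x := by
    rw [← fderiv_comp_add_right]
    congr 1
    funext y; exact hp y m
  rw [← h1]
  refine hC _ ⟨fun j => (hm j (mem_univ j)).1, fun j => (hm j (mem_univ j)).2.le⟩

/-- Small periodic perturbations of the identity are diffeomorphisms of the torus. -/
theorem isLatticeBijective_id_add {u : (Fin n → ℝ) → (Fin n → ℝ)} {C : NNReal} (hC : C < 1)
    (hu : LipschitzWith C u) (hp : ∀ x m, u (x + lat m) = u x) :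
    IsLatticeBijective fun x => x + u x where
  map_add x m := ⟨m, by rw [hp]; abel⟩
  injective x y m h := by
    refine ⟨m, ?_⟩
    have h1 : x + u x = (y + lat m) + u (y + lat m) := by rw [h, hp]; abel
    have h2 : dist x (y + lat m) ≤ C * dist x (y + lat m) := by
      have h3 : x - (y + lat m) = -(u x - u (y + lat m)) := by
        rw [neg_sub, sub_eq_sub_iff_add_eq_add, h1]; abel
      calc dist x (y + lat m) = dist (u x) (u (y + lat m)) := by
            rw [dist_eq_norm, h3, norm_neg, ← dist_eq_norm]
        _ ≤ _ := hu.dist_le_mul x (y + lat m)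
    by_contra hne
    have h4 : 0 < dist x (y + lat m) := dist_pos.2 hne
    have h5 : (C : ℝ) < 1 := by exact_mod_cast hC
    nlinarith
  surjective y := by
    have hl : LipschitzWith C fun x => y - u x := by
      have := (LipschitzWith.const y).sub hu
      simpa using this
    have hc : ContractingWith C fun x => y - u x := ⟨hC, hl⟩
    refine ⟨hc.fixedPoint, 0, ?_⟩
    have := hc.fixedPoint_isFixedPt
    rw [IsFixedPt] at this
    simp only [lat_zero, add_zero]
    nth_rewrite 1 [← this]
    abel

theorem volume_real_box : volume.real (box n) = (2 * Real.pi) ^ n := by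
  rw [Measure.real, box, volume_pi, Measure.pi_pi]
  simp [ENNReal.toReal_ofReal Real.pi_pos.le]

/-- The real matrix of partial derivatives. -/
def jacMatrix (u : (Fin n → ℝ) → (Fin n → ℝ)) (x : Fin n → ℝ) : Matrix (Fin n) (Fin n) ℝ :=
  Matrix.of fun i j => fderiv ℝ (fun y => u y i) x (Pi.single j 1)

theorem continuous_jacMatrix {u : (Fin n → ℝ) → (Fin n → ℝ)} (hu : ContDiff ℝ 1 u) :
    Continuous (jacMatrix u) := by
  refine continuous_matrix fun i j => ?_
  have : ContDiff ℝ 1 fun y => u y i := contDiff_pi.1 hu i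
  exact (this.continuous_fderiv one_ne_zero).clm_apply continuous_const

theorem integrableOn_box {F : Type*} [NormedAddCommGroup F] [NormedSpace ℝ F]
    {f : (Fin n → ℝ) → F} (hf : Continuous f) : IntegrableOn f (box n) := by
  refine (hf.continuousOn.integrableOn_compact
    (isCompact_Icc (a := (0 : Fin n → ℝ)) (b := fun _ => 2 * Real.pi))).congr_set_ae ?_
  exact box_ae_eq_Icc

/-- The matrix with the rows of `A` over `s` and those of `B` elsewhere. -/
def mixRows {R : Type*} (s : Finset (Fin n)) (A B : Matrix (Fin n) (Fin n) R) :
    Matrix (Fin n) (Fin n) R :=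
  Matrix.of fun i j => if i ∈ s then A i j else B i j

theorem det_smul_add {R : Type*} [CommRing R] (t : R) (A B : Matrix (Fin n) (Fin n) R) :
    (t • A + B).det = ∑ s : Finset (Fin n), t ^ s.card * (mixRows s A B).det := by
  let D := (Matrix.detRowAlternating (n := Fin n) (R := R)).toMultilinearMap
  let A' : Fin n → Fin n → R := A
  let B' : Fin n → Fin n → R := B
  have h : D (t • A' + B') = _ := D.map_add_univ (t • A') B'
  refine h.trans (Finset.sum_congr rfl fun s _ => ?_)
  have h2 := D.map_piecewise_smul (fun _ => t) (s.piecewise A' B') s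
  simp only [Finset.prod_const, smul_eq_mul] at h2
  have h3 : s.piecewise (t • A') B' =
      s.piecewise (fun i => t • s.piecewise A' B' i) (s.piecewise A' B') := by
    funext i
    by_cases hi : i ∈ s <;> simp [Finset.piecewise, hi]
  have h4 : s.piecewise A' B' = mixRows s A B := by
    funext i j
    by_cases hi : i ∈ s <;> simp [Finset.piecewise, hi, mixRows, A', B']
  rw [h3, h2, h4]
  rfl

/-- The integral of the Jacobian determinant of a periodic map vanishes: `∫ det (t + Du)` is the
polynomial `(2πt)ⁿ` for large `t`, as `id + u / t` is then a diffeomorphism of the torus; its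
constant term is `∫ det Du`. -/
theorem integral_det_jacMatrix_eq_zero (hn : n ≠ 0) {u : (Fin n → ℝ) → (Fin n → ℝ)}
    (hu : ContDiff ℝ 1 u) (hp : ∀ x m, u (x + lat m) = u x) :
    ∫ x in box n, (jacMatrix u x).det = 0 := by
  obtain ⟨C, hC⟩ := norm_fderiv_le_of_periodic hu hp
  have hC0 : 0 ≤ C := (norm_nonneg _).trans (hC 0)
  have hud : Differentiable ℝ u := hu.differentiable one_ne_zero
  have hcM := continuous_jacMatrix hu
  obtain ⟨η, hη, hdet⟩ : ∃ η > 0, ∀ B : (Fin n → ℝ) →L[ℝ] (Fin n → ℝ), ‖B‖ < η →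
      0 < (ContinuousLinearMap.id ℝ (Fin n → ℝ) + B).det := by
    have hcont : Continuous fun B : (Fin n → ℝ) →L[ℝ] (Fin n → ℝ) =>
        (ContinuousLinearMap.id ℝ (Fin n → ℝ) + B).det :=
      ContinuousLinearMap.continuous_det.comp (continuous_const.add continuous_id)
    have h0 : 0 < (ContinuousLinearMap.id ℝ (Fin n → ℝ) + 0).det := by
      simp [ContinuousLinearMap.det]
    obtain ⟨η, hη, h⟩ := Metric.eventually_nhds_iff.1
      (hcont.continuousAt.eventually (lt_mem_nhds h0))
    exact ⟨η, hη, fun B hB => h (by simpa using hB)⟩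
  set I : Finset (Fin n) → ℝ := fun s =>
    ∫ x in box n, (mixRows s (1 : Matrix (Fin n) (Fin n) ℝ) (jacMatrix u x)).det
  have hIcont : ∀ s : Finset (Fin n), Continuous fun x =>
      (mixRows s (1 : Matrix (Fin n) (Fin n) ℝ) (jacMatrix u x)).det := by
    intro s
    refine Continuous.matrix_det (continuous_matrix fun i j => ?_)
    simp only [mixRows, Matrix.of_apply]
    split
    · exact continuous_const
    · exact hcM.matrix_elem i j
  have key : ∀ t : ℝ, C < t → C / η < t →
      ∑ s : Finset (Fin n), t ^ s.card * I s = (2 * Real.pi) ^ n * t ^ n := by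
    intro t ht1 ht2
    have ht : 0 < t := hC0.trans_lt ht1
    have hD : ∀ x, HasFDerivAt (fun x => x + t⁻¹ • u x)
        (ContinuousLinearMap.id ℝ (Fin n → ℝ) + t⁻¹ • fderiv ℝ u x) x := fun x =>
      (hasFDerivAt_id x).add ((hud x).hasFDerivAt.const_smul t⁻¹)
    have hlip : LipschitzWith (C / t).toNNReal fun x => t⁻¹ • u x := by
      refine lipschitzWith_of_nnnorm_fderiv_le (𝕜 := ℝ) (hud.fun_const_smul _) fun x => ?_
      rw [← NNReal.coe_le_coe, coe_nnnorm, Real.coe_toNNReal _ (by positivity)]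
      rw [fderiv_fun_const_smul (hud x), norm_smul, norm_inv, Real.norm_of_nonneg ht.le,
        div_eq_inv_mul]
      gcongr
      exact hC x
    have hbij := isLatticeBijective_id_add (C := (C / t).toNNReal)
      (by simpa using (div_lt_one ht).2 ht1) hlip
      (fun x m => by rw [hp])
    have h1 := integral_box_comp hbij hD (f := fun _ => (1 : ℝ)) (fun _ _ => rfl)
    have h2 : ∀ x, |(ContinuousLinearMap.id ℝ (Fin n → ℝ) + t⁻¹ • fderiv ℝ u x).det| • (1 : ℝ) =
        (t ^ n)⁻¹ * (t • (1 : Matrix (Fin n) (Fin n) ℝ) + jacMatrix u x).det := by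
      intro x
      rw [abs_of_pos, smul_eq_mul, mul_one]
      · rw [ContinuousLinearMap.det, ← LinearMap.det_toMatrix', eq_inv_mul_iff_mul_eq₀ (by positivity)]
        have hds := Matrix.det_smul (LinearMap.toMatrix' ((ContinuousLinearMap.id ℝ (Fin n → ℝ) +
          t⁻¹ • fderiv ℝ u x : (Fin n → ℝ) →L[ℝ] (Fin n → ℝ)) : (Fin n → ℝ) →ₗ[ℝ] (Fin n → ℝ))) t
        rw [Fintype.card_fin] at hds
        rw [← hds]
        congr 1
        ext i j
        have h3 : fderiv ℝ u x (Pi.single j 1) i = jacMatrix u x i j := by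
          rw [jacMatrix, Matrix.of_apply, fderiv_apply (hud x)]; rfl
        simp only [Matrix.smul_apply, LinearMap.toMatrix'_apply, ContinuousLinearMap.coe_coe,
          add_apply, ContinuousLinearMap.id_apply,
          smul_apply, Pi.add_apply, Pi.smul_apply, smul_eq_mul, mul_add, h3,
          Matrix.add_apply, mul_inv_cancel_left₀ ht.ne', Matrix.one_apply, Pi.single_apply]
      · refine hdet _ ?_
        rw [norm_smul, norm_inv, Real.norm_of_nonneg ht.le, inv_mul_lt_iff₀ ht]
        calc _ ≤ C := hC x
          _ < t * η := by rwa [div_lt_iff₀ hη] at ht2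
    simp only [h2] at h1
    rw [integral_const_mul, inv_mul_eq_iff_eq_mul₀ (by positivity)] at h1
    simp only [det_smul_add] at h1
    rw [integral_finsetSum _ fun s _ => ((integrableOn_box (hIcont s)).const_mul _)] at h1
    simp only [integral_const_mul] at h1
    rw [show (2 * Real.pi) ^ n * t ^ n = t ^ n * (2 * Real.pi) ^ n by ring, ← volume_real_box]
    simpa using h1
  set P : Polynomial ℝ := ∑ s : Finset (Fin n), Polynomial.C (I s) * Polynomial.X ^ s.card -
    Polynomial.C ((2 * Real.pi) ^ n) * Polynomial.X ^ n with hP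
  have hP0 : P = 0 := by
    refine Polynomial.eq_zero_of_infinite_isRoot P ?_
    refine (Ioi_infinite (max C (C / η))).mono fun t ht => ?_
    have := key t ((le_max_left _ _).trans_lt ht) ((le_max_right _ _).trans_lt ht)
    simp only [mem_ofPred_eq, Polynomial.IsRoot, hP, Polynomial.eval_sub, Polynomial.eval_finsetSum,
      Polynomial.eval_mul, Polynomial.eval_C, Polynomial.eval_pow, Polynomial.eval_X]
    rw [← this, sub_eq_zero]
    exact Finset.sum_congr rfl fun s _ => mul_comm _ _
  have h0 : P.eval 0 = 0 := by rw [hP0, Polynomial.eval_zero]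
  simp only [hP, Polynomial.eval_sub, Polynomial.eval_finsetSum,
      Polynomial.eval_mul, Polynomial.eval_C, Polynomial.eval_pow, Polynomial.eval_X,
      zero_pow hn, mul_zero, sub_zero] at h0
  rw [Finset.sum_eq_single ∅ (fun s _ hs => by
    rw [zero_pow (Finset.card_ne_zero.2 (Finset.nonempty_iff_ne_empty.2 hs)), mul_zero])
    (by simp)] at h0
  have h1 : ∀ M : Matrix (Fin n) (Fin n) ℝ, mixRows ∅ 1 M = M := fun M => by
    ext i j; simp [mixRows]
  simpa [I, h1] using h0

/-- The integral of the complex Jacobian determinant of a periodic map `ℝⁿ → ℂⁿ` vanishes: expand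
it by multilinearity into real Jacobian determinants. -/
theorem integral_det_dmat_eq_zero (hn : n ≠ 0) {F : (Fin n → ℝ) → (Fin n → ℂ)}
    (hF : ContDiff ℝ 1 F) (hp : ∀ x m, F (x + lat m) = F x) :
    ∫ x in box n, (dmat (fderiv ℝ F x)).det = 0 := by
  set w : Finset (Fin n) → (Fin n → ℝ) → (Fin n → ℝ) := fun s x i =>
    if i ∈ s then (F x i).im else (F x i).re with hw
  have hFi : ∀ i, ContDiff ℝ 1 fun x => F x i := contDiff_pi.1 hF
  have hre : ∀ i, ContDiff ℝ 1 fun x => (F x i).re := fun i =>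
    Complex.reCLM.contDiff.comp (hFi i)
  have him : ∀ i, ContDiff ℝ 1 fun x => (F x i).im := fun i =>
    Complex.imCLM.contDiff.comp (hFi i)
  have hwd : ∀ s, ContDiff ℝ 1 (w s) := by
    intro s
    refine contDiff_pi.2 fun i => ?_
    simp only [hw]
    split
    · exact him i
    · exact hre i
  have hwp : ∀ s x m, w s (x + lat m) = w s x := by
    intro s x m; funext i; simp only [hw, hp]
  have hexp : ∀ x, (dmat (fderiv ℝ F x)).det =
      ∑ s : Finset (Fin n), Complex.I ^ s.card * (((jacMatrix (w s) x).det : ℝ) : ℂ) := by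
    intro x
    set A : Matrix (Fin n) (Fin n) ℂ := Matrix.of fun i j =>
      ((fderiv ℝ (fun y => (F y i).re) x (Pi.single j 1) : ℝ) : ℂ)
    set B : Matrix (Fin n) (Fin n) ℂ := Matrix.of fun i j =>
      ((fderiv ℝ (fun y => (F y i).im) x (Pi.single j 1) : ℝ) : ℂ)
    have hAB : dmat (fderiv ℝ F x) = Complex.I • B + A := by
      ext i j
      have h1 : fderiv ℝ F x (Pi.single j 1) i = fderiv ℝ (fun y => F y i) x (Pi.single j 1) := by
        rw [fderiv_apply (hF.differentiable one_ne_zero x)]; rfl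
      have h2 : HasFDerivAt (fun y => (F y i).re) (Complex.reCLM.comp (fderiv ℝ (fun y => F y i) x)) x :=
        Complex.reCLM.hasFDerivAt.comp x ((hFi i).differentiable one_ne_zero x).hasFDerivAt
      have h3 : HasFDerivAt (fun y => (F y i).im) (Complex.imCLM.comp (fderiv ℝ (fun y => F y i) x)) x :=
        Complex.imCLM.hasFDerivAt.comp x ((hFi i).differentiable one_ne_zero x).hasFDerivAt
      simp only [dmat, Matrix.of_apply, h1, Matrix.add_apply, A, B, h2.fderiv, h3.fderiv,
        Matrix.smul_apply, smul_eq_mul, ContinuousLinearMap.comp_apply, Complex.reCLM_apply,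
        Complex.imCLM_apply]
      rw [add_comm, mul_comm]
      exact (Complex.re_add_im _).symm
    rw [hAB, det_smul_add]
    refine Finset.sum_congr rfl fun s _ => ?_
    congr 1
    have h4 : (jacMatrix (w s) x).map Complex.ofRealHom = mixRows s B A := by
      ext i j
      by_cases hi : i ∈ s <;> simp [jacMatrix, hw, hi, A, B, mixRows]
    rw [← Complex.ofRealHom_eq_coe, RingHom.map_det, RingHom.mapMatrix_apply, h4]
  simp only [hexp]
  rw [integral_finsetSum]
  · refine Finset.sum_eq_zero fun s _ => ?_
    have h1 : ∫ x in box n, (((jacMatrix (w s) x).det : ℝ) : ℂ) = 0 := by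
      rw [integral_complex_ofReal, integral_det_jacMatrix_eq_zero hn (hwd s) (hwp s),
        Complex.ofReal_zero]
    rw [integral_const_mul, h1, mul_zero]
  · intro s _
    refine Integrable.const_mul ?_ _
    refine integrableOn_box (Complex.continuous_ofReal.comp ?_)
    exact (continuous_jacMatrix (hwd s)).matrix_det

/-! ### The sum of the angles as a coordinate -/

section Shear
variable (𝕜 : Type*) [RCLike 𝕜] [NeZero n]

/-- The linear change of variables `θ ↦ (θ₁ + ⋯ + θₙ, θ₂, …, θₙ)`. -/
def shear : (Fin n → 𝕜) ≃L[𝕜] (Fin n → 𝕜) :=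
  LinearEquiv.toContinuousLinearEquiv
    { toFun := fun θ => update θ 0 (∑ j, θ j)
      invFun := fun θ => update θ 0 (θ 0 - ∑ j ∈ Finset.univ.erase 0, θ j)
      map_add' := fun x y => by
        funext j
        by_cases h : j = 0
        · subst h; simp [Finset.sum_add_distrib]
        · simp [h]
      map_smul' := fun c x => by
        funext j
        by_cases h : j = 0
        · subst h; simp [Finset.mul_sum]
        · simp [h]
      left_inv := fun x => by
        funext j
        by_cases h : j = 0
        · subst h
          have h1 : ∑ j ∈ Finset.univ.erase 0, update x 0 (∑ j, x j) j =
              ∑ j ∈ Finset.univ.erase 0, x j :=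
            Finset.sum_congr rfl fun j hj => by rw [update_of_ne (Finset.ne_of_mem_erase hj)]
          simp only [update_self, h1]
          rw [← Finset.add_sum_erase _ _ (Finset.mem_univ 0)]
          ring
        · simp [h]
      right_inv := fun x => by
        funext j
        by_cases h : j = 0
        · subst h
          simp only [update_self]
          rw [← Finset.add_sum_erase _ _ (Finset.mem_univ 0), update_self]
          have h1 : ∀ c, ∑ j ∈ Finset.univ.erase 0, update x 0 c j =
              ∑ j ∈ Finset.univ.erase 0, x j := fun c =>
            Finset.sum_congr rfl fun j hj => by rw [update_of_ne (Finset.ne_of_mem_erase hj)]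
          rw [h1]
          ring
        · simp [h] }

variable {𝕜}

theorem shear_apply (θ : Fin n → 𝕜) : shear 𝕜 θ = update θ 0 (∑ j, θ j) := rfl

theorem shear_symm_apply (θ : Fin n → 𝕜) :
    (shear 𝕜).symm θ = update θ 0 (θ 0 - ∑ j ∈ Finset.univ.erase 0, θ j) := rfl

/-- The determinant of a linear map changing only the first coordinate. -/
theorem det_eq_of_forall_ne_zero (A : (Fin n → 𝕜) →L[𝕜] (Fin n → 𝕜))
    (h : ∀ v, ∀ j ≠ 0, A v j = v j) : A.det = A (Pi.single 0 1) 0 := by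
  rw [ContinuousLinearMap.det, ← LinearMap.det_toMatrix', Matrix.det_of_isUpperTriangular]
  · rw [← Finset.mul_prod_erase _ _ (Finset.mem_univ 0), Finset.prod_eq_one, mul_one]
    · simp [LinearMap.toMatrix'_apply]
    · intro j hj
      simp [LinearMap.toMatrix'_apply, h _ j (Finset.ne_of_mem_erase hj)]
  · intro i j hij
    have hi : i ≠ 0 := by
      rintro rfl
      exact absurd hij (by simp)
    have hij' : i ≠ j := by rintro rfl; exact lt_irrefl _ hij
    simp [LinearMap.toMatrix'_apply, h _ i hi, hij']

theorem det_shear : ((shear 𝕜 : (Fin n → 𝕜) ≃L[𝕜] (Fin n → 𝕜)) :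
    (Fin n → 𝕜) →L[𝕜] (Fin n → 𝕜)).det = 1 := by
  rw [det_eq_of_forall_ne_zero]
  · simp [shear_apply]
  · intro v j hj
    simp [shear_apply, hj]

theorem shear_lat (m : Fin n → ℤ) : shear ℝ (lat m) = lat (update m 0 (∑ j, m j)) := by
  funext j
  by_cases h : j = 0
  · subst h; simp [shear_apply, lat, Finset.mul_sum]
  · simp [shear_apply, lat, h]

theorem shear_symm_lat (m : Fin n → ℤ) : (shear ℝ).symm (lat m) =
    lat (update m 0 (m 0 - ∑ j ∈ Finset.univ.erase 0, m j)) := by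
  funext j
  by_cases h : j = 0
  · subst h; simp [shear_symm_apply, lat, Finset.mul_sum, mul_sub]
  · simp [shear_symm_apply, lat, h]

theorem isLatticeBijective_shear : IsLatticeBijective (n := n) (shear ℝ) where
  map_add x m := ⟨_, by rw [map_add, shear_lat]⟩
  injective x y m h := by
    have := congrArg (shear ℝ).symm h
    rw [map_add, ContinuousLinearEquiv.symm_apply_apply, ContinuousLinearEquiv.symm_apply_apply,
      shear_symm_lat] at this
    exact ⟨_, this⟩
  surjective y := ⟨(shear ℝ).symm y, 0, by simp⟩

theorem integral_box_coord_zero (v : ℝ → 𝕜) :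
    ∫ θ in box n, v (θ 0) = (2 * Real.pi) ^ (n - 1) * ∫ s in (0 : ℝ)..(2 * Real.pi), v s := by
  have h := integral_fintype_prod_eq_prod (𝕜 := 𝕜) (ι := Fin n) (E := fun _ => ℝ)
    (μ := fun _ => volume.restrict (Ico (0 : ℝ) (2 * Real.pi)))
    (fun j s => if j = 0 then v s else 1)
  rw [box, volume_pi, Measure.restrict_pi_pi]
  have h1 : ∀ θ : Fin n → ℝ, ∏ j, (if j = 0 then v (θ j) else 1) = v (θ 0) := by
    intro θ; simp
  simp only [h1] at h
  rw [h, ← Finset.mul_prod_erase _ _ (Finset.mem_univ 0), mul_comm]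
  congr 1
  · have h2 : ∀ j ∈ Finset.univ.erase (0 : Fin n), ∫ x in Ico (0 : ℝ) (2 * Real.pi),
        (if j = 0 then v x else (1 : 𝕜)) = 2 * Real.pi := by
      intro j hj
      simp [Finset.ne_of_mem_erase hj, Real.pi_pos.le, RCLike.real_smul_eq_coe_mul, map_ofNat]
    rw [Finset.prod_congr rfl h2]
    simp
  · simp only [if_true]
    rw [intervalIntegral.integral_of_le Real.two_pi_pos.le, restrict_Ico_eq_restrict_Ioc]

/-- The sum of the angles maps the Lebesgue measure of the torus to that of the circle, up to the
factor `(2π)ⁿ⁻¹`. -/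
theorem integral_box_sum (v : ℝ → 𝕜) (hv : Function.Periodic v (2 * Real.pi)) :
    ∫ θ in box n, v (∑ j, θ j) =
      (2 * Real.pi) ^ (n - 1) * ∫ s in (0 : ℝ)..(2 * Real.pi), v s := by
  rw [← integral_box_coord_zero]
  have h := integral_box_comp isLatticeBijective_shear
    (fun x => (shear ℝ : (Fin n → ℝ) ≃L[ℝ] (Fin n → ℝ)).hasFDerivAt (x := x))
    (f := fun θ => v (θ 0)) (fun x m => by
      have := (hv.int_mul (m 0)) (x 0)
      simp only [Pi.add_apply, lat]
      rw [mul_comm]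
      exact this)
  rw [← h]
  simp [det_shear, shear_apply]

end Shear

end

section
variable {n : ℕ} {δ : ℝ}

/-! ### Unimodular maps -/

theorem Omega_compLinearMap (A : (Fin n → ℂ) →ₗ[ℂ] (Fin n → ℂ)) :
    (Omega n).compLinearMap A = LinearMap.det A • Omega n := by
  have h : Omega n = (Pi.basisFun ℂ (Fin n)).det := (Pi.basisFun_det).symm
  ext v
  rw [h]
  simpa [Function.comp_def] using (Pi.basisFun ℂ (Fin n)).det_comp A v

theorem Omega_compLinearMap_eq_iff (A : (Fin n → ℂ) →L[ℂ] (Fin n → ℂ)) :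
    (Omega n).compLinearMap (A : (Fin n → ℂ) →ₗ[ℂ] (Fin n → ℂ)) = Omega n ↔ A.det = 1 := by
  rw [Omega_compLinearMap]
  constructor
  · intro h
    have h1 := DFunLike.congr_fun h ⇑(Pi.basisFun ℂ (Fin n))
    have h2 : Omega n (Pi.basisFun ℂ (Fin n)) = 1 := by
      have : Omega n = (Pi.basisFun ℂ (Fin n)).det := (Pi.basisFun_det).symm
      rw [this, Module.Basis.det_self]
    simpa [h2] using h1
  · intro h
    rw [show LinearMap.det (A : (Fin n → ℂ) →ₗ[ℂ] (Fin n → ℂ)) = 1 from h, one_smul]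

theorem hasStrictFDerivAt_of_differentiableOn {f : (Fin n → ℂ) → (Fin n → ℂ)} {U : Set (Fin n → ℂ)}
    (hU : IsOpen U) (hf : DifferentiableOn ℂ f U) {z : Fin n → ℂ} (hz : z ∈ U)
    (hdet : (fderiv ℂ f z).det ≠ 0) :
    HasStrictFDerivAt f (((fderiv ℂ f z).toContinuousLinearEquivOfDetNeZero hdet :
      (Fin n → ℂ) ≃L[ℂ] (Fin n → ℂ)) : (Fin n → ℂ) →L[ℂ] (Fin n → ℂ)) z := by
  rw [ContinuousLinearMap.coe_toContinuousLinearEquivOfDetNeZero]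
  exact ((contDiffOn_one_of_differentiableOn hU hf).contDiffAt (hU.mem_nhds hz)).hasStrictFDerivAt
    one_ne_zero

/-- An injective holomorphic map with nonvanishing Jacobian is biholomorphic onto its image. -/
theorem exists_biholomorphic {f : (Fin n → ℂ) → (Fin n → ℂ)} {U : Set (Fin n → ℂ)}
    (hU : IsOpen U) (hf : DifferentiableOn ℂ f U) (hinj : InjOn f U)
    (hdet : ∀ z ∈ U, (fderiv ℂ f z).det ≠ 0) :
    ∃ e : OpenPartialHomeomorph (Fin n → ℂ) (Fin n → ℂ), e.source = U ∧ e = f ∧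
      DifferentiableOn ℂ e.symm e.target := by
  have ho : IsOpenMap (U.domRestrict f) := by
    refine IsOpenMap.of_nhds_le fun x => ?_
    have h1 := (hasStrictFDerivAt_of_differentiableOn hU hf x.2 (hdet x x.2)).map_nhds_eq_of_equiv
    have h2 : map (U.domRestrict f) (𝓝 x) = map f (𝓝 (x : Fin n → ℂ)) := by
      rw [← map_nhds_subtype_coe_eq_nhds x.2 (hU.mem_nhds x.2), map_map]
      rfl
    rw [h2, h1]
    rfl
  let e := OpenPartialHomeomorph.ofContinuousOpenRestrict (hinj.toPartialEquiv f U) hf.continuousOn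
    ho hU
  refine ⟨e, rfl, rfl, fun y hy => ?_⟩
  have hx : e.symm y ∈ U := e.map_target hy
  have h1 : HasFDerivAt e _ (e.symm y) :=
    (hasStrictFDerivAt_of_differentiableOn hU hf hx (hdet _ hx)).hasFDerivAt
  exact (e.hasFDerivAt_symm hy h1).differentiableAt.differentiableWithinAt

theorem unimodularEquiv_image {f : (Fin n → ℂ) → (Fin n → ℂ)} {U M : Set (Fin n → ℂ)}
    (hU : IsOpen U) (hf : DifferentiableOn ℂ f U) (hinj : InjOn f U)
    (hdet : ∀ z ∈ U, (fderiv ℂ f z).det = 1) (hM : M ⊆ U) : UnimodularEquiv M (f '' M) := by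
  obtain ⟨e, hs, he, hd⟩ := exists_biholomorphic hU hf hinj fun z hz => by
    rw [hdet z hz]; exact one_ne_zero
  refine ⟨e, hs ▸ hM, by rw [he, hs]; exact hf, hd, fun z hz => ?_, by rw [he]⟩
  rw [he, Omega_compLinearMap_eq_iff]
  exact hdet z (hs ▸ hz)

theorem UnimodularEquiv.symm {M N : Set (Fin n → ℂ)} (h : UnimodularEquiv M N) :
    UnimodularEquiv N M := by
  obtain ⟨Φ, hM, hd, hd', hΩ, rfl⟩ := h
  refine ⟨Φ.symm, ?_, hd', by simpa using hd, ?_, ?_⟩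
  · rintro _ ⟨z, hz, rfl⟩
    exact Φ.map_source (hM hz)
  · intro w hw
    have hw' : w ∈ Φ.target := hw
    have hz := Φ.map_target hw'
    have h1 : HasFDerivAt Φ (fderiv ℂ Φ (Φ.symm w)) (Φ.symm w) :=
      (hd.differentiableAt (Φ.open_source.mem_nhds hz)).hasFDerivAt
    have h2 : HasFDerivAt Φ.symm (fderiv ℂ Φ.symm w) w :=
      (hd'.differentiableAt (Φ.open_target.mem_nhds hw')).hasFDerivAt
    have h3 := h1.comp w h2
    have h4 : HasFDerivAt (Φ ∘ Φ.symm) (ContinuousLinearMap.id ℂ _) w :=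
      (hasFDerivAt_id w).congr_of_eventuallyEq (Φ.eventually_right_inverse hw')
    have h5 := h3.unique h4
    have h6 := (Omega_compLinearMap_eq_iff _).1 (hΩ _ hz)
    rw [Omega_compLinearMap_eq_iff]
    have h7 := congrArg ContinuousLinearMap.det h5
    simp only [ContinuousLinearMap.det] at h6 h7 ⊢
    simpa [h6] using h7
  · rw [image_image]
    refine (image_congr fun z hz => Φ.left_inv (hM hz)).trans (image_id M)

theorem UnimodularEquiv.trans {M N P : Set (Fin n → ℂ)} (h : UnimodularEquiv M N)
    (h' : UnimodularEquiv N P) : UnimodularEquiv M P := by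
  obtain ⟨Φ, hM, hd, hd', hΩ, rfl⟩ := h
  obtain ⟨Ψ, hN, he, he', hΩ', rfl⟩ := h'
  refine ⟨Φ.trans Ψ, ?_, ?_, ?_, ?_, ?_⟩
  · intro z hz
    rw [OpenPartialHomeomorph.trans_source]
    exact ⟨hM hz, hN (mem_image_of_mem _ hz)⟩
  · rw [OpenPartialHomeomorph.trans_source, OpenPartialHomeomorph.coe_trans]
    exact he.comp (hd.mono inter_subset_left) fun z hz => hz.2
  · rw [OpenPartialHomeomorph.trans_target, OpenPartialHomeomorph.coe_trans_symm]
    exact hd'.comp (he'.mono inter_subset_left) fun z hz => hz.2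
  · intro z hz
    rw [OpenPartialHomeomorph.trans_source] at hz
    have h1 := hd.differentiableAt (Φ.open_source.mem_nhds hz.1)
    have h2 := he.differentiableAt (Ψ.open_source.mem_nhds hz.2)
    rw [OpenPartialHomeomorph.coe_trans, fderiv_comp z h2 h1, Omega_compLinearMap_eq_iff]
    have h3 := (Omega_compLinearMap_eq_iff _).1 (hΩ z hz.1)
    have h4 := (Omega_compLinearMap_eq_iff _).1 (hΩ' _ hz.2)
    simp only [ContinuousLinearMap.det] at h3 h4 ⊢
    simp [h3, h4]
  · rw [OpenPartialHomeomorph.coe_trans, image_comp]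

theorem isCompact_torus : IsCompact (torus n) := by
  have : torus n = univ.pi fun _ => sphere (0 : ℂ) 1 := by
    ext z; simp [torus]
  rw [this]
  exact isCompact_univ_pi fun _ => isCompact_sphere 0 1

/-- A map that is holomorphic near the torus, injective on it and of nonvanishing Jacobian is
biholomorphic near the torus. -/
theorem exists_biholomorphic_near_torus {f : (Fin n → ℂ) → (Fin n → ℂ)} {U : Set (Fin n → ℂ)}
    (hU : IsOpen U) (hT : torus n ⊆ U) (hf : DifferentiableOn ℂ f U) (hinj : InjOn f (torus n))
    (hdet : ∀ z ∈ U, (fderiv ℂ f z).det ≠ 0) :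
    ∃ V, IsOpen V ∧ torus n ⊆ V ∧ V ⊆ U ∧ InjOn f V := by
  obtain ⟨t, ht, hTt, hit⟩ := hinj.exists_isOpen_superset isCompact_torus
    (fun x hx => hf.continuousOn.continuousAt (hU.mem_nhds (hT hx)))
    (fun x hx => by
      have h := hasStrictFDerivAt_of_differentiableOn hU hf (hT hx) (hdet x (hT hx))
      exact ⟨_, h.toOpenPartialHomeomorph.open_source.mem_nhds
        h.mem_toOpenPartialHomeomorph_source, h.toOpenPartialHomeomorph.injOn⟩)
  exact ⟨t ∩ U, ht.inter hU, subset_inter hTt hT, inter_subset_right, hit.mono inter_subset_left⟩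

/-- Two parametrized tori are unimodularly equivalent if the parametrizations extend to
holomorphic maps with the same nonvanishing Jacobian. -/
theorem unimodularEquiv_of_det_eq {f₁ f₂ : (Fin n → ℂ) → (Fin n → ℂ)} {U : Set (Fin n → ℂ)}
    (hU : IsOpen U) (hT : torus n ⊆ U) (hf₁ : DifferentiableOn ℂ f₁ U)
    (hf₂ : DifferentiableOn ℂ f₂ U) (hinj₁ : InjOn f₁ (torus n)) (hinj₂ : InjOn f₂ (torus n))
    (hdet : ∀ z ∈ U, (fderiv ℂ f₁ z).det ≠ 0)
    (heq : ∀ z ∈ U, (fderiv ℂ f₂ z).det = (fderiv ℂ f₁ z).det) :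
    UnimodularEquiv (f₁ '' torus n) (f₂ '' torus n) := by
  obtain ⟨V, hV, hTV, hVU, hiV⟩ := exists_biholomorphic_near_torus hU hT hf₁ hinj₁ hdet
  obtain ⟨W, hW, hTW, hWV, hiW⟩ := exists_biholomorphic_near_torus hV hTV (hf₂.mono hVU) hinj₂
    fun z hz => by rw [heq z (hVU hz)]; exact hdet z (hVU hz)
  have hWU := hWV.trans hVU
  obtain ⟨e, hs, he, hd⟩ := exists_biholomorphic hW (hf₁.mono hWU) (hiV.mono hWV)
    fun z hz => hdet z (hWU hz)
  have hsymm : ∀ w ∈ e.target, e.symm w ∈ W := fun w hw => hs ▸ e.map_target hw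
  have key := unimodularEquiv_image (f := f₂ ∘ e.symm) (U := e.target) (M := f₁ '' torus n)
    e.open_target ((hf₂.mono hWU).comp hd hsymm)
    (hiW.comp e.symm.injOn hsymm) ?_ ?_
  · have : (f₂ ∘ e.symm) '' (f₁ '' torus n) = f₂ '' torus n := by
      rw [image_image]
      refine image_congr fun z hz => ?_
      rw [comp_apply, ← he, e.left_inv (hs ▸ hTW hz)]
    rwa [this] at key
  · intro w hw
    have hz := hsymm w hw
    have h1 : HasFDerivAt e (fderiv ℂ f₁ (e.symm w)) (e.symm w) := by
      rw [he]; exact (hf₁.differentiableAt (hU.mem_nhds (hWU hz))).hasFDerivAt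
    have h2 : HasFDerivAt e.symm (fderiv ℂ e.symm w) w :=
      (hd.differentiableAt (e.open_target.mem_nhds hw)).hasFDerivAt
    have h3 := (h1.comp w h2).unique
      ((hasFDerivAt_id w).congr_of_eventuallyEq (e.eventually_right_inverse hw))
    have h4 := congrArg ContinuousLinearMap.det h3
    have h5 := heq _ (hWU hz)
    rw [fderiv_comp w (hf₂.differentiableAt (hU.mem_nhds (hWU hz)))
      (hd.differentiableAt (e.open_target.mem_nhds hw))]
    simp only [ContinuousLinearMap.det] at h4 h5 ⊢
    simpa [h5] using h4
  · rintro _ ⟨z, hz, rfl⟩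
    rw [← he]
    exact e.map_source (hs ▸ hTW hz)

/-! ### The universal covering of the torus -/

/-- The covering `w ↦ (e^{iw_1}, …, e^{iw_n})` of `(ℂ ∖ 0)ⁿ`. -/
def ccover (w : Fin n → ℂ) : Fin n → ℂ := fun j => Complex.exp (Complex.I * w j)

theorem ccover_toC (θ : Fin n → ℝ) : ccover (toC θ) = cover θ := rfl

theorem cover_mem_torus (θ : Fin n → ℝ) : cover θ ∈ torus n := fun j => by
  simp [cover, Complex.norm_exp]

theorem exists_cover_eq {z : Fin n → ℂ} (hz : z ∈ torus n) : ∃ θ : Fin n → ℝ, cover θ = z := by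
  refine ⟨fun j => (z j).arg, funext fun j => ?_⟩
  have := Complex.norm_mul_exp_arg_mul_I (z j)
  rw [hz j] at this
  simpa [cover, mul_comm] using this

/-- The fibres of the covering are the orbits of the period lattice. -/
theorem ccover_eq_iff {w w' : Fin n → ℂ} :
    ccover w = ccover w' ↔ ∃ m : Fin n → ℤ, w = w' + toC (lat m) := by
  constructor
  · intro h
    have h1 : ∀ j, ∃ k : ℤ, Complex.I * w j = Complex.I * w' j + k * (2 * Real.pi * Complex.I) :=
      fun j => Complex.exp_eq_exp_iff_exists_int.1 (congrFun h j)
    choose m hm using h1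
    refine ⟨m, funext fun j => ?_⟩
    have := hm j
    simp only [Pi.add_apply, toC, lat]
    push_cast
    refine mul_left_cancel₀ Complex.I_ne_zero ?_
    linear_combination this
  · rintro ⟨m, rfl⟩
    funext j
    refine Complex.exp_eq_exp_iff_exists_int.2 ⟨m j, ?_⟩
    simp only [Pi.add_apply, toC, lat]
    push_cast
    ring

theorem toC_add (x y : Fin n → ℝ) : toC (x + y) = toC x + toC y := by
  funext j; simp [toC]

theorem toC_injective : Injective (toC (n := n)) := fun x y h => by
  funext j; exact Complex.ofReal_injective (congrFun h j)

theorem cover_eq_iff {x y : Fin n → ℝ} :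
    cover x = cover y ↔ ∃ m : Fin n → ℤ, x = y + lat m := by
  rw [← ccover_toC, ← ccover_toC, ccover_eq_iff]
  simp only [← toC_add, toC_injective.eq_iff]

theorem cover_add_lat (x : Fin n → ℝ) (m : Fin n → ℤ) : cover (x + lat m) = cover x :=
  cover_eq_iff.2 ⟨m, rfl⟩

theorem differentiable_ccover : Differentiable ℂ (ccover (n := n)) := by
  rw [differentiable_pi]
  intro j
  simp only [ccover]
  fun_prop

end

section
variable {n : ℕ} {δ : ℝ}

/-! ### The normal form -/

theorem fderiv_single_eq {𝕜 : Type*} [RCLike 𝕜] {E : Type*} [NormedAddCommGroup E] [NormedSpace 𝕜 E]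
    {F : (Fin n → 𝕜) → (Fin n → E)} {θ : Fin n → 𝕜} (hF : DifferentiableAt 𝕜 F θ) {i j : Fin n}
    {c : E} (h : HasDerivAt (fun t => F (update θ j t) i) c (θ j)) :
    fderiv 𝕜 F θ (Pi.single j 1) i = c := by
  have h1 : HasFDerivAt F (fderiv 𝕜 F θ) (update θ j (θ j)) := by
    rw [update_eq_self]; exact hF.hasFDerivAt
  exact ((hasDerivAt_pi.1 (h1.comp_hasDerivAt (θ j) (hasDerivAt_update θ j (θ j)))) i).unique h

theorem injective_of_det_dmat_ne_zero {A : (Fin n → ℝ) →L[ℝ] (Fin n → ℂ)}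
    (h : (dmat A).det ≠ 0) : Injective A := by
  rw [injective_iff_map_eq_zero]
  intro v hv
  have h1 : (dmat A).mulVec (toC v) = 0 := by
    funext i
    have h2 : A v i = ∑ j, A (Pi.single j 1) i * (v j : ℂ) := by
      have : v = ∑ k, v k • (Pi.single k (1 : ℝ) : Fin n → ℝ) := by
        funext l; simp [Finset.sum_apply, Pi.single_apply]
      conv_lhs => rw [this, map_sum, Finset.sum_apply]
      refine Finset.sum_congr rfl fun k _ => ?_
      rw [map_smul]; simp [mul_comm]
    rw [hv] at h2
    simpa [Matrix.mulVec, dotProduct, dmat, toC] using h2.symm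
  have h2 := Matrix.eq_zero_of_mulVec_eq_zero h h1
  funext j
  have := congrFun h2 j
  simpa [toC] using this

variable [NeZero n]

theorem prod_erase_cover (θ : Fin n → ℝ) : ∏ j ∈ Finset.univ.erase (0 : Fin n), cover θ j =
    Complex.exp (Complex.I * ((∑ j ∈ Finset.univ.erase (0 : Fin n), θ j : ℝ) : ℂ)) := by
  simp only [cover]
  rw [← Complex.exp_sum, ← Finset.mul_sum]
  push_cast
  rfl

theorem sum_eq_zero_add (θ : Fin n → ℝ) :
    ∑ j, θ j = θ 0 + ∑ j ∈ Finset.univ.erase (0 : Fin n), θ j :=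
  (Finset.add_sum_erase _ _ (Finset.mem_univ 0)).symm

theorem normalMap_cover_zero (g : ℂ → ℂ) (θ : Fin n → ℝ) : normalMap g (cover θ) 0 =
    Complex.exp (-(Complex.I * ((∑ j ∈ Finset.univ.erase (0 : Fin n), θ j : ℝ) : ℂ))) *
      g (Complex.exp (Complex.I * ((∑ j, θ j : ℝ) : ℂ))) := by
  simp only [normalMap, update_self, prod_erase_cover, Complex.exp_neg]
  congr 2
  simp only [cover]
  rw [← Complex.exp_add, ← mul_add, sum_eq_zero_add]
  push_cast
  ring_nf

theorem normalMap_cover_ne (g : ℂ → ℂ) (θ : Fin n → ℝ) {j : Fin n} (hj : j ≠ 0) :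
    normalMap g (cover θ) j = Complex.exp (Complex.I * (θ j : ℂ)) := by
  simp [normalMap, hj, cover]

theorem contDiff_normalMap_cover {s : WithTop ℕ∞} {g : ℂ → ℂ}
    (hg : ContDiff ℝ s fun u : ℝ => g (Complex.exp (Complex.I * (u : ℂ)))) :
    ContDiff ℝ s fun θ : Fin n → ℝ => normalMap g (cover θ) := by
  have hof : ContDiff ℝ s fun x : ℝ => (x : ℂ) := Complex.ofRealCLM.contDiff
  refine contDiff_pi.2 fun j => ?_
  by_cases hj : j = 0
  · subst hj
    simp only [normalMap_cover_zero]
    refine ContDiff.mul ?_ (hg.comp (ContDiff.sum fun i _ => contDiff_apply ℝ ℝ i))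
    refine ContDiff.cexp (ContDiff.neg (contDiff_const.mul (hof.comp ?_)))
    exact ContDiff.sum fun i _ => contDiff_apply ℝ ℝ i
  · simp only [normalMap_cover_ne g _ hj]
    exact ContDiff.cexp (contDiff_const.mul (hof.comp (contDiff_apply ℝ ℝ j)))

theorem differentiable_normalMap_cover {g : ℂ → ℂ} {γ' : ℝ → ℂ}
    (hg : ∀ t, HasDerivAt (fun u : ℝ => g (Complex.exp (Complex.I * (u : ℂ)))) (γ' t) t) :
    Differentiable ℝ fun θ : Fin n → ℝ => normalMap g (cover θ) := by
  have hgd : Differentiable ℝ fun u : ℝ => g (Complex.exp (Complex.I * (u : ℂ))) :=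
    fun t => (hg t).differentiableAt
  rw [differentiable_pi]
  intro j
  by_cases hj : j = 0
  · subst hj
    simp only [normalMap_cover_zero]
    refine Differentiable.mul ?_ (hgd.comp (f := fun θ : Fin n → ℝ => ∑ j, θ j) (by fun_prop))
    have h1 : Differentiable ℝ fun θ : Fin n → ℝ =>
        ((∑ j ∈ Finset.univ.erase (0 : Fin n), θ j : ℝ) : ℂ) :=
      Complex.ofRealCLM.differentiable.comp
        (g := Complex.ofRealCLM) (f := fun θ : Fin n → ℝ => ∑ j ∈ Finset.univ.erase (0 : Fin n), θ j)
        (by fun_prop)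
    fun_prop
  · simp only [normalMap_cover_ne g _ hj]
    have h1 : Differentiable ℝ fun θ : Fin n → ℝ => (θ j : ℂ) :=
      Complex.ofRealCLM.differentiable.comp (g := Complex.ofRealCLM) (f := fun θ : Fin n → ℝ => θ j)
        (by fun_prop)
    fun_prop

/-- The Jacobian of `ψ` depends on the sum of the angles only. -/
theorem pullbackCoeff_normalMap {g : ℂ → ℂ} {γ' : ℝ → ℂ}
    (hg : ∀ t, HasDerivAt (fun u : ℝ => g (Complex.exp (Complex.I * (u : ℂ)))) (γ' t) t)
    (θ : Fin n → ℝ) : pullbackCoeff (normalMap g) θ = Complex.I ^ (n - 1) * γ' (∑ j, θ j) := by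
  have hd := differentiable_normalMap_cover (n := n) hg θ
  have hrow : ∀ i ≠ (0 : Fin n), ∀ j,
      fderiv ℝ (fun θ : Fin n → ℝ => normalMap g (cover θ)) θ (Pi.single j 1) i =
        if i = j then Complex.I * Complex.exp (Complex.I * (θ i : ℂ)) else 0 := by
    intro i hi j
    refine fderiv_single_eq hd ?_
    simp only [normalMap_cover_ne g _ hi]
    by_cases hij : i = j
    · subst hij
      simp only [update_self, if_true]
      have h1 : HasDerivAt (fun t : ℝ => Complex.I * (t : ℂ)) Complex.I (θ i) := by
        simpa using ((hasDerivAt_id (θ i)).ofReal_comp).const_mul Complex.I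
      simpa [mul_comm] using h1.cexp
    · simp only [update_of_ne hij, if_neg hij]
      exact hasDerivAt_const _ _
  have h0 : fderiv ℝ (fun θ : Fin n → ℝ => normalMap g (cover θ)) θ (Pi.single 0 1) 0 =
      Complex.exp (-(Complex.I * ((∑ j ∈ Finset.univ.erase (0 : Fin n), θ j : ℝ) : ℂ))) *
        γ' (∑ j, θ j) := by
    refine fderiv_single_eq hd ?_
    simp only [normalMap_cover_zero]
    have h1 : ∀ t, ∑ j ∈ Finset.univ.erase (0 : Fin n), update θ 0 t j =
        ∑ j ∈ Finset.univ.erase (0 : Fin n), θ j := fun t =>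
      Finset.sum_congr rfl fun j hj => by rw [update_of_ne (Finset.ne_of_mem_erase hj)]
    simp only [sum_eq_zero_add (update θ 0 _), h1, update_self]
    refine HasDerivAt.const_mul _ ?_
    rw [sum_eq_zero_add θ]
    exact HasDerivAt.comp_add_const (θ 0) _ (hg _)
  rw [pullbackCoeff_eq_det, Matrix.det_of_isUpperTriangular]
  · rw [← Finset.mul_prod_erase _ _ (Finset.mem_univ 0)]
    simp only [dmat, Matrix.of_apply]
    rw [h0, Finset.prod_congr rfl fun j hj => by
      rw [hrow j (Finset.ne_of_mem_erase hj) j, if_pos rfl],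
      Finset.prod_mul_distrib, Finset.prod_const, Finset.card_erase_of_mem (Finset.mem_univ _),
      Finset.card_univ, Fintype.card_fin]
    have h2 := prod_erase_cover θ
    simp only [cover] at h2
    rw [h2, Complex.exp_neg]
    have := Complex.exp_ne_zero (Complex.I * ((∑ j ∈ Finset.univ.erase (0 : Fin n), θ j : ℝ) : ℂ))
    field_simp
  · intro i j hij
    have hi : i ≠ 0 := by
      rintro rfl
      exact absurd hij (by simp)
    have hij' : i ≠ j := by rintro rfl; exact lt_irrefl _ hij
    simp [dmat, hrow i hi j, hij']

/-- A plane arc whose tangent direction increases by at most `π` is not closed. -/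
theorem ne_of_tangent_angle_le_pi {γ : ℝ → ℂ} {L : ℝ → ℝ} {ρ : ℝ} (hρ : 0 < ρ) (hL : StrictMono L)
    (hγ : ∀ t, HasDerivAt γ (ρ * Complex.exp (Complex.I * (L t : ℂ))) t) {a b : ℝ} (hab : a < b)
    (hLab : L b - L a ≤ Real.pi) : γ a ≠ γ b := by
  set m := (L a + L b) / 2 with hm
  set h : ℝ → ℝ := fun t => (Complex.exp (-(Complex.I * (m : ℂ))) * γ t).re with hh
  have hd : ∀ t, HasDerivAt h (ρ * Real.cos (L t - m)) t := by
    intro t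
    have h1 := (hγ t).const_mul (Complex.exp (-(Complex.I * (m : ℂ))))
    have h2 := Complex.reCLM.hasFDerivAt.comp_hasDerivAt t h1
    refine h2.congr_deriv ?_
    rw [Complex.reCLM_apply, mul_left_comm, ← Complex.exp_add, Complex.re_ofReal_mul]
    have : -(Complex.I * (m : ℂ)) + Complex.I * (L t : ℂ) = ((L t - m : ℝ) : ℂ) * Complex.I := by
      push_cast; ring
    rw [this, Complex.exp_ofReal_mul_I_re]
  have hmono : StrictMonoOn h (Icc a b) := by
    refine strictMonoOn_of_deriv_pos (convex_Icc a b)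
      (fun t _ => (hd t).continuousAt.continuousWithinAt) fun t ht => ?_
    rw [interior_Icc] at ht
    rw [(hd t).deriv]
    have h1 := hL ht.1
    have h2 := hL ht.2
    exact mul_pos hρ (Real.cos_pos_of_mem_Ioo ⟨by linarith, by linarith⟩)
  intro heq
  have := hmono (left_mem_Icc.2 hab.le) (right_mem_Icc.2 hab.le) hab
  simp only [hh, heq, lt_irrefl] at this

/-- A closed plane curve whose tangent direction turns monotonically by `2π` is simple. -/
theorem injOn_of_tangent_angle_strictMono {g : ℂ → ℂ} {L : ℝ → ℝ} {ρ : ℝ} (hρ : 0 < ρ)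
    (hL : StrictMono L) (hL2 : ∀ t, L (t + 2 * Real.pi) = L t + 2 * Real.pi)
    (hγ : ∀ t, HasDerivAt (fun u : ℝ => g (Complex.exp (Complex.I * (u : ℂ))))
      (ρ * Complex.exp (Complex.I * (L t : ℂ))) t) : InjOn g (sphere (0 : ℂ) 1) := by
  set γ : ℝ → ℂ := fun u => g (Complex.exp (Complex.I * (u : ℂ))) with hγdef
  have hper : ∀ t, Complex.exp (Complex.I * ((t + 2 * Real.pi : ℝ) : ℂ)) =
      Complex.exp (Complex.I * (t : ℂ)) := by
    intro t
    push_cast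
    rw [mul_add, Complex.exp_add, mul_comm Complex.I (2 * (Real.pi : ℂ)), Complex.exp_two_pi_mul_I,
      mul_one]
  have key : ∀ a b, a < b → b < a + 2 * Real.pi → γ a ≠ γ b := by
    intro a b hab hb
    by_cases h : L b - L a ≤ Real.pi
    · exact ne_of_tangent_angle_le_pi hρ hL hγ hab h
    · have h1 := ne_of_tangent_angle_le_pi hρ hL hγ hb (by rw [hL2]; linarith)
      simp only [hγdef, hper] at h1
      exact fun h2 => h1 h2.symm
  have hrep : ∀ z ∈ sphere (0 : ℂ) 1, ∃ t ∈ Ico 0 (2 * Real.pi),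
      Complex.exp (Complex.I * (t : ℂ)) = z := by
    intro z hz
    obtain ⟨k, hk, -⟩ := existsUnique_add_zsmul_mem_Ico Real.two_pi_pos z.arg 0
    refine ⟨_, by simpa using hk, ?_⟩
    have h1 := Complex.norm_mul_exp_arg_mul_I z
    rw [mem_sphere_zero_iff_norm.1 hz, Complex.ofReal_one, one_mul] at h1
    conv_rhs => rw [← h1]
    refine Complex.exp_eq_exp_iff_exists_int.2 ⟨k, ?_⟩
    push_cast
    ring
  intro z hz w hw hzw
  obtain ⟨a, ha, rfl⟩ := hrep z hz
  obtain ⟨b, hb, rfl⟩ := hrep w hw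
  rcases lt_trichotomy a b with h | rfl | h
  · exact absurd hzw (key a b h (by linarith [ha.1, hb.2]))
  · rfl
  · exact absurd hzw.symm (key b a h (by linarith [hb.1, ha.2]))

/-- On the torus, `ψ` determines `z'`, hence `ζ`, and then `z_1` through the simple curve `g`. -/
theorem injOn_normalMap {g : ℂ → ℂ} (hg : InjOn g (sphere (0 : ℂ) 1)) :
    InjOn (normalMap (n := n) g) (torus n) := by
  intro z hz w hw h
  have h1 : ∀ j ≠ 0, z j = w j := by
    intro j hj
    have := congrFun h j
    simpa [normalMap, hj] using this
  have h2 : ∏ j ∈ Finset.univ.erase (0 : Fin n), z j = ∏ j ∈ Finset.univ.erase (0 : Fin n), w j :=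
    Finset.prod_congr rfl fun j hj => h1 j (Finset.ne_of_mem_erase hj)
  have h3 : ‖∏ j ∈ Finset.univ.erase (0 : Fin n), w j‖ = 1 := by
    rw [norm_prod]
    exact Finset.prod_eq_one fun j _ => hw j
  have h4 : ∏ j ∈ Finset.univ.erase (0 : Fin n), w j ≠ 0 := by
    rw [← norm_ne_zero_iff, h3]; exact one_ne_zero
  have h5 := congrFun h 0
  simp only [normalMap, update_self, h2] at h5
  have h6 := hg (by simp [h3, hz 0]) (by simp [h3, hw 0]) (mul_left_cancel₀ (inv_ne_zero h4) h5)
  funext j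
  by_cases hj : j = 0
  · subst hj; exact mul_left_cancel₀ h4 h6
  · exact h1 j hj

/-- If `t + k t` increases strictly, `g` parametrizes a strictly convex curve, and `ψ` is an
embedding. -/
theorem isTorusEmbedding_normalMap {s : WithTop ℕ∞} {g : ℂ → ℂ} {k : ℝ → ℝ} {ρ : ℝ} (hρ : 0 < ρ)
    (hk : StrictMono fun t => t + k t) (hper : Function.Periodic k (2 * Real.pi))
    (hg : ContDiff ℝ s fun u : ℝ => g (Complex.exp (Complex.I * (u : ℂ))))
    (hγ : ∀ t : ℝ, HasDerivAt (fun u : ℝ => g (Complex.exp (Complex.I * (u : ℂ))))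
      ((ρ : ℂ) * Complex.exp (Complex.I * ((t : ℂ) + (k t : ℂ)))) t) :
    IsTorusEmbedding s (normalMap (n := n) g) := by
  refine ⟨contDiff_normalMap_cover hg, fun θ => injective_of_det_dmat_ne_zero ?_, injOn_normalMap ?_⟩
  · rw [← pullbackCoeff_eq_det, pullbackCoeff_normalMap hγ]
    simp [hρ.ne', Complex.exp_ne_zero]
  · refine injOn_of_tangent_angle_strictMono hρ hk (fun t => ?_) (fun t => ?_)
    · simp only [hper t]; ring
    · simpa using hγ t

theorem normalMap_congr {g g' : ℂ → ℂ} (h : EqOn g g' (sphere (0 : ℂ) 1)) :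
    EqOn (normalMap (n := n) g) (normalMap g') (torus n) := by
  intro z hz
  simp only [normalMap]
  rw [h]
  rw [mem_sphere_zero_iff_norm, norm_mul, norm_prod, hz 0, mul_one]
  exact Finset.prod_eq_one fun j _ => hz j

/-- The normal form torus depends, up to unimodular equivalence, only on the derivative of `g`:
adding `c` to `g` amounts to the shear `z_1 ↦ z_1 + c / (z_2 ⋯ z_n)`. -/
theorem unimodularEquiv_normalMap_of_deriv_eq {g g' : ℂ → ℂ} {γ' : ℝ → ℂ}
    (hg : ∀ t, HasDerivAt (fun u : ℝ => g (Complex.exp (Complex.I * (u : ℂ)))) (γ' t) t)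
    (hg' : ∀ t, HasDerivAt (fun u : ℝ => g' (Complex.exp (Complex.I * (u : ℂ)))) (γ' t) t) :
    UnimodularEquiv (normalMap (n := n) g '' torus n) (normalMap g' '' torus n) := by
  obtain ⟨c, hc⟩ : ∃ c, ∀ u : ℝ, g' (Complex.exp (Complex.I * (u : ℂ))) =
      g (Complex.exp (Complex.I * (u : ℂ))) + c := by
    refine ⟨g' 1 - g 1, fun u => ?_⟩
    have h1 := is_const_of_deriv_eq_zero (𝕜 := ℝ)
      (f := fun u : ℝ => g' (Complex.exp (Complex.I * (u : ℂ))) - g (Complex.exp (Complex.I * (u : ℂ))))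
      (fun t => ((hg' t).fun_sub (hg t)).differentiableAt)
      (fun t => by rw [((hg' t).fun_sub (hg t)).deriv, sub_self]) u 0
    simp only [Complex.ofReal_zero, mul_zero, Complex.exp_zero] at h1
    linear_combination h1
  have hcs : EqOn g' (fun z => g z + c) (sphere (0 : ℂ) 1) := by
    intro z hz
    have h1 := Complex.norm_mul_exp_arg_mul_I z
    rw [mem_sphere_zero_iff_norm.1 hz, Complex.ofReal_one, one_mul, mul_comm] at h1
    rw [← h1]
    exact hc _
  rw [image_congr (normalMap_congr hcs)]
  set P : (Fin n → ℂ) → ℂ := fun z => ∏ j ∈ Finset.univ.erase (0 : Fin n), z j with hP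
  set U : Set (Fin n → ℂ) := {z | P z ≠ 0} with hU
  have hPd : Differentiable ℂ P := by
    simp only [hP]; fun_prop
  have hPu : ∀ z a, P (update z 0 a) = P z := fun z a =>
    Finset.prod_congr rfl fun j hj => by rw [update_of_ne (Finset.ne_of_mem_erase hj)]
  set Φ : (Fin n → ℂ) → (Fin n → ℂ) := fun z => update z 0 (z 0 + (P z)⁻¹ * c) with hΦ
  have hΦd : DifferentiableOn ℂ Φ U := by
    rw [differentiableOn_pi]
    intro j
    by_cases hj : j = 0
    · subst hj
      simp only [hΦ, update_self]
      exact DifferentiableOn.add (by fun_prop)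
        ((hPd.differentiableOn.fun_inv fun z hz => hz).mul_const c)
    · simp only [hΦ, update_of_ne hj]; fun_prop
  have hUo : IsOpen U := isOpen_ne_fun hPd.continuous continuous_const
  have key := unimodularEquiv_image (f := Φ) (U := U) (M := normalMap g '' torus n) hUo hΦd ?_ ?_ ?_
  · have : Φ '' (normalMap g '' torus n) = normalMap (fun z => g z + c) '' torus n := by
      rw [image_image]
      refine image_congr fun z _ => ?_
      simp only [hΦ, normalMap, hPu]
      simp [mul_add, hP]
    rwa [this] at key
  · intro z _ w _ h
    have h1 : ∀ j ≠ 0, z j = w j := by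
      intro j hj
      have := congrFun h j
      simpa [hΦ, hj] using this
    have h2 : P z = P w := Finset.prod_congr rfl fun j hj => h1 j (Finset.ne_of_mem_erase hj)
    have h3 := congrFun h 0
    simp only [hΦ, update_self, h2, add_left_inj] at h3
    funext j
    by_cases hj : j = 0
    · subst hj; exact h3
    · exact h1 j hj
  · intro z hz
    have hdz := hΦd.differentiableAt (hUo.mem_nhds hz)
    have hrow : ∀ v, ∀ j ≠ 0, fderiv ℂ Φ z v j = v j := by
      intro v j hj
      have h1 : HasFDerivAt (fun y => Φ y j) (ContinuousLinearMap.proj (R := ℂ) (φ := fun _ : Fin n => ℂ) j) z := by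
        simp only [hΦ, update_of_ne hj]
        exact (ContinuousLinearMap.proj (R := ℂ) (φ := fun _ : Fin n => ℂ) j).hasFDerivAt
      have h2 := (hasFDerivAt_pi'.1 hdz.hasFDerivAt) j
      have := h2.unique h1
      exact congrArg (fun A : (Fin n → ℂ) →L[ℂ] ℂ => A v) this
    rw [det_eq_of_forall_ne_zero _ hrow]
    refine fderiv_single_eq hdz ?_
    simp only [hΦ, update_self, hPu]
    exact (hasDerivAt_id (z 0)).add_const _
  · rintro _ ⟨z, hz, rfl⟩
    simp only [hU, mem_ofPred_eq, normalMap, hPu]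
    rw [hP]
    refine Finset.prod_ne_zero_iff.2 fun j _ => ?_
    rw [← norm_ne_zero_iff, hz j]
    exact one_ne_zero

/-- The curve `θ ↦ -g(-e^{iθ})` belongs to the invariant shifted by `π`. The involution
`(z_1, z_2, z'') ↦ (z_1 z_2², -1 / z_2, z'')`, which is unimodular and reverses the orientation of
the torus, carries one normal form into the other. -/
theorem unimodularEquiv_normalMap_neg (hn : 2 ≤ n) (g : ℂ → ℂ) :
    UnimodularEquiv (normalMap (n := n) g '' torus n)
      (normalMap (fun z => -g (-z)) '' torus n) := by
  set i₁ : Fin n := ⟨1, by omega⟩ with hi₁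
  have h10 : i₁ ≠ 0 := by
    intro h
    have := congrArg Fin.val h
    simp [hi₁] at this
  set Λ : (Fin n → ℂ) → (Fin n → ℂ) := fun z =>
    update (update z 0 (z 0 * z i₁ ^ 2)) i₁ (-(z i₁)⁻¹) with hΛ
  set U : Set (Fin n → ℂ) := {z | z i₁ ≠ 0} with hU
  have hUo : IsOpen U := isOpen_ne_fun (continuous_apply i₁) continuous_const
  have hΛ0 : ∀ z, Λ z 0 = z 0 * z i₁ ^ 2 := fun z => by simp [hΛ, h10.symm]
  have hΛ1 : ∀ z, Λ z i₁ = -(z i₁)⁻¹ := fun z => by simp [hΛ]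
  have hΛj : ∀ z j, j ≠ 0 → j ≠ i₁ → Λ z j = z j := fun z j h0 h1 => by simp [hΛ, h0, h1]
  have hΛd : DifferentiableOn ℂ Λ U := by
    rw [differentiableOn_pi]
    intro j
    by_cases h0 : j = 0
    · subst h0; simp only [hΛ0]; fun_prop
    · by_cases h1 : j = i₁
      · subst h1
        simp only [hΛ1]
        exact ((differentiable_apply (𝕜 := ℂ) i₁).differentiableOn.fun_inv fun z hz => hz).fun_neg
      · simp only [hΛj _ j h0 h1]; fun_prop
  have hinv : ∀ z ∈ U, Λ (Λ z) = z := by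
    intro z hz
    have hz' : z i₁ ≠ 0 := hz
    funext j
    by_cases h0 : j = 0
    · subst h0; rw [hΛ0, hΛ0, hΛ1]; field_simp
    · by_cases h1 : j = i₁
      · subst h1; rw [hΛ1, hΛ1]; field_simp
      · rw [hΛj _ j h0 h1, hΛj _ j h0 h1]
  have key := unimodularEquiv_image (f := Λ) (U := U) (M := normalMap g '' torus n) hUo hΛd
    (fun z hz w hw h => by rw [← hinv z hz, ← hinv w hw, h]) ?_ ?_
  · have hflip : ∀ θ : Fin n → ℝ, Λ (normalMap g (cover θ)) = normalMap (fun z => -g (-z))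
        (cover (update (update θ 0 (θ 0 + 2 * θ i₁)) i₁ (Real.pi - θ i₁))) := by
      intro θ
      set θ' := update (update θ 0 (θ 0 + 2 * θ i₁)) i₁ (Real.pi - θ i₁) with hθ'
      have hθ0 : θ' 0 = θ 0 + 2 * θ i₁ := by simp [hθ', h10.symm]
      have hθ1 : θ' i₁ = Real.pi - θ i₁ := by simp [hθ']
      have hθj : ∀ j, j ≠ 0 → j ≠ i₁ → θ' j = θ j := fun j h0 h1 => by simp [hθ', h0, h1]
      have hm : i₁ ∈ Finset.univ.erase (0 : Fin n) := by simp [h10]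
      have hS : ∑ j ∈ Finset.univ.erase (0 : Fin n), θ' j =
          ∑ j ∈ Finset.univ.erase (0 : Fin n), θ j - 2 * θ i₁ + Real.pi := by
        rw [← Finset.add_sum_erase _ _ hm, ← Finset.add_sum_erase _ (fun j => θ j) hm, hθ1]
        rw [Finset.sum_congr rfl fun j hj => hθj j
          (Finset.ne_of_mem_erase (Finset.mem_of_mem_erase hj)) (Finset.ne_of_mem_erase hj)]
        ring
      funext j
      by_cases h0 : j = 0
      · subst h0
        rw [hΛ0, normalMap_cover_zero, normalMap_cover_ne _ _ h10, normalMap_cover_zero]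
        rw [sum_eq_zero_add θ', hS, hθ0]
        have e1 : Complex.exp (Complex.I * ((θ 0 + 2 * θ i₁ +
            (∑ j ∈ Finset.univ.erase (0 : Fin n), θ j - 2 * θ i₁ + Real.pi) : ℝ) : ℂ)) =
            -Complex.exp (Complex.I * ((∑ j, θ j : ℝ) : ℂ)) := by
          rw [sum_eq_zero_add θ, ← mul_neg_one (Complex.exp _), ← Complex.exp_pi_mul_I,
            ← Complex.exp_add]
          congr 1; push_cast; ring
        have e2 : Complex.exp (-(Complex.I *
            ((∑ j ∈ Finset.univ.erase (0 : Fin n), θ j - 2 * θ i₁ + Real.pi : ℝ) : ℂ))) =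
            -(Complex.exp (-(Complex.I * ((∑ j ∈ Finset.univ.erase (0 : Fin n), θ j : ℝ) : ℂ))) *
              Complex.exp (Complex.I * (θ i₁ : ℂ)) ^ 2) := by
          rw [← Complex.exp_nat_mul, ← Complex.exp_add, ← mul_neg_one (Complex.exp _),
            ← Complex.exp_neg_pi_mul_I, ← Complex.exp_add]
          congr 1; push_cast; ring
        rw [e1, e2, neg_neg]
        ring
      · by_cases h1 : j = i₁
        · subst h1
          rw [hΛ1, normalMap_cover_ne _ _ h10, normalMap_cover_ne _ _ h10, hθ1]
          rw [← Complex.exp_neg, ← mul_neg_one (Complex.exp _), ← Complex.exp_pi_mul_I,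
            ← Complex.exp_add]
          congr 1; push_cast; ring
        · rw [hΛj _ j h0 h1, normalMap_cover_ne _ _ h0, normalMap_cover_ne _ _ h0, hθj j h0 h1]
    have : Λ '' (normalMap g '' torus n) = normalMap (fun z => -g (-z)) '' torus n := by
      rw [image_image]
      apply Subset.antisymm
      · rintro _ ⟨z, hz, rfl⟩
        obtain ⟨θ, rfl⟩ := exists_cover_eq hz
        simp only [hflip]
        exact mem_image_of_mem _ (cover_mem_torus _)
      · rintro _ ⟨z, hz, rfl⟩
        obtain ⟨θ, rfl⟩ := exists_cover_eq hz
        refine ⟨cover (update (update θ 0 (θ 0 + 2 * θ i₁ - 2 * Real.pi)) i₁ (Real.pi - θ i₁)),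
          cover_mem_torus _, ?_⟩
        simp only [hflip]
        congr 2
        funext j
        by_cases h0 : j = 0
        · subst h0; simp [h10.symm]; ring
        · by_cases h1 : j = i₁
          · subst h1; simp
          · simp [h0, h1]
    rwa [this] at key
  · intro z hz
    have hz' : z i₁ ≠ 0 := hz
    have hdz := hΛd.differentiableAt (hUo.mem_nhds hz)
    have hM : ∀ i j, LinearMap.toMatrix' (fderiv ℂ Λ z : (Fin n → ℂ) →ₗ[ℂ] (Fin n → ℂ)) i j =
        fderiv ℂ Λ z (Pi.single j 1) i := fun i j => by
      rw [LinearMap.toMatrix'_apply]; rfl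
    rw [ContinuousLinearMap.det, ← LinearMap.det_toMatrix', Matrix.det_of_isUpperTriangular]
    · have h0 : fderiv ℂ Λ z (Pi.single 0 1) 0 = z i₁ ^ 2 := by
        refine fderiv_single_eq hdz ?_
        simp only [hΛ0, update_self, update_of_ne h10]
        simpa using (hasDerivAt_id (z 0)).mul_const (z i₁ ^ 2)
      have h1 : fderiv ℂ Λ z (Pi.single i₁ 1) i₁ = (z i₁ ^ 2)⁻¹ := by
        refine fderiv_single_eq hdz ?_
        simp only [hΛ1, update_self]
        simpa using (hasDerivAt_inv hz').fun_neg
      have hj : ∀ j, j ≠ 0 → j ≠ i₁ → fderiv ℂ Λ z (Pi.single j 1) j = 1 := by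
        intro j h0 h1
        refine fderiv_single_eq hdz ?_
        simp only [hΛj _ j h0 h1, update_self]
        exact hasDerivAt_id _
      have hm : i₁ ∈ Finset.univ.erase (0 : Fin n) := by simp [h10]
      simp only [hM]
      rw [← Finset.mul_prod_erase _ _ (Finset.mem_univ 0), ← Finset.mul_prod_erase _ _ hm, h0, h1,
        Finset.prod_eq_one fun j hj' => hj j
          (Finset.ne_of_mem_erase (Finset.mem_of_mem_erase hj')) (Finset.ne_of_mem_erase hj')]
      field_simp
    · intro i j hij
      have hij' : i ≠ j := by rintro rfl; exact lt_irrefl _ hij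
      have hi : i ≠ 0 := by
        rintro rfl
        exact absurd hij (by simp)
      rw [hM]
      refine fderiv_single_eq hdz ?_
      by_cases h1 : i = i₁
      · subst h1
        simp only [hΛ1, update_of_ne hij']
        exact hasDerivAt_const _ _
      · simp only [hΛj _ i hi h1, update_of_ne hij']
        exact hasDerivAt_const _ _
  · rintro _ ⟨z, hz, rfl⟩
    simp only [hU, mem_ofPred_eq, normalMap, update_of_ne h10]
    rw [← norm_ne_zero_iff, hz i₁]
    exact one_ne_zero

theorem isTorusEmbedding_normalMap_neg (hn : 2 ≤ n) {s : WithTop ℕ∞} {g : ℂ → ℂ}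
    (h : IsTorusEmbedding s (normalMap (n := n) g)) :
    IsTorusEmbedding s (normalMap (n := n) fun z => -g (-z)) := by
  set i₁ : Fin n := ⟨1, by omega⟩ with hi₁
  have h10 : i₁ ≠ 0 := by
    intro h
    have := congrArg Fin.val h
    simp [hi₁] at this
  -- the reflection of the coordinate `z_2` conjugates the two maps
  let D : (Fin n → ℂ) ≃L[ℂ] (Fin n → ℂ) := LinearEquiv.toContinuousLinearEquiv
    { toFun := fun z => update z i₁ (-z i₁)
      invFun := fun z => update z i₁ (-z i₁)
      map_add' := fun x y => by
        funext j
        by_cases h : j = i₁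
        · subst h; simp [add_comm]
        · simp [h]
      map_smul' := fun c x => by
        funext j
        by_cases h : j = i₁
        · subst h; simp
        · simp [h]
      left_inv := fun x => by simp
      right_inv := fun x => by simp }
  have hD : ∀ z, D z = update z i₁ (-z i₁) := fun _ => rfl
  have hm : i₁ ∈ Finset.univ.erase (0 : Fin n) := by simp [h10]
  have hconj : ∀ z, normalMap (fun z => -g (-z)) z = D (normalMap g (D z)) := by
    intro z
    have hprod : ∏ j ∈ Finset.univ.erase (0 : Fin n), D z j =
        -∏ j ∈ Finset.univ.erase (0 : Fin n), z j := by
      rw [← Finset.mul_prod_erase _ _ hm, ← Finset.mul_prod_erase _ z hm, hD, update_self, neg_mul]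
      congr 2
      exact Finset.prod_congr rfl fun j hj => by rw [update_of_ne (Finset.ne_of_mem_erase hj)]
    have hz0 : D z 0 = z 0 := by rw [hD, update_of_ne h10.symm]
    funext j
    by_cases h0 : j = 0
    · subst h0
      rw [hD, update_of_ne h10.symm]
      simp only [normalMap, update_self, hprod, hz0]
      rw [inv_neg]; ring_nf
    · by_cases h1 : j = i₁
      · subst h1
        rw [hD (normalMap g (D z)), update_self]
        simp [normalMap, hD, h10]
      · rw [hD (normalMap g (D z)), update_of_ne h1]
        simp [normalMap, hD, h0, h1]
  have hDc : ∀ θ : Fin n → ℝ, D (cover θ) = cover (θ + Pi.single i₁ Real.pi) := by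
    intro θ
    funext j
    rw [hD]
    by_cases h1 : j = i₁
    · subst h1
      simp [cover, mul_add, Complex.exp_add, mul_comm Complex.I (Real.pi : ℂ)]
    · simp [cover, h1]
  have hDt : ∀ z ∈ torus n, D z ∈ torus n := by
    intro z hz
    obtain ⟨θ, rfl⟩ := exists_cover_eq hz
    rw [hDc]; exact cover_mem_torus _
  let DR : (Fin n → ℂ) ≃L[ℝ] (Fin n → ℂ) := D.restrictScalars ℝ
  obtain ⟨h1, h2, h3⟩ := h
  have hfun : (fun θ : Fin n → ℝ => normalMap (fun z => -g (-z)) (cover θ)) =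
      fun θ => DR (normalMap g (cover (θ + Pi.single i₁ Real.pi))) := by
    funext θ; rw [hconj, hDc]; rfl
  refine ⟨?_, fun θ => ?_, ?_⟩
  · rw [hfun]
    exact DR.contDiff.comp (h1.comp (contDiff_id.add contDiff_const))
  · rw [hfun]
    have e1 := DR.comp_fderiv (f := fun θ : Fin n → ℝ => normalMap g (cover (θ + Pi.single i₁ Real.pi)))
      (x := θ)
    have e2 := fderiv_comp_add_right (𝕜 := ℝ) (f := fun θ : Fin n → ℝ => normalMap g (cover θ)) (x := θ)
      (Pi.single i₁ Real.pi)
    rw [e2] at e1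
    simp only [comp_def] at e1
    rw [e1]
    exact DR.injective.comp (h2 _)
  · intro z hz w hw hzw
    simp only [hconj] at hzw
    exact D.injective (h3 (hDt z hz) (hDt w hw) (D.injective hzw))

/-- The half turn: if `g` belongs to `k`, then `z ↦ -g(-z)` belongs to `k(· + π)`. -/
theorem HasNormalForm.shift (hn : 2 ≤ n) {s : WithTop ℕ∞} {M : Set (Fin n → ℂ)} {ρ : ℝ} {k : ℝ → ℝ}
    (h : HasNormalForm s M ρ k) : HasNormalForm s M ρ fun t => k (t + Real.pi) := by
  obtain ⟨hρ, hc, hp, hi, g, hg, he, hM⟩ := h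
  refine ⟨hρ, by fun_prop, fun t => ?_, ?_, fun z => -g (-z), fun t => ?_,
    isTorusEmbedding_normalMap_neg hn he, hM.trans (unimodularEquiv_normalMap_neg hn g)⟩
  · simp only
    rw [add_right_comm, hp]
  · rw [intervalIntegral.integral_comp_add_right (fun t => k t), zero_add, add_comm (2 * Real.pi),
      hp.intervalIntegral_add_eq Real.pi 0, zero_add, hi]
  · have h1 := ((hg (t + Real.pi)).comp_add_const t Real.pi).fun_neg
    have h2 : ∀ u : ℝ, Complex.exp (Complex.I * ((u + Real.pi : ℝ) : ℂ)) =
        -Complex.exp (Complex.I * (u : ℂ)) := by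
      intro u
      rw [← mul_neg_one (Complex.exp _), ← Complex.exp_pi_mul_I, ← Complex.exp_add]
      congr 1; push_cast; ring
    simp only [h2] at h1
    refine h1.congr_deriv ?_
    rw [← mul_neg, ← mul_neg_one (Complex.exp _), ← Complex.exp_neg_pi_mul_I, ← Complex.exp_add]
    congr 2; push_cast; ring

end

section
variable {n : ℕ} {δ : ℝ}

/-! ### Modulus and argument of the Jacobian -/

/-- The holomorphic extensions `p` and `a` of the modulus and of the argument of the Jacobian of
`F`, normalized by the Jacobian `Iⁿ e^{i(w_1 + ⋯ + w_n)}` of the covering map. -/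
structure IsPolarJacobian (δ c : ℝ) (F : (Fin n → ℂ) → (Fin n → ℂ)) (a p : (Fin n → ℂ) → ℂ) :
    Prop where
  differentiableOn_arg : DifferentiableOn ℂ a (strip n δ)
  differentiableOn_mod : DifferentiableOn ℂ p (strip n δ)
  arg_periodic : ∀ (x : Fin n → ℝ) (m : Fin n → ℤ), a (toC (x + lat m)) = a (toC x)
  mod_periodic : ∀ (x : Fin n → ℝ) (m : Fin n → ℤ), p (toC (x + lat m)) = p (toC x)
  arg_star : ∀ w, a (star w) = star (a w)
  mod_im : ∀ x : Fin n → ℝ, (p (toC x)).im = 0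
  mod_near_one : ∀ w ∈ strip n δ, ‖p w - 1‖ ≤ 1 / 4
  norm_arg_le : ∀ w ∈ strip n δ, ‖a w‖ ≤ c * δ
  det_eq : ∀ w ∈ strip n δ, (fderiv ℂ F w).det =
    Complex.I ^ n * Complex.exp (Complex.I * ∑ j, w j) * (p w * Complex.exp (Complex.I * a w))

theorem star_mem_strip {w : Fin n → ℂ} (hw : w ∈ strip n δ) : star w ∈ strip n δ := fun j => by
  simpa using hw j

theorem star_toC (x : Fin n → ℝ) : star (toC x) = toC x := by
  funext j; simp [toC]

theorem differentiableOn_star_star {f : (Fin n → ℂ) → ℂ} (hf : DifferentiableOn ℂ f (strip n δ)) :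
    DifferentiableOn ℂ (fun w => star (f (star w))) (strip n δ) := by
  intro w hw
  have h := (hf.differentiableAt (isOpen_strip.mem_nhds (star_mem_strip hw))).star_star
  rw [star_star] at h
  exact h.differentiableWithinAt

/-- Polar decomposition of a holomorphic function close to `1`: with `λ = log h` and
`λ* = conj λ(conj ·)`, take `a = (λ - λ*) / 2i` and `p = exp ((λ + λ*) / 2)`. -/
theorem exists_polar_decomposition {h : (Fin n → ℂ) → ℂ} {η : ℝ}
    (hd : DifferentiableOn ℂ h (strip n δ)) (hη : η ≤ 1 / 16)
    (h1 : ∀ w ∈ strip n δ, ‖h w - 1‖ ≤ η)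
    (hp : ∀ (x : Fin n → ℝ) (m : Fin n → ℤ), h (toC (x + lat m)) = h (toC x)) :
    ∃ a p : (Fin n → ℂ) → ℂ, DifferentiableOn ℂ a (strip n δ) ∧ DifferentiableOn ℂ p (strip n δ) ∧
      (∀ (x : Fin n → ℝ) (m : Fin n → ℤ), a (toC (x + lat m)) = a (toC x)) ∧
      (∀ (x : Fin n → ℝ) (m : Fin n → ℤ), p (toC (x + lat m)) = p (toC x)) ∧
      (∀ w, a (star w) = star (a w)) ∧ (∀ x : Fin n → ℝ, (p (toC x)).im = 0) ∧
      (∀ w ∈ strip n δ, ‖p w - 1‖ ≤ 1 / 4) ∧ (∀ w ∈ strip n δ, ‖a w‖ ≤ 3 / 2 * η) ∧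
      ∀ w ∈ strip n δ, h w = p w * Complex.exp (Complex.I * a w) := by
  let l : (Fin n → ℂ) → ℂ := fun w => Complex.log (h w)
  have hre : ∀ w ∈ strip n δ, 0 < (h w).re := fun w hw => by
    have h2 := (Complex.abs_re_le_norm (h w - 1)).trans (h1 w hw)
    have := (abs_le.1 h2).1
    simp only [Complex.sub_re, Complex.one_re] at this
    linarith
  have hl : DifferentiableOn ℂ l (strip n δ) := fun w hw =>
    ((hd.differentiableAt (isOpen_strip.mem_nhds hw)).clog (Or.inl (hre w hw))).differentiableWithinAt
  have hlb : ∀ w ∈ strip n δ, ‖l w‖ ≤ 3 / 2 * η := fun w hw => by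
    have := Complex.norm_log_one_add_half_le_self (z := h w - 1) (by linarith [h1 w hw])
    rw [add_sub_cancel] at this
    linarith [h1 w hw]
  have hls := differentiableOn_star_star hl
  have hlsb : ∀ w ∈ strip n δ, ‖star (l (star w))‖ ≤ 3 / 2 * η := fun w hw => by
    rw [norm_star]; exact hlb _ (star_mem_strip hw)
  have hlp : ∀ (x : Fin n → ℝ) (m : Fin n → ℤ), l (toC (x + lat m)) = l (toC x) := fun x m => by
    simp only [l, hp]
  refine ⟨fun w => (2 * Complex.I)⁻¹ * (l w - star (l (star w))),
    fun w => Complex.exp (2⁻¹ * (l w + star (l (star w)))), (hl.sub hls).const_mul _,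
    ((hl.add hls).const_mul _).cexp, ?_, ?_, ?_, ?_, ?_, ?_, ?_⟩
  · intro x m; simp only [star_toC, hlp]
  · intro x m; simp only [star_toC, hlp]
  · intro w
    simp only [star_star, star_mul', star_sub, star_inv₀, Complex.star_def, Complex.conj_I, map_ofNat]
    rw [Complex.conj_conj, mul_neg, inv_neg]; ring
  · intro x
    beta_reduce
    rw [star_toC]
    have : (2⁻¹ : ℂ) * (l (toC x) + star (l (toC x))) = (((l (toC x)).re : ℝ) : ℂ) := by
      rw [Complex.star_def, Complex.add_conj]; push_cast; ring
    rw [this, Complex.exp_ofReal_im]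
  · intro w hw
    have h3 : ‖(2⁻¹ : ℂ) * (l w + star (l (star w)))‖ ≤ 3 / 2 * η := by
      rw [norm_mul]
      have := (norm_add_le (l w) (star (l (star w)))).trans (add_le_add (hlb w hw) (hlsb w hw))
      simp only [norm_inv, Complex.norm_ofNat]
      linarith
    exact (Complex.norm_exp_sub_one_le (by linarith)).trans (by linarith)
  · intro w hw
    rw [norm_mul]
    have := (norm_sub_le (l w) (star (l (star w)))).trans (add_le_add (hlb w hw) (hlsb w hw))
    simp only [norm_inv, norm_mul, Complex.norm_ofNat, Complex.norm_I, mul_one]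
    linarith
  · intro w hw
    rw [← Complex.exp_add]
    have : 2⁻¹ * (l w + star (l (star w))) +
        Complex.I * ((2 * Complex.I)⁻¹ * (l w - star (l (star w)))) = l w := by
      field_simp; ring
    rw [this, Complex.exp_log]
    exact fun h0 => by have := hre w hw; rw [h0] at this; simp at this

theorem differentiable_det_one_add :
    Differentiable ℂ fun E : Fin n → Fin n → ℂ => (1 + Matrix.of E).det := by
  have : (fun E : Fin n → Fin n → ℂ => (1 + Matrix.of E).det) =
      fun E => ∑ σ : Equiv.Perm (Fin n), (Equiv.Perm.sign σ : ℤ) •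
        ∏ i, ((1 : Matrix (Fin n) (Fin n) ℂ) (σ i) i + E (σ i) i) := by
    funext E
    simp only [Matrix.det_apply]
    rfl
  rw [this]
  simp only [zsmul_eq_mul]
  fun_prop

theorem exists_norm_det_one_add_sub_one_le (n : ℕ) : ∃ C > 0, ∃ η > 0,
    ∀ (E : Fin n → Fin n → ℂ) (t : ℝ), 0 ≤ t → t ≤ η → (∀ i j, ‖E i j‖ ≤ t) →
      ‖(1 + Matrix.of E).det - 1‖ ≤ C * t := by
  let D : (Fin n → Fin n → ℂ) → ℂ := fun E => (1 + Matrix.of E).det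
  have hD : Differentiable ℂ D := differentiable_det_one_add
  have hO := (hD 0).isBigO_sub
  obtain ⟨C, hC, hO⟩ := hO.exists_pos
  rw [Asymptotics.IsBigOWith, Metric.eventually_nhds_iff] at hO
  obtain ⟨η, hη, hO⟩ := hO
  refine ⟨C, hC, η / 2, by positivity, fun E t ht htη hE => ?_⟩
  have hn : ‖E‖ ≤ t := (pi_norm_le_iff_of_nonneg ht).2 fun i =>
    (pi_norm_le_iff_of_nonneg ht).2 fun j => hE i j
  have := hO (y := E) (by rw [dist_zero_right]; linarith)
  simp only [D, sub_zero] at this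
  have h0 : (1 + Matrix.of (0 : Fin n → Fin n → ℂ)).det = 1 := by
    rw [Matrix.of_zero, add_zero, Matrix.det_one]
  rw [h0] at this
  exact this.trans (by gcongr)

theorem ccover_mem_annulus {r : ℝ} {w : Fin n → ℂ} : ccover w ∈ annulus n r ↔ w ∈ strip n r := by
  simp only [annulus, strip, ccover, mem_ofPred_eq, Complex.norm_exp, Real.exp_lt_exp, abs_lt]
  refine forall_congr' fun j => ?_
  simp only [Complex.mul_re, Complex.I_re, Complex.I_im, zero_mul, one_mul, zero_sub]
  constructor <;> rintro ⟨h1, h2⟩ <;> constructor <;> linarith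

theorem IsNearIdentity.norm_sub_le {ε r : ℝ} {φ : (Fin n → ℂ) → (Fin n → ℂ)} (hε : 0 < ε)
    (h : IsNearIdentity ε r φ) {z : Fin n → ℂ} (hz : z ∈ annulus n r) : ‖φ z - z‖ ≤ ε * r ^ 4 := by
  have hr : 0 ≤ ε * r ^ 4 := by positivity
  refine (pi_norm_le_iff_of_nonneg hr).2 fun j => ?_
  have h1 : ‖(φ z - z) j‖ₑ ≤ ENNReal.ofReal (ε * r ^ 4) :=
    (le_iSup (fun j => ‖(φ z - z) j‖ₑ) j).trans
      ((le_iSup₂ (f := fun z (_ : z ∈ annulus n r) => ⨆ j, ‖(φ z - z) j‖ₑ) z hz).trans h.2.2)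
  rwa [← ofReal_norm, ENNReal.ofReal_le_ofReal_iff hr] at h1

theorem ball_subset_strip {x : Fin n → ℂ} {r s : ℝ} (hx : x ∈ strip n r) :
    ball x s ⊆ strip n (r + s) := by
  intro y hy j
  have h1 : ‖y j - x j‖ < s := (norm_le_pi_norm (y - x) j).trans_lt (by rwa [← dist_eq_norm])
  have h2 := (Complex.abs_im_le_norm (y j - x j)).trans_lt h1
  have h3 := hx j
  rw [Complex.sub_im] at h2
  rw [abs_lt] at *
  constructor <;> linarith

theorem hasFDerivAt_add_const {f : (Fin n → ℂ) → (Fin n → ℂ)} {v : Fin n → ℂ}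
    (h : ∀ w, f (w + v) = f w) (w : Fin n → ℂ) : fderiv ℂ f (w + v) = fderiv ℂ f w := by
  rw [← fderiv_comp_add_right]
  simp only [h]

/-- The Jacobian of a map near the identity has a modulus and an argument that extend
holomorphically to a strip. The Cauchy estimate loses a factor `r`, so the Jacobian is within
`O(ε r³)` of that of the covering map, and the argument is small compared with the width of the
strip. -/
theorem exists_isPolarJacobian (n : ℕ) {c : ℝ} (hc : 0 < c) : ∃ ε > 0, ∀ (r : ℝ)
    (φ : (Fin n → ℂ) → (Fin n → ℂ)), 0 < r → r < 1 → IsNearIdentity ε r φ →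
      ∃ a p, IsPolarJacobian (r / 2) c (fun w => φ (ccover w)) a p := by
  obtain ⟨C, hC, η, hη, hdet⟩ := exists_norm_det_one_add_sub_one_le n
  -- the entries of the relative Jacobian differ from those of `1` by at most `12 ε r ^ 3`
  refine ⟨min (η / 12) (min (1 / (192 * C)) (c / (36 * C))), by positivity, fun r φ hr hr1 h => ?_⟩
  set ε := min (η / 12) (min (1 / (192 * C)) (c / (36 * C))) with hεdef
  have hε : 0 < ε := by positivity
  have hε1 : 12 * ε ≤ η := by
    have := min_le_left (η / 12) (min (1 / (192 * C)) (c / (36 * C)))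
    linarith
  have hε2 : C * (12 * ε) ≤ 1 / 16 := by
    have : ε ≤ 1 / (192 * C) := (min_le_right _ _).trans (min_le_left _ _)
    rw [le_div_iff₀ (by positivity)] at this
    linarith
  have hε3 : 3 / 2 * (C * (12 * ε)) ≤ c / 2 := by
    have : ε ≤ c / (36 * C) := (min_le_right _ _).trans (min_le_right _ _)
    rw [le_div_iff₀ (by positivity)] at this
    linarith
  set F : (Fin n → ℂ) → (Fin n → ℂ) := fun w => φ (ccover w)
  have hsub : strip n (r / 2) ⊆ strip n r := fun w hw j => (hw j).trans (by linarith)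
  have hF : DifferentiableOn ℂ F (strip n r) :=
    h.1.comp differentiable_ccover.differentiableOn fun w hw => ccover_mem_annulus.2 hw
  let v : (Fin n → ℂ) → (Fin n → ℂ) := fun w => F w - ccover w
  have hv : DifferentiableOn ℂ v (strip n r) := hF.sub differentiable_ccover.differentiableOn
  have hvb : ∀ w ∈ strip n r, ‖v w‖ ≤ ε * r ^ 4 := fun w hw =>
    h.norm_sub_le hε (ccover_mem_annulus.2 hw)
  have hvd : ∀ w ∈ strip n (r / 2), ‖fderiv ℂ v w‖ ≤ 4 * ε * r ^ 3 := fun w hw => by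
    have hb : ball w (r / 2) ⊆ strip n r := by
      have := ball_subset_strip (s := r / 2) hw
      rwa [add_halves] at this
    refine (norm_fderiv_le_of_bounded (half_pos hr) (hv.mono hb) fun y hy =>
      hvb y (hb hy)).trans (le_of_eq ?_)
    field_simp
    ring
  let E : (Fin n → ℂ) → Fin n → Fin n → ℂ := fun w i j =>
    (Complex.I * Complex.exp (Complex.I * w i))⁻¹ * fderiv ℂ v w (Pi.single j 1) i
  have hexp : ∀ w ∈ strip n (r / 2), ∀ i,
      ‖(Complex.I * Complex.exp (Complex.I * w i))⁻¹‖ ≤ 3 := fun w hw i => by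
    rw [norm_inv, norm_mul, Complex.norm_I, one_mul, Complex.norm_exp, ← Real.exp_neg]
    have h1 : -(Complex.I * w i).re ≤ 1 := by
      have := (abs_lt.1 (hw i)).2
      simp only [Complex.mul_re, Complex.I_re, Complex.I_im]
      linarith
    exact (Real.exp_le_exp.2 h1).trans (Real.exp_one_lt_d9.le.trans (by norm_num))
  have hr3 : r ^ 3 ≤ r := by nlinarith [sq_nonneg r, mul_pos hr hr]
  have hE : ∀ w ∈ strip n (r / 2), ∀ i j, ‖E w i j‖ ≤ 12 * ε * r := fun w hw i j => by
    simp only [E]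
    rw [norm_mul]
    have h1 : ‖fderiv ℂ v w (Pi.single j 1) i‖ ≤ 4 * ε * r ^ 3 := by
      refine (norm_le_pi_norm _ i).trans (((fderiv ℂ v w).le_opNorm _).trans ?_)
      rw [Pi.norm_single, norm_one, mul_one]
      exact hvd w hw
    calc _ ≤ 3 * (4 * ε * r ^ 3) := mul_le_mul (hexp w hw i) h1 (norm_nonneg _) (by norm_num)
      _ ≤ 3 * (4 * ε * r) := by gcongr
      _ = _ := by ring
  let g : (Fin n → ℂ) → ℂ := fun w => (1 + Matrix.of (E w)).det
  have hg1 : ∀ w ∈ strip n (r / 2), ‖g w - 1‖ ≤ C * (12 * ε) * r := fun w hw =>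
    (hdet (E w) (12 * ε * r) (by positivity) (by nlinarith) (hE w hw)).trans
      (le_of_eq (by ring))
  have hfd : ∀ w ∈ strip n (r / 2), (fderiv ℂ F w).det =
      Complex.I ^ n * Complex.exp (Complex.I * ∑ j, w j) * g w := fun w hw => by
    have hvw := hv.differentiableAt (isOpen_strip.mem_nhds (hsub hw))
    have hsum : fderiv ℂ F w = fderiv ℂ ccover w + fderiv ℂ v w := by
      rw [← fderiv_add (differentiable_ccover w) hvw]
      congr 1
      funext y; simp [v]
    have hcc : ∀ i j, fderiv ℂ ccover w (Pi.single j 1) i =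
        (Complex.I * Complex.exp (Complex.I * w i)) * (1 : Matrix (Fin n) (Fin n) ℂ) i j := by
      intro i j
      refine fderiv_single_eq (differentiable_ccover w) ?_
      simp only [ccover]
      rcases eq_or_ne i j with rfl | hij
      · simp only [update_self, Matrix.one_apply_eq, mul_one]
        have := ((hasDerivAt_id (w i)).const_mul Complex.I).cexp
        simpa [mul_comm] using this
      · simp only [update_of_ne hij, Matrix.one_apply_ne hij, mul_zero]
        exact hasDerivAt_const _ _
    have hmat : LinearMap.toMatrix' (fderiv ℂ F w : (Fin n → ℂ) →ₗ[ℂ] (Fin n → ℂ)) =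
        Matrix.of fun i j => (Complex.I * Complex.exp (Complex.I * w i)) *
          (1 + Matrix.of (E w)) i j := by
      ext i j
      rw [LinearMap.toMatrix'_apply, ContinuousLinearMap.coe_coe, hsum,
        add_apply, Pi.add_apply, hcc]
      simp only [Matrix.of_apply, Matrix.add_apply, E]
      have : Complex.exp (Complex.I * w i) ≠ 0 := Complex.exp_ne_zero _
      field_simp
    rw [ContinuousLinearMap.det, ← LinearMap.det_toMatrix', hmat, Matrix.det_mul_column,
      Finset.prod_mul_distrib, Finset.prod_const, Finset.card_univ, Fintype.card_fin,
      Finset.mul_sum, Complex.exp_sum]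
  have hgd : DifferentiableOn ℂ g (strip n (r / 2)) := by
    have hEd : ∀ i j, DifferentiableOn ℂ (fun w => E w i j) (strip n (r / 2)) := fun i j => by
      refine DifferentiableOn.mul ?_ ?_
      · refine DifferentiableOn.fun_inv (by fun_prop) fun w _ => ?_
        exact mul_ne_zero Complex.I_ne_zero (Complex.exp_ne_zero _)
      · exact differentiableOn_pi.1 ((differentiableOn_fderiv_apply isOpen_strip hv
          (Pi.single j 1)).mono hsub) i
    exact differentiable_det_one_add.comp_differentiableOn
      (differentiableOn_pi.2 fun i => differentiableOn_pi.2 fun j => hEd i j)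
  have hgp : ∀ (x : Fin n → ℝ) (m : Fin n → ℤ), g (toC (x + lat m)) = g (toC x) := by
    intro x m
    have h1 : ∀ w, ccover (w + toC (lat m)) = ccover w := fun w => ccover_eq_iff.2 ⟨m, rfl⟩
    have h2 : ∀ w, v (w + toC (lat m)) = v w := fun w => by simp only [v, F, h1]
    have h3 : E (toC (x + lat m)) = E (toC x) := by
      funext i j
      simp only [E]
      have := congrFun (h1 (toC x)) i
      simp only [ccover] at this
      rw [toC_add, this, hasFDerivAt_add_const h2]
    simp only [g, h3]
  obtain ⟨a, p, ha, hp, hap, hpp, has, hpi, hp1, hab, hap'⟩ :=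
    exists_polar_decomposition hgd (η := C * (12 * ε) * r) (by nlinarith) hg1 hgp
  refine ⟨a, p, ha, hp, hap, hpp, has, hpi, hp1, fun w hw => (hab w hw).trans ?_, fun w hw => ?_⟩
  · nlinarith
  · rw [hfd w hw, hap' w hw]

end

section
variable {n : ℕ} {δ : ℝ}

/-! ### Straightening the argument of the Jacobian -/

theorem eq_toC_of_star_eq {w : Fin n → ℂ} (h : star w = w) : w = toC fun j => (w j).re := by
  funext j
  exact (Complex.conj_eq_iff_re.1 (congrFun h j)).symm

section
variable [NeZero n]

/-- The change of variables that makes the argument `π / 2 + w_1 + ⋯ + w_n + a(w)` of the Jacobian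
the first coordinate. -/
def straighten (a : (Fin n → ℂ) → ℂ) (w : Fin n → ℂ) : Fin n → ℂ :=
  shear ℂ w + Pi.single 0 (Real.pi / 2 + a w)

theorem straighten_zero (a : (Fin n → ℂ) → ℂ) (w : Fin n → ℂ) :
    straighten a w 0 = ∑ j, w j + (Real.pi / 2 + a w) := by
  simp [straighten, shear_apply]

theorem straighten_ne (a : (Fin n → ℂ) → ℂ) (w : Fin n → ℂ) {j : Fin n} (hj : j ≠ 0) :
    straighten a w j = w j := by
  simp [straighten, shear_apply, hj]

theorem hasFDerivAt_straighten {a : (Fin n → ℂ) → ℂ} {w : Fin n → ℂ} (ha : DifferentiableAt ℂ a w) :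
    HasFDerivAt (straighten a) ((shear ℂ : (Fin n → ℂ) ≃L[ℂ] (Fin n → ℂ)).toContinuousLinearMap +
      (ContinuousLinearMap.single ℂ (fun _ : Fin n => ℂ) 0).comp (fderiv ℂ a w)) w :=
  (shear ℂ : (Fin n → ℂ) ≃L[ℂ] (Fin n → ℂ)).toContinuousLinearMap.hasFDerivAt.add
    ((ContinuousLinearMap.single ℂ (fun _ : Fin n => ℂ) 0).hasFDerivAt.comp w
      (ha.hasFDerivAt.const_add _))

theorem det_fderiv_straighten {a : (Fin n → ℂ) → ℂ} {w : Fin n → ℂ} (ha : DifferentiableAt ℂ a w) :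
    (fderiv ℂ (straighten a) w).det = 1 + fderiv ℂ a w (Pi.single 0 1) := by
  rw [(hasFDerivAt_straighten ha).fderiv, det_eq_of_forall_ne_zero]
  · simp [shear_apply]
  · intro v j hj
    simp [shear_apply, hj]

theorem star_straighten {a : (Fin n → ℂ) → ℂ} (hs : ∀ w, a (star w) = star (a w)) (w : Fin n → ℂ) :
    straighten a (star w) = star (straighten a w) := by
  funext j
  by_cases hj : j = 0
  · subst hj
    rw [Pi.star_apply, straighten_zero, straighten_zero, hs]
    simp [Complex.conj_ofReal]
  · rw [Pi.star_apply, straighten_ne a _ hj, straighten_ne a _ hj, Pi.star_apply]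

/-- For an argument `a` small compared with the width of the strip, straightening is injective on
a smaller strip and its image contains a strip. -/
theorem exists_straighten_inverse (n : ℕ) [NeZero n] : ∃ c > 0, ∀ (δ : ℝ) (a : (Fin n → ℂ) → ℂ),
    0 < δ → DifferentiableOn ℂ a (strip n δ) → (∀ w, a (star w) = star (a w)) →
    (∀ w ∈ strip n δ, ‖a w‖ ≤ c * δ) →
    ∃ (δ₁ δ₂ : ℝ) (Z : (Fin n → ℂ) → (Fin n → ℂ)), 0 < δ₁ ∧ 0 < δ₂ ∧ δ₁ ≤ δ / 2 ∧
      DifferentiableOn ℂ Z (strip n δ₂) ∧ MapsTo (straighten a) (strip n δ₁) (strip n δ₂) ∧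
      (∀ y ∈ strip n δ₂, Z y ∈ strip n (δ / 2) ∧ straighten a (Z y) = y) ∧
      InjOn (straighten a) (strip n (δ / 2)) ∧
      ∀ w ∈ strip n (δ / 2), ‖fderiv ℂ a w‖ ≤ 1 / 4 := by
  set N : NNReal := ‖((shear ℂ : (Fin n → ℂ) ≃L[ℂ] (Fin n → ℂ)).symm :
    (Fin n → ℂ) →L[ℂ] (Fin n → ℂ))‖₊ with hN
  have hN0 : 0 < N := ContinuousLinearEquiv.nnnorm_symm_pos _
  set c : NNReal := min (1 / 16) (N⁻¹ / 16) with hc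
  have hc0 : 0 < c := by
    rw [hc]; exact lt_min (by positivity) (by positivity)
  have hc1 : (c : ℝ) ≤ 1 / 16 := by
    have : c ≤ 1 / 16 := min_le_left _ _
    exact_mod_cast this
  have hc2 : (16 * c : ℝ) ≤ (N : ℝ)⁻¹ := by
    have : c ≤ N⁻¹ / 16 := min_le_right _ _
    have : (c : ℝ) ≤ (N : ℝ)⁻¹ / 16 := by exact_mod_cast this
    linarith
  have hc0' : (0 : ℝ) < c := by exact_mod_cast hc0
  refine ⟨c, hc0', fun δ a hδ ha hs hb => ?_⟩
  have hsub : strip n (δ / 2) ⊆ strip n δ := fun w hw j => (hw j).trans (by linarith)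
  have had : ∀ w ∈ strip n (δ / 2), DifferentiableAt ℂ a w := fun w hw =>
    ha.differentiableAt (isOpen_strip.mem_nhds (hsub hw))
  have hfd : ∀ w ∈ strip n (δ / 2), ‖fderiv ℂ a w‖ ≤ 4 * c := fun w hw => by
    have hbs : ball w (δ / 2) ⊆ strip n δ := by
      have := ball_subset_strip (s := δ / 2) hw
      rwa [add_halves] at this
    refine (norm_fderiv_le_of_bounded (half_pos hδ) (ha.mono hbs) fun y hy =>
      hb y (hbs hy)).trans (le_of_eq ?_)
    field_simp
    ring
  have hlip : ∀ x ∈ strip n (δ / 2), ∀ y ∈ strip n (δ / 2), ‖a x - a y‖ ≤ 4 * c * ‖x - y‖ :=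
    fun x hx y hy => convex_strip.norm_image_sub_le_of_norm_fderiv_le had hfd hy hx
  have happ : ApproximatesLinearOn (straighten a)
      (shear ℂ : (Fin n → ℂ) ≃L[ℂ] (Fin n → ℂ)).toContinuousLinearMap
      (strip n (δ / 2)) (4 * c) := by
    intro x hx y hy
    have : straighten a x - straighten a y -
        (shear ℂ : (Fin n → ℂ) ≃L[ℂ] (Fin n → ℂ)).toContinuousLinearMap (x - y) = Pi.single 0 (a x - a y) := by
      simp only [straighten, ContinuousLinearEquiv.coe_coe, map_sub]
      rw [show a x - a y = (Real.pi / 2 + a x) - (Real.pi / 2 + a y) by ring, Pi.single_sub]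
      abel
    rw [this, Pi.norm_single]
    simpa using hlip x hx y hy
  have hlt : 4 * c < N⁻¹ := by
    have : (4 * c : ℝ) < (N : ℝ)⁻¹ := by linarith
    exact_mod_cast this
  have hinj : InjOn (straighten a) (strip n (δ / 2)) := happ.injOn (Or.inr hlt)
  have hdiff : DifferentiableOn ℂ (straighten a) (strip n (δ / 2)) := fun w hw =>
    (hasFDerivAt_straighten (had w hw)).differentiableAt.differentiableWithinAt
  obtain ⟨e, hes, hef, hed⟩ := exists_biholomorphic isOpen_strip hdiff hinj fun w hw => by
    rw [det_fderiv_straighten (had w hw)]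
    intro h0
    have h1 : ‖fderiv ℂ a w (Pi.single 0 1)‖ ≤ 4 * c := by
      refine ((fderiv ℂ a w).le_opNorm _).trans ?_
      rw [Pi.norm_single, norm_one, mul_one]
      exact hfd w hw
    rw [show fderiv ℂ a w (Pi.single 0 1) = -1 by linear_combination h0, norm_neg, norm_one] at h1
    linarith
  -- a strip around the real points that is covered by the image
  set δ₂ : ℝ := δ / (8 * n) with hδ₂
  have hn : (0 : ℝ) < n := by exact_mod_cast Nat.pos_of_ne_zero (NeZero.ne n)
  have hδ₂0 : 0 < δ₂ := by positivity
  have hsurj : strip n δ₂ ⊆ e.target := by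
    intro y hy
    set b : Fin n → ℂ := (shear ℂ).symm (y - Pi.single 0 (Real.pi / 2 : ℂ)) with hbdef
    have hb0 : b ∈ strip n (δ / 8) := by
      intro j
      have hδn : δ₂ * n = δ / 8 := by rw [hδ₂]; field_simp
      have h1n : (1 : ℝ) ≤ n := by exact_mod_cast Nat.pos_of_ne_zero (NeZero.ne n)
      by_cases hj : j = 0
      · subst hj
        have h1 : (b 0).im = (y 0).im - ∑ j ∈ Finset.univ.erase 0, (y j).im := by
          simp only [hbdef, shear_symm_apply, update_self, Pi.sub_apply, Pi.single_eq_same,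
            Complex.sub_im]
          rw [show ((Real.pi : ℂ) / 2).im = 0 by
            rw [show (Real.pi : ℂ) / 2 = ((Real.pi / 2 : ℝ) : ℂ) by push_cast; ring,
              Complex.ofReal_im], sub_zero]
          congr 1
          rw [Complex.im_sum]
          refine Finset.sum_congr rfl fun j hj => ?_
          rw [Pi.single_eq_of_ne (Finset.ne_of_mem_erase hj), sub_zero]
        rw [h1]
        calc _ ≤ |(y 0).im| + |∑ j ∈ Finset.univ.erase 0, (y j).im| := abs_sub _ _
          _ ≤ |(y 0).im| + ∑ j ∈ Finset.univ.erase 0, |(y j).im| := by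
            gcongr; exact Finset.abs_sum_le_sum_abs _ _
          _ = ∑ j, |(y j).im| := Finset.add_sum_erase _ (fun j => |(y j).im|) (Finset.mem_univ 0)
          _ < ∑ _j : Fin n, δ₂ := Finset.sum_lt_sum_of_nonempty ⟨0, Finset.mem_univ 0⟩
            fun j _ => hy j
          _ = δ / 8 := by rw [Finset.sum_const, Finset.card_univ, Fintype.card_fin, nsmul_eq_mul,
            mul_comm, hδn]
      · have h1 : b j = y j := by simp [hbdef, shear_symm_apply, hj]
        rw [h1]
        exact (hy j).trans_le (by nlinarith)
    have hcb : closedBall b (δ / 4) ⊆ strip n (δ / 2) := by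
      have := ball_subset_strip (s := 3 * δ / 8) hb0
      rw [show δ / 8 + 3 * δ / 8 = δ / 2 by ring] at this
      exact (closedBall_subset_ball (by linarith)).trans this
    have h1 := happ.closedBall_subset_target (Or.inr hlt) isOpen_strip (by positivity) hcb
    have h2 : y ∈ closedBall (straighten a b) (((N : ℝ)⁻¹ - (4 * c : NNReal)) * (δ / 4)) := by
      rw [mem_closedBall, dist_comm, dist_eq_norm]
      have h3 : straighten a b - y = Pi.single 0 (a b) := by
        simp only [straighten, hbdef, ContinuousLinearEquiv.apply_symm_apply, Pi.single_add]
        abel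
      rw [h3, Pi.norm_single]
      refine (hb b (hsub (hcb (mem_closedBall_self (by positivity))))).trans ?_
      push_cast
      nlinarith
    have h4 : y ∈ straighten a '' strip n (δ / 2) := h1 h2
    obtain ⟨w, hw, rfl⟩ := h4
    rw [← hef]
    exact e.map_source (hes ▸ hw)
  have hδ₁ : 0 < min (δ / 2) (δ₂ / (n + 1)) := by positivity
  refine ⟨min (δ / 2) (δ₂ / (n + 1)), δ₂, e.symm, hδ₁, hδ₂0, min_le_left _ _, hed.mono hsurj, ?_,
    fun y hy => ⟨hes ▸ e.map_target (hsurj hy), by rw [← hef]; exact e.right_inv (hsurj hy)⟩, hinj,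
    fun w hw => (hfd w hw).trans (by linarith)⟩
  intro w hw j
  set δ₁ := min (δ / 2) (δ₂ / (n + 1)) with hδ₁def
  have hle1 : δ₁ ≤ δ / 2 := min_le_left _ _
  have hle2 : δ₁ * (n + 1) ≤ δ₂ := by
    have : δ₁ ≤ δ₂ / (n + 1) := min_le_right _ _
    rwa [le_div_iff₀ (by positivity)] at this
  by_cases hj : j = 0
  · subst hj
    set x : Fin n → ℝ := fun j => (w j).re
    have hxw : ‖w - toC x‖ ≤ δ₁ := by
      refine (pi_norm_le_iff_of_nonneg hδ₁.le).2 fun j => ?_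
      have : (w - toC x) j = (w j).im * Complex.I := by
        simp only [Pi.sub_apply, toC, x]
        linear_combination -Complex.re_add_im (w j)
      rw [this, norm_mul, Complex.norm_I, mul_one, Complex.norm_real]
      exact (hw j).le
    have h1 : |(a w).im| ≤ 4 * c * δ₁ := by
      have h2 : (a (toC x)).im = 0 := by
        have := hs (toC x)
        rw [star_toC] at this
        exact Complex.conj_eq_iff_im.1 this.symm
      have h3 := hlip w (fun j => (hw j).trans_le hle1) (toC x) (toC_mem_strip (half_pos hδ) x)
      have h4 := Complex.abs_im_le_norm (a w - a (toC x))
      rw [Complex.sub_im, h2, sub_zero] at h4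
      exact h4.trans (h3.trans (by gcongr))
    have h5 : (straighten a w 0).im = ∑ j, (w j).im + (a w).im := by
      rw [straighten_zero]
      rw [show (Real.pi : ℂ) / 2 = ((Real.pi / 2 : ℝ) : ℂ) by push_cast; ring]
      simp only [Complex.add_im, Complex.im_sum, Complex.ofReal_im, zero_add]
    rw [h5]
    calc _ ≤ |∑ j, (w j).im| + |(a w).im| := abs_add_le _ _
      _ ≤ ∑ j, |(w j).im| + 4 * c * δ₁ := by
        gcongr; exact Finset.abs_sum_le_sum_abs _ _
      _ < ∑ _j : Fin n, δ₁ + δ₁ := by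
        refine add_lt_add_of_lt_of_le (Finset.sum_lt_sum_of_nonempty ⟨0, Finset.mem_univ 0⟩
          fun j _ => hw j) ?_
        nlinarith
      _ ≤ δ₂ := by
        rw [Finset.sum_const, Finset.card_univ, Fintype.card_fin, nsmul_eq_mul]
        linarith
  · rw [straighten_ne a w hj]
    refine (hw j).trans_le ?_
    nlinarith

end

/-! ### Lattice bijections -/

theorem IsLatticeBijective.comp {X X' : (Fin n → ℝ) → (Fin n → ℝ)} (h : IsLatticeBijective X)
    (h' : IsLatticeBijective X') : IsLatticeBijective (X ∘ X') where
  map_add x m := by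
    obtain ⟨m', hm'⟩ := h'.map_add x m
    obtain ⟨m'', hm''⟩ := h.map_add (X' x) m'
    exact ⟨m'', by simp only [comp_apply, hm', hm'']⟩
  injective x y m hxy := by
    obtain ⟨m', hm'⟩ := h.injective _ _ m hxy
    exact h'.injective _ _ m' hm'
  surjective y := by
    obtain ⟨u, m, hu⟩ := h.surjective y
    obtain ⟨x, m', hx⟩ := h'.surjective u
    obtain ⟨m'', hm''⟩ := h.map_add u m'
    exact ⟨x, m + m'', by rw [comp_apply, hx, hm'', hu, lat_add, add_assoc]⟩

theorem isLatticeBijective_add_const (v : Fin n → ℝ) : IsLatticeBijective fun x => x + v where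
  map_add x m := ⟨m, by abel⟩
  injective x y m h := ⟨m, by
    have : x + v = y + lat m + v := by rw [h]; abel
    exact add_right_cancel this⟩
  surjective y := ⟨y - v, 0, by simp [lat_zero]⟩

theorem isLatticeBijective_shear_symm [NeZero n] : IsLatticeBijective (n := n) (shear ℝ).symm where
  map_add x m := ⟨_, by rw [map_add, shear_symm_lat]⟩
  injective x y m h := ⟨_, by
    have := congrArg (shear ℝ) h
    rwa [map_add, shear_lat, ContinuousLinearEquiv.apply_symm_apply,
      ContinuousLinearEquiv.apply_symm_apply] at this⟩
  surjective y := ⟨shear ℝ y, 0, by simp [lat_zero]⟩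

/-- A triangular map with strictly increasing diagonal sections, commuting with the translations
by the lattice, is bijective. -/
theorem isLatticeBijective_of_triangular {X : (Fin n → ℝ) → (Fin n → ℝ)} (hc : Continuous X)
    (hl : ∀ x m, X (x + lat m) = X x + lat m) (ht : ∀ j x y, (∀ i ≤ j, x i = y i) → X x j = X y j)
    (hm : ∀ x j, StrictMono fun t => X (update x j t) j) : IsLatticeBijective X where
  map_add x m := ⟨m, hl x m⟩
  injective x y m h := by
    refine ⟨m, ?_⟩
    rw [← hl] at h
    set z := y + lat m
    have key : ∀ (k : ℕ) (j : Fin n), (j : ℕ) < k → x j = z j := by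
      intro k
      induction k with
      | zero => exact fun j hj => absurd hj (Nat.not_lt_zero _)
      | succ k ih =>
        intro j hj
        refine (hm x j).injective ?_
        have h1 : X (update x j (z j)) j = X z j := by
          refine ht j _ _ fun i hi => ?_
          rcases eq_or_lt_of_le hi with rfl | hlt
          · rw [update_self]
          · rw [update_of_ne hlt.ne]
            exact ih i (by have : (i : ℕ) < j := hlt; omega)
        change X (update x j (x j)) j = X (update x j (z j)) j
        rw [update_eq_self, h1, h]
    exact funext fun j => key n j j.2
  surjective y := by
    have key : ∀ k : ℕ, ∃ x : Fin n → ℝ, ∀ j : Fin n, (j : ℕ) < k → X x j = y j := by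
      intro k
      induction k with
      | zero => exact ⟨0, fun j hj => absurd hj (Nat.not_lt_zero _)⟩
      | succ k ih =>
        obtain ⟨x, hx⟩ := ih
        by_cases hk : k < n
        · set j₀ : Fin n := ⟨k, hk⟩
          have hs : Surjective fun t => X (update x j₀ t) j₀ := by
            have hper : ∀ (t : ℝ) (m : ℤ), X (update x j₀ (t + 2 * Real.pi * m)) j₀ =
                X (update x j₀ t) j₀ + 2 * Real.pi * m := by
              intro t m
              have : update x j₀ (t + 2 * Real.pi * m) = update x j₀ t + lat (Pi.single j₀ m) := by
                funext i
                by_cases hi : i = j₀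
                · subst hi; simp [lat]
                · simp [lat, hi]
              rw [this, hl]
              simp [lat]
            refine fun b => mem_range_of_exists_le_of_exists_ge
              ((continuous_apply j₀).comp (hc.comp (continuous_const.update j₀ continuous_id)))
              ?_ ?_
            · obtain ⟨m, hm'⟩ := exists_int_lt ((b - X (update x j₀ 0) j₀) / (2 * Real.pi))
              refine ⟨0 + 2 * Real.pi * m, ?_⟩
              rw [lt_div_iff₀ Real.two_pi_pos] at hm'
              simp only [hper]
              linarith
            · obtain ⟨m, hm'⟩ := exists_int_gt ((b - X (update x j₀ 0) j₀) / (2 * Real.pi))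
              refine ⟨0 + 2 * Real.pi * m, ?_⟩
              rw [div_lt_iff₀ Real.two_pi_pos] at hm'
              simp only [hper]
              linarith
          obtain ⟨t, ht'⟩ := hs (y j₀)
          refine ⟨update x j₀ t, fun j hj => ?_⟩
          rcases eq_or_ne j j₀ with rfl | hne
          · exact ht'
          · have hlt : (j : ℕ) < k := by
              have : (j : ℕ) ≠ k := fun h => hne (Fin.ext h)
              omega
            rw [← hx j hlt]
            refine ht j _ _ fun i hi => update_of_ne ?_ _ _
            rintro rfl
            exact absurd (show k ≤ j from hi) (by omega)
        · exact ⟨x, fun j hj => hx j (by have := j.2; omega)⟩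
    obtain ⟨x, hx⟩ := key n
    exact ⟨x, 0, funext fun j => by rw [lat_zero, add_zero]; exact hx j j.2⟩

end

section
variable {n : ℕ} {δ : ℝ}

/-! ### Real points of holomorphic maps -/

/-- The inclusion `ℝⁿ ⊆ ℂⁿ` as a linear map. -/
def toCL (n : ℕ) : (Fin n → ℝ) →L[ℝ] (Fin n → ℂ) :=
  ContinuousLinearMap.pi fun j => Complex.ofRealCLM.comp (ContinuousLinearMap.proj j)

theorem toCL_apply (x : Fin n → ℝ) : toCL n x = toC x := rfl

theorem hasFDerivAt_toC (x : Fin n → ℝ) : HasFDerivAt toC (toCL n) x := (toCL n).hasFDerivAt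

theorem det_dmat_toCL : (dmat (toCL n)).det = 1 := by
  have : dmat (toCL n) = 1 := by
    ext i j
    simp only [dmat, Matrix.of_apply, toCL_apply, toC, Matrix.one_apply, Pi.single_apply]
    split_ifs <;> simp
  rw [this, Matrix.det_one]

theorem det_dmat_fderiv_comp_toC {F : (Fin n → ℂ) → (Fin n → ℂ)} {x : Fin n → ℝ}
    (hF : DifferentiableAt ℂ F (toC x)) :
    (dmat (fderiv ℝ (fun x => F (toC x)) x)).det = (fderiv ℂ F (toC x)).det := by
  have h : HasFDerivAt (fun x => F (toC x)) _ x :=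
    (hF.hasFDerivAt.restrictScalars ℝ).comp x (hasFDerivAt_toC x)
  rw [h.fderiv, dmat_comp_left, det_dmat_toCL, mul_one]

/-- If a holomorphic map preserves `ℝⁿ`, its complex Jacobian at real points is the Jacobian of
the induced real map. -/
theorem det_fderiv_of_eq_toC {F : (Fin n → ℂ) → (Fin n → ℂ)} {X : (Fin n → ℝ) → (Fin n → ℝ)}
    (h : ∀ x, F (toC x) = toC (X x)) {x : Fin n → ℝ} (hF : DifferentiableAt ℂ F (toC x)) :
    DifferentiableAt ℝ X x ∧ ((fderiv ℝ X x).det : ℂ) = (fderiv ℂ F (toC x)).det := by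
  have hX : DifferentiableAt ℝ X x := by
    have h1 : X = fun x j => (F (toC x) j).re := by
      funext x j; simp [h, toC]
    have h2 : DifferentiableAt ℝ (fun x => F (toC x)) x :=
      ((hF.hasFDerivAt.restrictScalars ℝ).comp x (hasFDerivAt_toC x)).differentiableAt
    rw [h1]
    exact differentiableAt_pi.2 fun j =>
      Complex.reCLM.differentiableAt.comp x (differentiableAt_pi.1 h2 j)
  refine ⟨hX, ?_⟩
  rw [← det_dmat_fderiv_comp_toC hF]
  have h2 : HasFDerivAt (fun x => F (toC x)) ((toCL n).comp (fderiv ℝ X x)) x := by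
    simp only [h]
    exact (hasFDerivAt_toC _).comp x hX.hasFDerivAt
  rw [h2.fderiv, dmat_comp, det_dmat_toCL, one_mul]

theorem hasDerivAt_comp_toC_update {E : Type*} [NormedAddCommGroup E] [NormedSpace ℂ E]
    {f : (Fin n → ℂ) → E} {x : Fin n → ℝ} (hf : DifferentiableAt ℂ f (toC x)) (j : Fin n) :
    HasDerivAt (fun t : ℝ => f (toC (update x j t))) (fderiv ℂ f (toC x) (Pi.single j 1)) (x j) := by
  have h1 : HasFDerivAt f (fderiv ℂ f (toC x)) (toC (update x j (x j))) := by
    rw [update_eq_self]; exact hf.hasFDerivAt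
  have h2 : HasDerivAt (fun t : ℝ => toC (update x j t)) (Pi.single j 1) (x j) := by
    have := (hasFDerivAt_toC (update x j (x j))).comp_hasDerivAt (x j)
      (hasDerivAt_update x j (x j))
    have he : toCL n (Pi.single j 1) = Pi.single j 1 := by
      funext i
      rw [toCL_apply]
      rcases eq_or_ne i j with rfl | hij
      · simp [toC]
      · simp [toC, hij]
    rwa [he] at this
  exact (h1.restrictScalars ℝ).comp_hasDerivAt (x j) h2

theorem fderiv_toC_single_im {f : (Fin n → ℂ) → ℂ} (hr : ∀ x : Fin n → ℝ, (f (toC x)).im = 0)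
    {x : Fin n → ℝ} (hf : DifferentiableAt ℂ f (toC x)) (j : Fin n) :
    (fderiv ℂ f (toC x) (Pi.single j 1)).im = 0 := by
  have h1 := (Complex.imCLM.hasFDerivAt).comp_hasDerivAt (x j) (hasDerivAt_comp_toC_update hf j)
  have h2 : (Complex.imCLM ∘ fun t : ℝ => f (toC (update x j t))) = fun _ => 0 := by
    funext t; exact hr _
  rw [h2] at h1
  exact h1.unique (hasDerivAt_const _ _)

theorem fderiv_toC_add_lat {f : (Fin n → ℂ) → ℂ}
    (hp : ∀ (x : Fin n → ℝ) (m : Fin n → ℤ), f (toC (x + lat m)) = f (toC x))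
    (hδ : 0 < δ) (hf : DifferentiableOn ℂ f (strip n δ)) (x : Fin n → ℝ) (m : Fin n → ℤ)
    (j : Fin n) :
    fderiv ℂ f (toC (x + lat m)) (Pi.single j 1) = fderiv ℂ f (toC x) (Pi.single j 1) := by
  have hd : ∀ x, DifferentiableAt ℂ f (toC x) := fun x =>
    hf.differentiableAt (isOpen_strip.mem_nhds (toC_mem_strip hδ x))
  have h1 := hasDerivAt_comp_toC_update (hd (x + lat m)) j
  have h2 := (hasDerivAt_comp_toC_update (hd x) j)
  have h3 : HasDerivAt (fun t : ℝ => t - lat m j) 1 ((x + lat m) j) :=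
    (hasDerivAt_id _).sub_const _
  have h4 : x j = (x + lat m) j - lat m j := by simp
  rw [h4] at h2
  have h5 := HasDerivAt.scomp (h := fun t : ℝ => t - lat m j) ((x + lat m) j) h2 h3
  rw [one_smul] at h5
  refine h1.unique (h5.congr_of_eventuallyEq (Eventually.of_forall fun t => ?_))
  simp only [comp_apply]
  rw [← hp (update x j (t - lat m j)) m]
  congr 2
  funext i
  rcases eq_or_ne i j with rfl | hij
  · simp
  · simp [hij]

theorem contDiff_slice [NeZero n] {f : (Fin n → ℂ) → ℂ} (hδ : 0 < δ)
    (hf : DifferentiableOn ℂ f (strip n δ)) :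
    ContDiff ℝ ω fun s : ℝ => f (toC (Pi.single 0 s)) := by
  rw [contDiff_omega_iff_analyticOnNhd]
  intro s _
  let U : Set ℂ := {z | |z.im| < δ}
  have hU : IsOpen U := isOpen_lt (by fun_prop) continuous_const
  have h1 : DifferentiableOn ℂ (fun z : ℂ => f (Pi.single 0 z)) U := by
    refine hf.comp (f := fun z : ℂ => (Pi.single 0 z : Fin n → ℂ))
      (ContinuousLinearMap.single ℂ (fun _ : Fin n => ℂ) 0).differentiable.differentiableOn
      fun z hz j => ?_
    by_cases hj : j = 0
    · subst hj; simpa [U] using hz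
    · simpa [hj] using hδ
  have h2 : AnalyticAt ℂ (fun z : ℂ => f (Pi.single 0 z)) (s : ℂ) :=
    h1.analyticOnNhd hU _ (by simpa [U] using hδ)
  have h3 : AnalyticAt ℝ (fun s : ℝ => (s : ℂ)) s := Complex.ofRealCLM.analyticAt s
  have h4 := (h2.restrictScalars (𝕜 := ℝ)).comp h3
  have h5 : (fun s : ℝ => f (toC (Pi.single 0 s))) =
      (fun z : ℂ => f (Pi.single 0 z)) ∘ fun s : ℝ => (s : ℂ) := by
    funext s
    simp only [comp_apply]
    congr 1
    funext j
    by_cases hj : j = 0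
    · subst hj; simp [toC]
    · simp [toC, hj]
  rw [h5]
  exact h4

/-! ### Lifts of circle diffeomorphisms -/

/-- The inverse of an analytic diffeomorphism of the circle, read on the line. -/
theorem exists_contDiff_inverse {T : ℝ → ℝ} (hT : ContDiff ℝ ω T) (hpos : ∀ s, 0 < deriv T s)
    (hper : ∀ s, T (s + 2 * Real.pi) = T s + 2 * Real.pi) :
    ∃ K : ℝ → ℝ, ContDiff ℝ ω K ∧ StrictMono K ∧ (∀ s, K (T s) = s) ∧ (∀ t, T (K t) = t) ∧
      ∀ t, K (t + 2 * Real.pi) = K t + 2 * Real.pi := by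
  have hm : StrictMono T := strictMono_of_deriv_pos hpos
  have hperz : ∀ (m : ℤ), T (0 + m * (2 * Real.pi)) = T 0 + m * (2 * Real.pi) := by
    have hp : Periodic (fun s => T s - s) (2 * Real.pi) := fun s => by
      simp only [hper]; ring
    intro m
    have := hp.int_mul m 0
    linarith
  have hs : Surjective T := fun b => by
    refine mem_range_of_exists_le_of_exists_ge hT.continuous ?_ ?_
    · obtain ⟨m, hm'⟩ := exists_int_lt ((b - T 0) / (2 * Real.pi))
      rw [lt_div_iff₀ Real.two_pi_pos] at hm'
      exact ⟨0 + m * (2 * Real.pi), by rw [hperz]; linarith⟩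
    · obtain ⟨m, hm'⟩ := exists_int_gt ((b - T 0) / (2 * Real.pi))
      rw [div_lt_iff₀ Real.two_pi_pos] at hm'
      exact ⟨0 + m * (2 * Real.pi), by rw [hperz]; linarith⟩
  let e : ℝ ≃o ℝ := hm.orderIsoOfSurjective T hs
  have hd : ∀ x, HasDerivAt e.toHomeomorph (deriv T x) x := fun x =>
    (hT.differentiable (by simp) x).hasDerivAt
  refine ⟨e.symm, e.toHomeomorph.contDiff_symm_deriv (fun x => (hpos x).ne') hd hT,
    e.symm.strictMono, e.symm_apply_apply, e.apply_symm_apply, fun t => hm.injective ?_⟩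
  have h1 : ∀ t, T (e.symm t) = t := e.apply_symm_apply
  rw [h1, hper, h1]

/-- A translation of the parameter makes the mean of `K t - t` vanish. -/
theorem exists_shift_mean_zero {K : ℝ → ℝ} (hK : Continuous K)
    (hper : ∀ t, K (t + 2 * Real.pi) = K t + 2 * Real.pi) :
    ∃ c : ℝ, ∫ t in (0 : ℝ)..(2 * Real.pi), (K (t - c) - t) = 0 := by
  have hp : Periodic (fun s => K s - s) (2 * Real.pi) := fun s => by
    simp only [hper]; ring
  refine ⟨(∫ s in (0 : ℝ)..(2 * Real.pi), (K s - s)) / (2 * Real.pi), ?_⟩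
  set c := (∫ s in (0 : ℝ)..(2 * Real.pi), (K s - s)) / (2 * Real.pi) with hc
  have h1 : ∀ t, K (t - c) - t = (K (t - c) - (t - c)) - c := fun t => by ring
  have hci : Continuous fun s => K s - s := by fun_prop
  have h2 : ∫ t in (0 : ℝ)..(2 * Real.pi), (K (t - c) - (t - c)) =
      ∫ s in (0 : ℝ)..(2 * Real.pi), (K s - s) := by
    rw [intervalIntegral.integral_comp_sub_right (fun s => K s - s) c]
    have := hp.intervalIntegral_add_eq (0 - c) 0
    rwa [zero_add, show 0 - c + 2 * Real.pi = 2 * Real.pi - c by ring] at this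
  simp only [h1]
  rw [intervalIntegral.integral_sub (Continuous.intervalIntegrable (by fun_prop) _ _)
    (Continuous.intervalIntegrable (by fun_prop) _ _), h2, intervalIntegral.integral_const]
  rw [hc]
  have := Real.pi_pos
  simp only [smul_eq_mul]
  field_simp
  ring

/-! ### The holomorphic model map -/

theorem det_comp_complex (A B : (Fin n → ℂ) →L[ℂ] (Fin n → ℂ)) :
    (A.comp B).det = A.det * B.det :=
  LinearMap.det_comp _ _

theorem det_of_isLowerTriangular_clm {A : (Fin n → ℂ) →L[ℂ] (Fin n → ℂ)}
    (h : ∀ i j, i < j → A (Pi.single j 1) i = 0) : A.det = ∏ j, A (Pi.single j 1) j := by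
  rw [ContinuousLinearMap.det, ← LinearMap.det_toMatrix', Matrix.det_of_isLowerTriangular]
  · simp [LinearMap.toMatrix'_apply]
  · intro i j hij
    simpa [LinearMap.toMatrix'_apply] using h i j hij

theorem det_of_isUpperTriangular_clm {A : (Fin n → ℂ) →L[ℂ] (Fin n → ℂ)}
    (h : ∀ i j, j < i → A (Pi.single j 1) i = 0) : A.det = ∏ j, A (Pi.single j 1) j := by
  rw [ContinuousLinearMap.det, ← LinearMap.det_toMatrix', Matrix.det_of_isUpperTriangular]
  · simp [LinearMap.toMatrix'_apply]
  · intro i j hij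
    simpa [LinearMap.toMatrix'_apply] using h i j hij

theorem fderiv_single_eq_zero_of_triangular {Y : (Fin n → ℂ) → (Fin n → ℂ)}
    (ht : ∀ j x y, (∀ i ≤ j, x i = y i) → Y x j = Y y j) {x : Fin n → ℂ}
    (hY : DifferentiableAt ℂ Y x) {i j : Fin n} (hij : i < j) :
    fderiv ℂ Y x (Pi.single j 1) i = 0 := by
  refine fderiv_single_eq hY ?_
  have : (fun t => Y (update x j t) i) = fun _ => Y x i := by
    funext t
    refine ht i _ _ fun k hk => update_of_ne ?_ _ _
    exact (hk.trans_lt hij).ne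
  rw [this]
  exact hasDerivAt_const _ _

section
variable [NeZero n]

/-- The normal form of a torus in the coordinates `Y` of the universal covering: the curve is
given by `Γ`. -/
def wrap (Γ : (Fin n → ℂ) → ℂ) (Y : (Fin n → ℂ) → (Fin n → ℂ)) (x : Fin n → ℂ) : Fin n → ℂ :=
  update (ccover (Y x)) 0
    (Complex.exp (-(Complex.I * ∑ j ∈ Finset.univ.erase 0, Y x j)) * Γ x)

theorem differentiableAt_wrap {Γ : (Fin n → ℂ) → ℂ} {Y : (Fin n → ℂ) → (Fin n → ℂ)} {x : Fin n → ℂ}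
    (hΓ : DifferentiableAt ℂ Γ x) (hY : DifferentiableAt ℂ Y x) :
    DifferentiableAt ℂ (wrap Γ Y) x := by
  have hYj := differentiableAt_pi.1 hY
  rw [differentiableAt_pi]
  intro j
  by_cases hj : j = 0
  · subst hj
    simp only [wrap, update_self]
    fun_prop
  · simp only [wrap, update_of_ne hj, ccover]
    fun_prop

/-- If `Y` is triangular and `Γ` depends on the first coordinate only, the Jacobian of `wrap Γ Y`
involves the diagonal derivatives of `Y` only; the factors `e^{i Y_j}` cancel. -/
theorem det_fderiv_wrap {Γ : (Fin n → ℂ) → ℂ} {Y : (Fin n → ℂ) → (Fin n → ℂ)} {x : Fin n → ℂ}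
    {d : ℂ} (hΓ : DifferentiableAt ℂ Γ x) (hY : DifferentiableAt ℂ Y x)
    (ht : ∀ j x y, (∀ i ≤ j, x i = y i) → Y x j = Y y j) (hΓt : ∀ x y, x 0 = y 0 → Γ x = Γ y)
    (hd : HasDerivAt (fun t => Γ (update x 0 t)) d (x 0)) :
    (fderiv ℂ (wrap Γ Y) x).det = Complex.I ^ (n - 1) * d *
      ∏ j ∈ Finset.univ.erase 0, fderiv ℂ Y x (Pi.single j 1) j := by
  -- factor through `x ↦ (Γ x, Y_2 x, …, Y_n x)`, whose Jacobian matrix is lower triangular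
  let V : (Fin n → ℂ) → (Fin n → ℂ) := fun x => update (Y x) 0 (Γ x)
  let S : (Fin n → ℂ) → (Fin n → ℂ) := fun y => update (ccover y) 0
    (Complex.exp (-(Complex.I * ∑ j ∈ Finset.univ.erase 0, y j)) * y 0)
  have hV : DifferentiableAt ℂ V x := by
    rw [differentiableAt_pi]
    intro j
    by_cases hj : j = 0
    · subst hj; simpa [V] using hΓ
    · simpa [V, hj] using differentiableAt_pi.1 hY j
  have hS : Differentiable ℂ S := by
    rw [differentiable_pi]
    intro j
    by_cases hj : j = 0
    · subst hj
      simp only [S, update_self]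
      fun_prop
    · simp only [S, update_of_ne hj, ccover]
      fun_prop
  have hcomp : wrap Γ Y = S ∘ V := by
    funext x j
    by_cases hj : j = 0
    · subst hj
      simp only [wrap, S, V, comp_apply, update_self]
      congr 4
      exact Finset.sum_congr rfl fun j hj => (update_of_ne (Finset.ne_of_mem_erase hj) _ _).symm
    · simp [wrap, S, V, hj, ccover]
  have hVt : ∀ j x y, (∀ i ≤ j, x i = y i) → V x j = V y j := by
    intro j x y h
    by_cases hj : j = 0
    · subst hj
      simpa [V] using hΓt x y (h 0 le_rfl)
    · simpa [V, hj] using ht j x y h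
  have hVdet : (fderiv ℂ V x).det =
      d * ∏ j ∈ Finset.univ.erase 0, fderiv ℂ Y x (Pi.single j 1) j := by
    rw [det_of_isLowerTriangular_clm fun i j hij => fderiv_single_eq_zero_of_triangular hVt hV hij,
      ← Finset.mul_prod_erase _ _ (Finset.mem_univ 0)]
    congr 1
    · refine fderiv_single_eq hV ?_
      simpa only [V, update_self] using hd
    · refine Finset.prod_congr rfl fun j hj => fderiv_single_eq hV ?_
      simp only [V, update_of_ne (Finset.ne_of_mem_erase hj)]
      have h1 : HasFDerivAt Y (fderiv ℂ Y x) (update x j (x j)) := by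
        rw [update_eq_self]; exact hY.hasFDerivAt
      exact (hasDerivAt_pi.1 (h1.comp_hasDerivAt (x j) (hasDerivAt_update x j (x j)))) j
  have hSdet : ∀ y, (fderiv ℂ S y).det = Complex.I ^ (n - 1) := by
    intro y
    rw [det_of_isUpperTriangular_clm, ← Finset.mul_prod_erase _ _ (Finset.mem_univ 0)]
    · have h0 : fderiv ℂ S y (Pi.single 0 1) 0 =
          Complex.exp (-(Complex.I * ∑ j ∈ Finset.univ.erase 0, y j)) := by
        refine fderiv_single_eq (hS y) ?_
        simp only [S, update_self]
        have h1 : ∀ t, ∑ j ∈ Finset.univ.erase 0, update y 0 t j =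
            ∑ j ∈ Finset.univ.erase 0, y j := fun t =>
          Finset.sum_congr rfl fun j hj => update_of_ne (Finset.ne_of_mem_erase hj) _ _
        simp only [h1]
        simpa using (hasDerivAt_id (y 0)).const_mul
          (Complex.exp (-(Complex.I * ∑ j ∈ Finset.univ.erase 0, y j)))
      have hj : ∀ j ∈ Finset.univ.erase (0 : Fin n), fderiv ℂ S y (Pi.single j 1) j =
          Complex.I * Complex.exp (Complex.I * y j) := fun j hj => by
        refine fderiv_single_eq (hS y) ?_
        simp only [S, update_of_ne (Finset.ne_of_mem_erase hj), ccover, update_self]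
        have := ((hasDerivAt_id (y j)).const_mul Complex.I).cexp
        simpa [mul_comm] using this
      rw [h0, Finset.prod_congr rfl hj, Finset.prod_mul_distrib, Finset.prod_const,
        Finset.card_erase_of_mem (Finset.mem_univ 0), Finset.card_univ, Fintype.card_fin,
        ← Complex.exp_sum, ← Finset.mul_sum, mul_left_comm, ← Complex.exp_add, neg_add_cancel,
        Complex.exp_zero, mul_one]
    · intro i j hij
      have hi : i ≠ 0 := fun h => by subst h; exact absurd hij (by simp)
      refine fderiv_single_eq (hS y) ?_
      simp only [S, update_of_ne hi, ccover, update_of_ne hij.ne']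
      exact hasDerivAt_const _ _
  rw [hcomp, fderiv_comp x (hS _) hV, det_comp_complex, hSdet, hVdet, mul_assoc]

end

end

section
variable {n : ℕ} {δ : ℝ}

/-! ### Normal coordinates -/

theorem IsPolarJacobian.arg_im {c : ℝ} {F : (Fin n → ℂ) → (Fin n → ℂ)} {a p : (Fin n → ℂ) → ℂ}
    (h : IsPolarJacobian δ c F a p) (x : Fin n → ℝ) : (a (toC x)).im = 0 := by
  have := h.arg_star (toC x)
  rw [star_toC] at this
  exact Complex.conj_eq_iff_im.1 this.symm

variable [NeZero n]

theorem straighten_add_lat {a : (Fin n → ℂ) → ℂ}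
    (hp : ∀ (x : Fin n → ℝ) (m : Fin n → ℤ), a (toC (x + lat m)) = a (toC x))
    (x : Fin n → ℝ) (m : Fin n → ℤ) : straighten a (toC (x + lat m)) =
      straighten a (toC x) + toC (shear ℝ (lat m)) := by
  funext j
  by_cases hj : j = 0
  · subst hj
    rw [Pi.add_apply, straighten_zero, straighten_zero, hp]
    simp only [toC, Pi.add_apply, shear_apply, update_self]
    push_cast
    rw [Finset.sum_add_distrib]
    ring
  · rw [Pi.add_apply, straighten_ne _ _ hj, straighten_ne _ _ hj]
    simp [toC, shear_apply, hj]

/-- The modulus of the Jacobian, expressed in the coordinates that straighten its argument, is a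
density. -/
theorem isDensity_straightened {δ₂ c : ℝ} {F : (Fin n → ℂ) → (Fin n → ℂ)} {a p : (Fin n → ℂ) → ℂ}
    {Z : (Fin n → ℂ) → (Fin n → ℂ)} (hδ : 0 < δ) (hδ₂ : 0 < δ₂) (h : IsPolarJacobian δ c F a p)
    (hZ : DifferentiableOn ℂ Z (strip n δ₂))
    (hBZ : ∀ y ∈ strip n δ₂, Z y ∈ strip n (δ / 2) ∧ straighten a (Z y) = y)
    (hinj : InjOn (straighten a) (strip n (δ / 2)))
    (hda : ∀ w ∈ strip n (δ / 2), ‖fderiv ℂ a w‖ ≤ 1 / 4) :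
    IsDensity δ₂ fun y => p (Z y) * (1 + fderiv ℂ a (Z y) (Pi.single 0 1))⁻¹ := by
  have hsub : strip n (δ / 2) ⊆ strip n δ := fun w hw j => (hw j).trans (by linarith)
  have hda' : ∀ w ∈ strip n (δ / 2), ‖fderiv ℂ a w (Pi.single 0 1)‖ ≤ 1 / 4 := fun w hw => by
    refine ((fderiv ℂ a w).le_opNorm _).trans ?_
    rw [Pi.norm_single, norm_one, mul_one]
    exact hda w hw
  have hne : ∀ w ∈ strip n (δ / 2), 3 / 4 ≤ ‖1 + fderiv ℂ a w (Pi.single 0 1)‖ := fun w hw => by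
    have h1 := norm_sub_norm_le (1 : ℂ) (-fderiv ℂ a w (Pi.single 0 1))
    rw [sub_neg_eq_add, norm_neg, norm_one] at h1
    linarith [hda' w hw]
  have hne0 : ∀ w ∈ strip n (δ / 2), 1 + fderiv ℂ a w (Pi.single 0 1) ≠ 0 := fun w hw h0 => by
    have := hne w hw
    rw [h0, norm_zero] at this
    linarith
  have had : ∀ x : Fin n → ℝ, DifferentiableAt ℂ a (toC x) := fun x =>
    h.differentiableOn_arg.differentiableAt (isOpen_strip.mem_nhds (toC_mem_strip hδ x))
  have hmaps : MapsTo Z (strip n δ₂) (strip n δ) := fun y hy => hsub (hBZ y hy).1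
  have hZreal : ∀ y : Fin n → ℝ, ∃ x : Fin n → ℝ, Z (toC y) = toC x := fun y => by
    obtain ⟨h1, h2⟩ := hBZ _ (toC_mem_strip hδ₂ y)
    refine ⟨_, eq_toC_of_star_eq (hinj (star_mem_strip h1) h1 ?_)⟩
    rw [star_straighten h.arg_star, h2, star_toC]
  refine ⟨?_, ?_, ?_, ?_⟩
  · refine (h.differentiableOn_mod.comp hZ hmaps).mul (DifferentiableOn.fun_inv ?_
      fun y hy => hne0 _ (hBZ y hy).1)
    exact ((differentiableOn_fderiv_apply isOpen_strip h.differentiableOn_arg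
      (Pi.single 0 1)).comp hZ hmaps).const_add 1
  · intro y hy
    obtain ⟨hw, -⟩ := hBZ y hy
    set w := Z y
    set D := 1 + fderiv ℂ a w (Pi.single 0 1) with hD
    have h1 : ‖p w * D⁻¹ - 1‖ < 1 := by
      have : p w * D⁻¹ - 1 = (p w - 1 - fderiv ℂ a w (Pi.single 0 1)) * D⁻¹ := by
        have := hne0 w hw
        rw [← hD] at this
        field_simp
        rw [hD]; ring
      rw [this, norm_mul, norm_inv]
      have h2 := norm_sub_le (p w - 1) (fderiv ℂ a w (Pi.single 0 1))
      have h3 := h.mod_near_one w (hsub hw)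
      have h4 := hda' w hw
      have h5 := hne w hw
      rw [mul_inv_lt_iff₀ (by linarith)]
      linarith
    have h2 := (Complex.abs_re_le_norm _).trans_lt h1
    have := (abs_lt.1 h2).1
    simp only [Complex.sub_re, Complex.one_re] at this
    linarith
  · intro y
    obtain ⟨x, hx⟩ := hZreal y
    have h1 : p (toC x) = ((p (toC x)).re : ℂ) := Complex.ext (by simp) (by simp [h.mod_im])
    have h2 : fderiv ℂ a (toC x) (Pi.single 0 1) = ((fderiv ℂ a (toC x) (Pi.single 0 1)).re : ℂ) :=
      Complex.ext (by simp) (by simp [fderiv_toC_single_im h.arg_im (had x)])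
    simp only [hx]
    rw [h1, h2, ← Complex.ofReal_one, ← Complex.ofReal_add, ← Complex.ofReal_inv,
      ← Complex.ofReal_mul, Complex.ofReal_im]
  · intro y m
    obtain ⟨x, hx⟩ := hZreal y
    have hm := shear_symm_lat (n := n) m
    set m' := update m 0 (m 0 - ∑ j ∈ Finset.univ.erase 0, m j)
    have hx' : Z (toC (y + lat m)) = toC (x + lat m') := by
      obtain ⟨h1, h2⟩ := hBZ _ (toC_mem_strip hδ₂ (y + lat m))
      refine hinj h1 (toC_mem_strip (half_pos hδ) _) ?_
      rw [h2, straighten_add_lat h.arg_periodic, ← hx, (hBZ _ (toC_mem_strip hδ₂ y)).2, ← hm,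
        ContinuousLinearEquiv.apply_symm_apply, toC_add]
    simp only [hx, hx']
    rw [h.mod_periodic, fderiv_toC_add_lat h.arg_periodic hδ h.differentiableOn_arg]

/-- The real map induced by straightening is bijective modulo the lattice. -/
theorem isLatticeBijective_straighten {a : (Fin n → ℂ) → ℂ} {δ₂ : ℝ}
    {Z : (Fin n → ℂ) → (Fin n → ℂ)} {B : (Fin n → ℝ) → (Fin n → ℝ)} (hδ : 0 < δ) (hδ₂ : 0 < δ₂)
    (hp : ∀ (x : Fin n → ℝ) (m : Fin n → ℤ), a (toC (x + lat m)) = a (toC x))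
    (hs : ∀ w, a (star w) = star (a w))
    (hBZ : ∀ y ∈ strip n δ₂, Z y ∈ strip n (δ / 2) ∧ straighten a (Z y) = y)
    (hinj : InjOn (straighten a) (strip n (δ / 2)))
    (hB : ∀ x, straighten a (toC x) = toC (B x)) : IsLatticeBijective B := by
  have hadd : ∀ x m, B (x + lat m) = B x + shear ℝ (lat m) := fun x m => by
    refine toC_injective ?_
    rw [← hB, straighten_add_lat hp, hB, toC_add]
  refine ⟨fun x m => ⟨_, by rw [hadd, shear_lat]⟩, fun x y m h => ?_, fun y => ?_⟩
  · have hm := shear_symm_lat (n := n) m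
    refine ⟨update m 0 (m 0 - ∑ j ∈ Finset.univ.erase 0, m j), toC_injective ?_⟩
    refine hinj (toC_mem_strip (half_pos hδ) _) (toC_mem_strip (half_pos hδ) _) ?_
    rw [hB, hB, h, hadd, ← hm, ContinuousLinearEquiv.apply_symm_apply]
  · obtain ⟨h1, h2⟩ := hBZ _ (toC_mem_strip hδ₂ y)
    have h3 : Z (toC y) = toC fun j => (Z (toC y) j).re := by
      refine eq_toC_of_star_eq (hinj (star_mem_strip h1) h1 ?_)
      rw [star_straighten hs, h2, star_toC]
    refine ⟨fun j => (Z (toC y) j).re, 0, toC_injective ?_⟩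
    rw [← hB, ← h3, h2, lat_zero, add_zero]

theorem det_shear_symm : ((shear ℂ : (Fin n → ℂ) ≃L[ℂ] (Fin n → ℂ)).symm :
    (Fin n → ℂ) →L[ℂ] (Fin n → ℂ)).det = 1 := by
  rw [det_eq_of_forall_ne_zero]
  · simp only [ContinuousLinearEquiv.coe_coe, shear_symm_apply, update_self, Pi.single_eq_same]
    rw [Finset.sum_eq_zero fun j hj => Pi.single_eq_of_ne (Finset.ne_of_mem_erase hj) _, sub_zero]
  · intro v j hj
    simp [shear_symm_apply, hj]

/-- Coordinates `X` of the universal covering in which the coefficient of `F^*Ω` is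
`Iⁿ⁻¹ ρ e^{iK(X_1 + ⋯ + X_n)}`, and a holomorphic map `G` with the same Jacobian as `F` which is
in normal form in the coordinates `X`. -/
theorem exists_normal_coordinates (n : ℕ) [NeZero n] : ∃ c > 0,
    ∀ (δ : ℝ) (F : (Fin n → ℂ) → (Fin n → ℂ)) (a p : (Fin n → ℂ) → ℂ), 0 < δ →
    IsPolarJacobian δ c F a p →
    ∃ (δ₁ ρ : ℝ) (K : ℝ → ℝ) (γ : ℝ → ℂ) (X : (Fin n → ℝ) → (Fin n → ℝ))
      (G : (Fin n → ℂ) → (Fin n → ℂ)), 0 < δ₁ ∧ δ₁ ≤ δ ∧ 0 < ρ ∧ ContDiff ℝ ω K ∧ StrictMono K ∧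
      (∀ t, K (t + 2 * Real.pi) = K t + 2 * Real.pi) ∧
      (∫ t in (0 : ℝ)..(2 * Real.pi), (K t - t)) = 0 ∧ ContDiff ℝ ω γ ∧
      (∀ t : ℝ, HasDerivAt γ (ρ * Complex.exp (Complex.I * K t)) t) ∧
      IsLatticeBijective X ∧
      (∀ θ, DifferentiableAt ℝ X θ ∧ 0 < (fderiv ℝ X θ).det ∧ (fderiv ℂ F (toC θ)).det =
        Complex.I ^ (n - 1) * (ρ * Complex.exp (Complex.I * K (∑ j, X θ j))) *
          (fderiv ℝ X θ).det) ∧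
      DifferentiableOn ℂ G (strip n δ₁) ∧
      (∀ w ∈ strip n δ₁, (fderiv ℂ G w).det = (fderiv ℂ F w).det) ∧
      ∀ θ, G (toC θ) = update (cover (X θ)) 0 (Complex.exp (-(Complex.I *
        ((∑ j ∈ Finset.univ.erase 0, X θ j : ℝ) : ℂ))) * γ (∑ j, X θ j)) := by
  obtain ⟨c, hc, hstr⟩ := exists_straighten_inverse n
  refine ⟨c, hc, fun δ F a p hδ h => ?_⟩
  obtain ⟨δ₁, δ₂, Z, hδ₁, hδ₂, hδ₁δ, hZ, hBm, hBZ, hinj, hda⟩ :=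
    hstr δ a hδ h.differentiableOn_arg h.arg_star h.norm_arg_le
  have hsub1 : strip n δ₁ ⊆ strip n (δ / 2) := fun w hw j => (hw j).trans_le hδ₁δ
  have hsub : strip n (δ / 2) ⊆ strip n δ := fun w hw j => (hw j).trans (by linarith)
  have had : ∀ w ∈ strip n δ, DifferentiableAt ℂ a w := fun w hw =>
    h.differentiableOn_arg.differentiableAt (isOpen_strip.mem_nhds hw)
  obtain ⟨ρ, Y, hρ, hYd, hYim, hYlat, hYt, hYpos, hYq⟩ :=
    exists_triangular_rearrangement hδ₂ (isDensity_straightened hδ hδ₂ h hZ hBZ hinj hda)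
  have hYat : ∀ y ∈ strip n δ₂, DifferentiableAt ℂ Y y := fun y hy =>
    hYd.differentiableAt (isOpen_strip.mem_nhds hy)
  have hBd : ∀ w ∈ strip n δ₁, DifferentiableAt ℂ (straighten a) w := fun w hw =>
    (hasFDerivAt_straighten (had w (hsub (hsub1 hw)))).differentiableAt
  -- the coordinates `Y ∘ straighten a` have Jacobian `p / ρ`
  have hmod : ∀ w ∈ strip n δ₁, (ρ : ℂ) *
      (∏ j, fderiv ℂ Y (straighten a w) (Pi.single j 1) j) *
        (fderiv ℂ (straighten a) w).det = p w := fun w hw => by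
    have hw' := hsub1 hw
    have hne : 1 + fderiv ℂ a w (Pi.single 0 1) ≠ 0 := fun h0 => by
      have h1 : ‖fderiv ℂ a w (Pi.single 0 1)‖ ≤ 1 / 4 := by
        refine ((fderiv ℂ a w).le_opNorm _).trans ?_
        rw [Pi.norm_single, norm_one, mul_one]
        exact hda w hw'
      rw [show fderiv ℂ a w (Pi.single 0 1) = -1 by linear_combination h0, norm_neg,
        norm_one] at h1
      linarith
    have hZB : Z (straighten a w) = w :=
      hinj (hBZ _ (hBm hw)).1 hw' (hBZ _ (hBm hw)).2
    rw [hYq _ (hBm hw), hZB, det_fderiv_straighten (had w (hsub hw')), mul_assoc,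
      inv_mul_cancel₀ hne, mul_one]
  have hYdet : ∀ y ∈ strip n δ₂, (fderiv ℂ Y y).det = ∏ j, fderiv ℂ Y y (Pi.single j 1) j :=
    fun y hy => det_of_isLowerTriangular_clm fun i j hij =>
      fderiv_single_eq_zero_of_triangular hYt (hYat y hy) hij
  have hFdet : ∀ w ∈ strip n δ₁, (fderiv ℂ F w).det =
      Complex.I ^ (n - 1) * Complex.exp (Complex.I * straighten a w 0) * p w := fun w hw => by
    have h1 : Complex.I ^ n = Complex.I ^ (n - 1) * Complex.exp (Complex.I * (Real.pi / 2)) := by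
      rw [mul_comm Complex.I, Complex.exp_pi_div_two_mul_I, ← pow_succ,
        Nat.sub_add_cancel (Nat.pos_of_ne_zero (NeZero.ne n))]
    rw [h.det_eq w (hsub (hsub1 hw)), h1, straighten_zero, mul_add, mul_add, Complex.exp_add,
      Complex.exp_add]
    ring
  -- the first coordinate, as a function on the circle, and its inverse
  set T : ℝ → ℝ := fun s => (Y (toC (Pi.single 0 s)) 0).re with hTdef
  have hYT : ∀ x : Fin n → ℝ, Y (toC x) 0 = T (x 0) := fun x => by
    have : Y (toC x) 0 = Y (toC (Pi.single 0 (x 0))) 0 := by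
      refine hYt 0 _ _ fun i hi => ?_
      obtain rfl : i = 0 := le_antisymm hi (Fin.zero_le i)
      simp [toC]
    rw [this]
    exact Complex.ext (by simp [hTdef]) (by simp [hYim])
  have hTω : ContDiff ℝ ω T := Complex.reCLM.contDiff.comp
    (contDiff_slice hδ₂ (differentiableOn_pi.1 hYd 0))
  have hTd : ∀ s, HasDerivAt T (fderiv ℂ Y (toC (Pi.single 0 s)) (Pi.single 0 1) 0).re s := fun s => by
    have h1 := hasDerivAt_comp_toC_update (hYat _ (toC_mem_strip hδ₂ (Pi.single 0 s))) 0
    have h2 := (hasDerivAt_pi.1 h1) 0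
    rw [Pi.single_eq_same] at h2
    have h3 := Complex.reCLM.hasFDerivAt.comp_hasDerivAt s h2
    refine h3.congr_of_eventuallyEq (Eventually.of_forall fun t => ?_)
    simp only [comp_apply, hYT, update_self, Complex.reCLM_apply, Complex.ofReal_re]
  have hTper : ∀ s, T (s + 2 * Real.pi) = T s + 2 * Real.pi := fun s => by
    have h1 := congrFun (hYlat (Pi.single 0 s) (Pi.single 0 1)) 0
    rw [Pi.add_apply, hYT, hYT] at h1
    simp only [Pi.add_apply, Pi.single_eq_same, lat, toC] at h1
    have h2 : ((T (s + 2 * Real.pi * (1 : ℤ)) : ℝ) : ℂ) = ((T s + 2 * Real.pi * (1 : ℤ) : ℝ) : ℂ) := by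
      rw [h1]; push_cast; ring
    have h3 := Complex.ofReal_injective h2
    simpa using h3
  obtain ⟨K₀, hK₀ω, hK₀m, hK₀T, hTK₀, hK₀per⟩ := exists_contDiff_inverse hTω
    (fun s => by rw [(hTd s).deriv]; exact (hYpos _ 0).1) hTper
  obtain ⟨c₀, hc₀⟩ := exists_shift_mean_zero hK₀ω.continuous hK₀per
  set K : ℝ → ℝ := fun t => K₀ (t - c₀) with hKdef
  have hKω : ContDiff ℝ ω K := hK₀ω.comp (contDiff_id.sub contDiff_const)
  -- the tangent of the curve parametrized by the argument, `(γ ∘ T)' = ρ e^{is} T'(s)`,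
  -- extends holomorphically
  set u : (Fin n → ℂ) → ℂ := fun x =>
    Complex.exp (Complex.I * x 0) *
      (ρ * fderiv ℂ Y (Pi.single 0 (x 0)) (Pi.single 0 1) 0) with hudef
  have hud : DifferentiableOn ℂ u (strip n δ₂) := by
    refine DifferentiableOn.mul (by fun_prop) (DifferentiableOn.const_mul ?_ _)
    refine (differentiableOn_pi.1 (differentiableOn_fderiv_apply isOpen_strip hYd
      (Pi.single 0 1)) 0).comp (f := fun x : Fin n → ℂ => (Pi.single 0 (x 0) : Fin n → ℂ))
      ((ContinuousLinearMap.single ℂ (fun _ : Fin n => ℂ) 0).differentiable.comp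
        (differentiable_apply 0)).differentiableOn fun x hx j => ?_
    by_cases hj : j = 0
    · subst hj; simpa using hx 0
    · simpa [hj] using hδ₂
  have hu : ∀ w ∈ strip n δ₂,
      u w = Complex.exp (Complex.I * w 0) * (ρ * fderiv ℂ Y w (Pi.single 0 1) 0) := fun w hw => by
    have h1 : (Pi.single 0 (w 0) : Fin n → ℂ) ∈ strip n δ₂ := fun j => by
      by_cases hj : j = 0
      · subst hj; simpa using hw 0
      · simpa [hj] using hδ₂
    simp only [hudef]
    congr 2
    refine fderiv_single_eq (hYat _ h1) ?_
    have h2 : HasFDerivAt Y (fderiv ℂ Y w) (update w 0 (w 0)) := by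
      rw [update_eq_self]; exact (hYat w hw).hasFDerivAt
    have h3 := (hasDerivAt_pi.1 (h2.comp_hasDerivAt (w 0) (hasDerivAt_update w 0 (w 0)))) 0
    rw [Pi.single_eq_same]
    refine h3.congr_of_eventuallyEq (Eventually.of_forall fun t => hYt 0 _ _ fun i hi => ?_)
    obtain rfl : i = 0 := le_antisymm hi (Fin.zero_le i)
    simp
  have hut : ∀ x y : Fin n → ℂ, x 0 = y 0 → slicePrim 0 u x = slicePrim 0 u y := fun x y hxy => by
    refine slicePrim_congr (fun x y h => ?_) fun i hi => ?_
    · simp only [hudef, h 0 (by simp)]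
    · obtain rfl : i = 0 := Fin.ext (by simpa using hi)
      exact hxy
  set Γ : (Fin n → ℂ) → ℂ := slicePrim 0 u with hΓdef
  have hΓd : DifferentiableOn ℂ Γ (strip n δ₂) := differentiableOn_slicePrim hud 0
  set γ : ℝ → ℂ := fun t => Γ (toC (Pi.single 0 (K t))) with hγdef
  have hΓγ : ∀ x : Fin n → ℝ, Γ (toC x) = γ (T (x 0) + c₀) := fun x => by
    refine hut _ _ ?_
    simp [toC, hKdef, hK₀T]
  have hγω : ContDiff ℝ ω γ := (contDiff_slice hδ₂ hΓd).comp hKω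
  have hγd : ∀ t : ℝ, HasDerivAt γ (ρ * Complex.exp (Complex.I * K t)) t := fun t => by
    set y : Fin n → ℝ := Pi.single 0 (K t) with hy
    have hy0 : toC y 0 = (K t : ℂ) := by simp [hy, toC]
    have h1 := hasDerivAt_slicePrim hud 0 (toC_mem_strip hδ₂ y)
    rw [hu _ (toC_mem_strip hδ₂ y), hy0] at h1
    have h2 : HasDerivAt K (deriv K t) t := (hKω.differentiable (by simp) t).hasDerivAt
    have h3 := HasDerivAt.scomp (h := K) t h1.comp_ofReal h2
    have h4 := HasDerivAt.comp (h := K) t (hTd (K t)) h2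
    have h5 : (T ∘ K) = fun t => t - c₀ := funext fun t => hTK₀ _
    rw [h5] at h4
    have h6 := h4.unique ((hasDerivAt_id t).sub_const c₀)
    have h7 : fderiv ℂ Y (toC y) (Pi.single 0 1) 0 =
        ((fderiv ℂ Y (toC y) (Pi.single 0 1) 0).re : ℂ) :=
      Complex.ext (by simp) (by simp [(hYpos y 0).2])
    have h8 : deriv K t • (Complex.exp (Complex.I * K t) *
        (ρ * fderiv ℂ Y (toC y) (Pi.single 0 1) 0)) = ρ * Complex.exp (Complex.I * K t) := by
      rw [h7, Complex.real_smul]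
      have h9 := congrArg (fun r : ℝ => (r : ℂ)) h6
      push_cast at h9
      linear_combination (ρ * Complex.exp (Complex.I * K t)) * h9
    rw [h8] at h3
    refine h3.congr_of_eventuallyEq (Eventually.of_forall fun s => ?_)
    simp only [hγdef, comp_apply]
    refine hut _ _ ?_
    simp [toC]
  -- the real coordinates
  set B : (Fin n → ℝ) → (Fin n → ℝ) := fun x j => (straighten a (toC x) j).re with hBdef
  have hB : ∀ x, straighten a (toC x) = toC (B x) := fun x => by
    refine eq_toC_of_star_eq ?_
    rw [← star_straighten h.arg_star, star_toC]
  set Yr : (Fin n → ℝ) → (Fin n → ℝ) := fun x j => (Y (toC x) j).re with hYrdef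
  have hYr : ∀ x, Y (toC x) = toC (Yr x) := fun x => by
    funext j
    exact Complex.ext (by simp [hYrdef, toC]) (by simp [hYim, toC])
  set X : (Fin n → ℝ) → (Fin n → ℝ) := fun θ =>
    (shear ℝ).symm (Yr (B θ) + Pi.single 0 c₀) with hXdef
  have hX0 : ∀ θ, ∑ j, X θ j = T (B θ 0) + c₀ := fun θ => by
    have h1 : shear ℝ (X θ) 0 = Yr (B θ) 0 + c₀ := by
      rw [hXdef]; simp
    rw [shear_apply, update_self] at h1
    rw [h1]
    simp only [hYrdef, hYT, Complex.ofReal_re]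
  have hXne : ∀ θ, ∀ j ≠ 0, X θ j = Yr (B θ) j := fun θ j hj => by
    simp [hXdef, shear_symm_apply, hj]
  have hBlat : IsLatticeBijective B :=
    isLatticeBijective_straighten hδ hδ₂ h.arg_periodic h.arg_star hBZ hinj hB
  have hYrd : ∀ x j, HasDerivAt (fun t : ℝ => Yr (update x j t) j)
      (fderiv ℂ Y (toC x) (Pi.single j 1) j).re (x j) := fun x j =>
    Complex.reCLM.hasFDerivAt.comp_hasDerivAt (x j) ((hasDerivAt_pi.1
      (hasDerivAt_comp_toC_update (hYat _ (toC_mem_strip hδ₂ x)) j)) j)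
  have hYrlat : IsLatticeBijective Yr := by
    refine isLatticeBijective_of_triangular ?_ (fun x m => ?_) (fun j x y hxy => ?_) fun x j => ?_
    · refine continuous_iff_continuousAt.2 fun x => ?_
      exact (det_fderiv_of_eq_toC hYr (hYat _ (toC_mem_strip hδ₂ x))).1.continuousAt
    · refine toC_injective ?_
      rw [← hYr, hYlat, toC_add, hYr]
    · simp only [hYrdef]
      rw [hYt j (toC x) (toC y) fun i hi => by simp only [toC, hxy i hi]]
    · refine strictMono_of_deriv_pos fun t => ?_
      have h1 := hYrd (update x j t) j
      simp only [update_idem, update_self] at h1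
      rw [h1.deriv]
      exact (hYpos _ j).1
  have hXlat : IsLatticeBijective X :=
    isLatticeBijective_shear_symm.comp ((isLatticeBijective_add_const _).comp (hYrlat.comp hBlat))
  set Xc : (Fin n → ℂ) → (Fin n → ℂ) := fun w =>
    (shear ℂ).symm (Y (straighten a w) + Pi.single 0 (c₀ : ℂ)) with hXcdef
  have hXc : ∀ θ, Xc (toC θ) = toC (X θ) := fun θ => by
    simp only [hXcdef, hB, hYr]
    funext j
    by_cases hj : j = 0
    · subst hj
      simp only [hXdef, shear_symm_apply, toC, update_self, Pi.add_apply, Pi.single_eq_same]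
      push_cast
      congr 1
      refine Finset.sum_congr rfl fun j hj => ?_
      rw [Pi.single_eq_of_ne (Finset.ne_of_mem_erase hj),
        Pi.single_eq_of_ne (Finset.ne_of_mem_erase hj), Complex.ofReal_zero]
    · simp [hXdef, shear_symm_apply, toC, hj]
  have hXcd : ∀ w ∈ strip n δ₁, DifferentiableAt ℂ Xc w ∧ (ρ : ℂ) * (fderiv ℂ Xc w).det = p w := by
    intro w hw
    have h0 : HasFDerivAt (fun w => Y (straighten a w) + Pi.single 0 (c₀ : ℂ)) _ w :=
      ((hYat _ (hBm hw)).hasFDerivAt.comp w (hBd w hw).hasFDerivAt).add_const _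
    have h1 : HasFDerivAt Xc _ w :=
      (shear ℂ : (Fin n → ℂ) ≃L[ℂ] (Fin n → ℂ)).symm.toContinuousLinearMap.hasFDerivAt.comp w h0
    refine ⟨h1.differentiableAt, ?_⟩
    rw [h1.fderiv, det_comp_complex, det_comp_complex, det_shear_symm, one_mul, hYdet _ (hBm hw),
      ← mul_assoc, hmod w hw]
  refine ⟨δ₁, ρ, K, γ, X, fun w => wrap Γ Y (straighten a w), hδ₁, by linarith, hρ, hKω,
    fun s t hst => hK₀m (by linarith), fun t => ?_, hc₀, hγω, hγd, hXlat, fun θ => ?_, ?_, ?_, ?_⟩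
  · simp only [hKdef]
    rw [← hK₀per]; ring_nf
  · have hw := toC_mem_strip hδ₁ θ
    obtain ⟨h1, h2⟩ := hXcd _ hw
    obtain ⟨h3, h4⟩ := det_fderiv_of_eq_toC hXc h1
    rw [← h4] at h2
    refine ⟨h3, ?_, ?_⟩
    · have h5 := (Complex.abs_re_le_norm _).trans
        (h.mod_near_one _ (hsub (hsub1 hw)))
      rw [← h2, ← Complex.ofReal_mul, ← Complex.ofReal_one, ← Complex.ofReal_sub,
        Complex.ofReal_re] at h5
      exact pos_of_mul_pos_right (by linarith [(abs_le.1 h5).1]) hρ.le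
    · rw [hFdet _ hw, ← h2, hX0, hB]
      simp only [hKdef, add_sub_cancel_right, hK₀T, toC]
      ring
  · intro w hw
    exact (DifferentiableAt.comp w (differentiableAt_wrap (hΓd.differentiableAt
      (isOpen_strip.mem_nhds (hBm hw))) (hYat _ (hBm hw))) (hBd w hw)).differentiableWithinAt
  · intro w hw
    have hΓat : DifferentiableAt ℂ Γ (straighten a w) :=
      hΓd.differentiableAt (isOpen_strip.mem_nhds (hBm hw))
    have h1 : (fun w => wrap Γ Y (straighten a w)) = wrap Γ Y ∘ straighten a := rfl
    rw [h1, fderiv_comp w (differentiableAt_wrap hΓat (hYat _ (hBm hw))) (hBd w hw),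
      det_comp_complex, det_fderiv_wrap hΓat (hYat _ (hBm hw)) hYt hut
        (hasDerivAt_slicePrim hud 0 (hBm hw)), hFdet w hw, ← hmod w hw, hu _ (hBm hw),
      ← Finset.mul_prod_erase _ _ (Finset.mem_univ 0)]
    ring
  · intro θ
    simp only [wrap, hB, hYr, ccover_toC, hX0, hΓγ]
    funext j
    by_cases hj : j = 0
    · subst hj
      simp only [update_self]
      congr 4
      simp only [toC]
      push_cast
      exact Finset.sum_congr rfl fun j hj => by rw [hXne θ j (Finset.ne_of_mem_erase hj)]
    · simp only [update_of_ne hj, cover, hXne θ j hj]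

end

section
variable {n : ℕ} {δ : ℝ}

/-! ### Existence of the normal form -/

theorem annulus_mono {r s : ℝ} (h : r ≤ s) : annulus n r ⊆ annulus n s := fun _ hz j =>
  ⟨(Real.exp_le_exp.2 (neg_le_neg h)).trans_lt (hz j).1, (hz j).2.trans_le (Real.exp_le_exp.2 h)⟩

theorem isOpen_annulus (r : ℝ) : IsOpen (annulus n r) := by
  simp only [annulus, ofPred_forall]
  have hc : ∀ j, Continuous fun z : Fin n → ℂ => ‖z j‖ := fun j => by fun_prop
  exact isOpen_iInter_of_finite fun j =>
    (isOpen_lt continuous_const (hc j)).and (isOpen_lt (hc j) continuous_const)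

theorem torus_subset_annulus {r : ℝ} (hr : 0 < r) : torus n ⊆ annulus n r := fun _ hz j => by
  rw [hz j]
  exact ⟨by simpa using hr, by simpa using hr⟩

theorem exists_ccover_eq {z : Fin n → ℂ} (hz : ∀ j, z j ≠ 0) : ccover (fun j => -(Complex.I *
    Complex.log (z j))) = z := by
  funext j
  simp only [ccover]
  rw [mul_neg, ← mul_assoc, Complex.I_mul_I, neg_mul, one_mul, neg_neg, Complex.exp_log (hz j)]

/-- A holomorphic map of the strip that factors through the covering map `ccover` on real points
descends to the annulus. -/
theorem exists_descent {G : (Fin n → ℂ) → (Fin n → ℂ)} (hδ : 0 < δ)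
    (hG : DifferentiableOn ℂ G (strip n δ))
    (hp : ∀ (x : Fin n → ℝ) (m : Fin n → ℤ), G (toC (x + lat m)) = G (toC x)) :
    ∃ f : (Fin n → ℂ) → (Fin n → ℂ), DifferentiableOn ℂ f (annulus n δ) ∧
      ∀ w ∈ strip n δ, f (ccover w) = G w := by
  have hshift : ∀ w ∈ strip n δ, ∀ m : Fin n → ℤ, w + toC (lat m) ∈ strip n δ := fun w hw m j => by
    simpa [toC] using hw j
  have hper : ∀ w ∈ strip n δ, ∀ m : Fin n → ℤ, G (w + toC (lat m)) = G w := fun w hw m => by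
    refine eqOn_strip_of_eq_real (f := fun w => G (w + toC (lat m))) hδ
      (hG.comp (by fun_prop) fun w hw => hshift w hw m) hG (fun x => ?_) hw
    rw [← toC_add, hp]
  have key : ∀ w ∈ strip n δ, G (fun j => -(Complex.I * Complex.log (ccover w j))) = G w :=
    fun w hw => by
      obtain ⟨m, hm⟩ := ccover_eq_iff.1 (exists_ccover_eq (z := ccover w)
        fun j => Complex.exp_ne_zero _)
      rw [hm, hper w hw]
  refine ⟨fun z => G fun j => -(Complex.I * Complex.log (z j)), fun z hz => ?_, key⟩
  have hz0 : ∀ j, z j ≠ 0 := fun j h0 => by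
    have := (hz j).1
    rw [h0, norm_zero] at this
    exact absurd this (not_lt.2 (Real.exp_pos _).le)
  set w : Fin n → ℂ := fun j => -(Complex.I * Complex.log (z j)) with hw
  have hcw : ccover w = z := exists_ccover_eq hz0
  have hws : w ∈ strip n δ := ccover_mem_annulus.1 (hcw ▸ hz)
  -- a local inverse of the covering map
  let S : (Fin n → ℂ) → (Fin n → ℂ) := fun y j => w j - Complex.I * Complex.log (y j * (z j)⁻¹)
  have hSd : DifferentiableAt ℂ S z := by
    refine differentiableAt_pi.2 fun j => ?_
    refine (DifferentiableAt.const_mul (DifferentiableAt.clog (by fun_prop) ?_) _).const_sub _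
    rw [mul_inv_cancel₀ (hz0 j)]
    exact Complex.one_mem_slitPlane
  have hSz : S z = w := by
    funext j
    simp only [S]
    rw [mul_inv_cancel₀ (hz0 j), Complex.log_one, mul_zero, sub_zero]
  have hGS : DifferentiableAt ℂ (G ∘ S) z :=
    DifferentiableAt.comp z (hSz ▸ hG.differentiableAt (isOpen_strip.mem_nhds hws)) hSd
  refine (hGS.congr_of_eventuallyEq ?_).differentiableWithinAt
  have h1 : ∀ᶠ y in 𝓝 z, S y ∈ strip n δ :=
    hSd.continuousAt.eventually_mem (isOpen_strip.mem_nhds (hSz ▸ hws))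
  have h2 : ∀ᶠ y in 𝓝 z, ∀ j, y j ≠ 0 := by
    rw [eventually_all]
    exact fun j => (continuous_apply j).continuousAt.eventually_ne (hz0 j)
  filter_upwards [h1, h2] with y hy1 hy2
  have h3 : ccover (S y) = y := by
    funext j
    have h4 := congrFun hcw j
    simp only [ccover] at h4
    simp only [ccover, S]
    rw [mul_sub, Complex.exp_sub, h4, ← mul_assoc, Complex.I_mul_I, neg_mul, one_mul,
      Complex.exp_neg, Complex.exp_log (mul_ne_zero (hy2 j) (inv_ne_zero (hz0 j)))]
    have := hz0 j
    field_simp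
  have h5 := key (S y) hy1
  rw [h3] at h5
  exact h5

theorem exists_circle_function {γ : ℝ → ℂ} (hγ : Periodic γ (2 * Real.pi)) :
    ∃ g : ℂ → ℂ, ∀ t : ℝ, g (Complex.exp (Complex.I * t)) = γ t := by
  refine ⟨fun z => γ z.arg, fun t => ?_⟩
  beta_reduce
  rw [mul_comm, Complex.arg_exp_mul_I]
  exact hγ.sub_zsmul_eq _

section
variable [NeZero n]

/-- The Jacobian of a torus over a full period has mean zero, hence so has the tangent of the
curve: the curve closes up. -/
theorem integral_tangent_eq_zero {f : (Fin n → ℝ) → (Fin n → ℂ)} (hf : ContDiff ℝ 1 f)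
    (hp : ∀ x m, f (x + lat m) = f x) {ρ : ℝ} {K : ℝ → ℝ}
    (hK : ∀ t, K (t + 2 * Real.pi) = K t + 2 * Real.pi) {X : (Fin n → ℝ) → (Fin n → ℝ)}
    (hX : IsLatticeBijective X) (hXd : ∀ θ, DifferentiableAt ℝ X θ ∧ 0 < (fderiv ℝ X θ).det ∧
      (dmat (fderiv ℝ f θ)).det =
        Complex.I ^ (n - 1) * (ρ * Complex.exp (Complex.I * K (∑ j, X θ j))) *
          (fderiv ℝ X θ).det) :
    ∫ t in (0 : ℝ)..(2 * Real.pi), ρ * Complex.exp (Complex.I * K t) = 0 := by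
  have hv : Periodic (fun t : ℝ => (ρ : ℂ) * Complex.exp (Complex.I * K t)) (2 * Real.pi) :=
    fun t => by
      simp only [hK]
      push_cast
      rw [mul_add, Complex.exp_add, show Complex.I * (2 * Real.pi) = 2 * Real.pi * Complex.I by ring,
        Complex.exp_two_pi_mul_I, mul_one]
  have hvlat : ∀ (x : Fin n → ℝ) (m : Fin n → ℤ),
      (ρ : ℂ) * Complex.exp (Complex.I * K (∑ j, (x + lat m) j)) =
        ρ * Complex.exp (Complex.I * K (∑ j, x j)) := fun x m => by
    have h1 : ∑ j, (x + lat m) j = ∑ j, x j + (∑ j, m j : ℤ) * (2 * Real.pi) := by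
      simp only [Pi.add_apply, lat, Finset.sum_add_distrib, ← Finset.mul_sum]
      push_cast
      ring
    rw [h1]
    exact hv.int_mul _ _
  have h0 := integral_det_dmat_eq_zero (NeZero.ne n) hf hp
  have h1 : ∀ θ, (dmat (fderiv ℝ f θ)).det = Complex.I ^ (n - 1) * (|(fderiv ℝ X θ).det| •
      ((ρ : ℂ) * Complex.exp (Complex.I * K (∑ j, X θ j)))) := fun θ => by
    rw [(hXd θ).2.2, abs_of_pos (hXd θ).2.1, Complex.real_smul]
    ring
  simp only [h1] at h0
  rw [integral_const_mul, integral_box_comp hX (fun θ => (hXd θ).1.hasFDerivAt)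
    (f := fun x => (ρ : ℂ) * Complex.exp (Complex.I * K (∑ j, x j))) hvlat,
    integral_box_sum _ hv] at h0
  have h2 := (mul_eq_zero.1 h0).resolve_left (pow_ne_zero _ Complex.I_ne_zero)
  refine (mul_eq_zero.1 h2).resolve_left (pow_ne_zero _ ?_)
  simp [Real.pi_ne_zero]

/-- The map `G` in normal form descends to a map near the torus with the same Jacobian as `φ`, so that
its image is unimodularly equivalent to the given torus. -/
theorem exists_hasNormalForm {ε r c : ℝ} {φ : (Fin n → ℂ) → (Fin n → ℂ)} {a p : (Fin n → ℂ) → ℂ}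
    (hφ : IsNearIdentity ε r φ)
    (hpol : IsPolarJacobian (r / 2) c (fun w => φ (ccover w)) a p) {δ₁ ρ : ℝ} {K : ℝ → ℝ}
    {γ : ℝ → ℂ} {X : (Fin n → ℝ) → (Fin n → ℝ)} {G : (Fin n → ℂ) → (Fin n → ℂ)}
    (hδ₁ : 0 < δ₁) (hδ₁r : δ₁ ≤ r / 2) (hρ : 0 < ρ) (hKω : ContDiff ℝ ω K) (hKm : StrictMono K)
    (hKper : ∀ t, K (t + 2 * Real.pi) = K t + 2 * Real.pi)
    (hKmean : (∫ t in (0 : ℝ)..(2 * Real.pi), (K t - t)) = 0) (hγω : ContDiff ℝ ω γ)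
    (hγ : ∀ t : ℝ, HasDerivAt γ (ρ * Complex.exp (Complex.I * K t)) t)
    (hX : IsLatticeBijective X)
    (hXd : ∀ θ, DifferentiableAt ℝ X θ ∧ 0 < (fderiv ℝ X θ).det ∧
      (fderiv ℂ (fun w => φ (ccover w)) (toC θ)).det =
        Complex.I ^ (n - 1) * (ρ * Complex.exp (Complex.I * K (∑ j, X θ j))) *
          (fderiv ℝ X θ).det)
    (hGd : DifferentiableOn ℂ G (strip n δ₁))
    (hGdet : ∀ w ∈ strip n δ₁,
      (fderiv ℂ G w).det = (fderiv ℂ (fun w => φ (ccover w)) w).det)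
    (hG : ∀ θ, G (toC θ) = update (cover (X θ)) 0 (Complex.exp (-(Complex.I *
        ((∑ j ∈ Finset.univ.erase 0, X θ j : ℝ) : ℂ))) * γ (∑ j, X θ j))) :
    HasNormalForm ω (φ '' torus n) ρ fun t => K t - t := by
  set F : (Fin n → ℂ) → (Fin n → ℂ) := fun w => φ (ccover w) with hF
  have hφ₁ : DifferentiableOn ℂ φ (annulus n δ₁) := hφ.1.mono (annulus_mono (by linarith))
  have hFd : ∀ w ∈ strip n δ₁, DifferentiableAt ℂ F w := fun w hw =>
    DifferentiableAt.comp w (hφ₁.differentiableAt ((isOpen_annulus _).mem_nhds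
      (ccover_mem_annulus.2 hw))) (differentiable_ccover w)
  have hint := integral_tangent_eq_zero (f := fun θ => φ (cover θ)) (hφ.2.1.1.of_le (by simp))
    (fun x m => by simp only [cover_add_lat]) hKper hX fun θ => by
      have := det_dmat_fderiv_comp_toC (hFd _ (toC_mem_strip hδ₁ θ))
      refine ⟨(hXd θ).1, (hXd θ).2.1, ?_⟩
      rw [← (hXd θ).2.2, ← this]
      rfl
  have hγper : Periodic γ (2 * Real.pi) := fun t => by
    have hv : Periodic (fun t : ℝ => (ρ : ℂ) * Complex.exp (Complex.I * K t)) (2 * Real.pi) :=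
      fun t => by
        simp only [hKper]
        push_cast
        rw [mul_add, Complex.exp_add,
          show Complex.I * (2 * Real.pi) = 2 * Real.pi * Complex.I by ring,
          Complex.exp_two_pi_mul_I, mul_one]
    have h1 := intervalIntegral.integral_eq_sub_of_hasDerivAt (a := t) (b := t + 2 * Real.pi)
      (fun s _ => hγ s) (Continuous.intervalIntegrable (by
        have := hKω.continuous
        fun_prop) _ _)
    rw [hv.intervalIntegral_add_eq t 0, zero_add, hint] at h1
    exact (sub_eq_zero.1 h1.symm)
  obtain ⟨g, hg⟩ := exists_circle_function hγper
  have hgfun : (fun u : ℝ => g (Complex.exp (Complex.I * (u : ℂ)))) = γ := funext hg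
  have hgd : ∀ t : ℝ, HasDerivAt (fun u : ℝ => g (Complex.exp (Complex.I * (u : ℂ))))
      ((ρ : ℂ) * Complex.exp (Complex.I * ((t : ℂ) + ((K t - t : ℝ) : ℂ)))) t := fun t => by
    rw [hgfun]
    have := hγ t
    push_cast
    rwa [add_sub_cancel]
  have hkper : Periodic (fun t => K t - t) (2 * Real.pi) := fun t => by
    simp only [hKper]; ring
  have hemb : IsTorusEmbedding ω (normalMap (n := n) g) :=
    isTorusEmbedding_normalMap hρ (by simpa using hKm) hkper (by rw [hgfun]; exact hγω) hgd
  have hGn : ∀ θ, G (toC θ) = normalMap g (cover (X θ)) := fun θ => by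
    rw [hG]
    funext j
    by_cases hj : j = 0
    · subst hj
      rw [normalMap_cover_zero, hg, update_self]
    · rw [normalMap_cover_ne _ _ hj, update_of_ne hj, cover]
  obtain ⟨f, hfd, hfG⟩ := exists_descent hδ₁ hGd fun x m => by
    obtain ⟨m', hm'⟩ := hX.map_add x m
    rw [hGn, hGn, hm', cover_add_lat]
  have hfcover : ∀ θ, f (cover θ) = normalMap g (cover (X θ)) := fun θ => by
    rw [← hGn, ← hfG _ (toC_mem_strip hδ₁ θ), ccover_toC]
  refine ⟨hρ, hKω.continuous.sub continuous_id, hkper, hKmean, g, hgd, hemb, ?_⟩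
  have himage : f '' torus n = normalMap g '' torus n := by
    ext y
    constructor
    · rintro ⟨z, hz, rfl⟩
      obtain ⟨θ, rfl⟩ := exists_cover_eq hz
      exact ⟨_, cover_mem_torus _, (hfcover θ).symm⟩
    · rintro ⟨z, hz, rfl⟩
      obtain ⟨η, rfl⟩ := exists_cover_eq hz
      obtain ⟨θ, m, hθ⟩ := hX.surjective η
      exact ⟨_, cover_mem_torus θ, by rw [hfcover, hθ, cover_add_lat]⟩
  rw [← himage]
  have hinj : InjOn f (torus n) := by
    intro z hz z' hz' h
    obtain ⟨θ, rfl⟩ := exists_cover_eq hz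
    obtain ⟨θ', rfl⟩ := exists_cover_eq hz'
    rw [hfcover, hfcover] at h
    obtain ⟨m, hm⟩ := cover_eq_iff.1 (hemb.2.2 (cover_mem_torus _) (cover_mem_torus _) h)
    obtain ⟨m', hm'⟩ := hX.injective _ _ m hm
    rw [hm', cover_add_lat]
  have hdets : ∀ z ∈ annulus n δ₁, ∃ d : ℂ, (fderiv ℂ φ z).det * d ≠ 0 ∧
      (fderiv ℂ f z).det * d = (fderiv ℂ φ z).det * d := fun z hz => by
    have hz0 : ∀ j, z j ≠ 0 := fun j h0 => by
      have := (hz j).1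
      rw [h0, norm_zero] at this
      exact absurd this (not_lt.2 (Real.exp_pos _).le)
    obtain ⟨w, rfl⟩ : ∃ w, ccover w = z := ⟨_, exists_ccover_eq hz0⟩
    have hw := ccover_mem_annulus.1 hz
    have h1 : (fderiv ℂ F w).det = (fderiv ℂ φ (ccover w)).det * (fderiv ℂ ccover w).det := by
      rw [← det_comp_complex, ← fderiv_comp w (hφ₁.differentiableAt ((isOpen_annulus _).mem_nhds hz))
        (differentiable_ccover w)]
      rfl
    have h2 : (fderiv ℂ G w).det = (fderiv ℂ f (ccover w)).det * (fderiv ℂ ccover w).det := by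
      rw [← det_comp_complex, ← fderiv_comp w (hfd.differentiableAt ((isOpen_annulus _).mem_nhds hz))
        (differentiable_ccover w)]
      congr 1
      refine Filter.EventuallyEq.fderiv_eq ?_
      filter_upwards [isOpen_strip.mem_nhds hw] with y hy
      exact (hfG y hy).symm
    refine ⟨(fderiv ℂ ccover w).det, ?_, by rw [← h1, ← h2, hGdet w hw]⟩
    have hw' : w ∈ strip n (r / 2) := fun j => (hw j).trans_le hδ₁r
    rw [← h1, hpol.det_eq w hw']
    have hp0 : p w ≠ 0 := fun h0 => by
      have := hpol.mod_near_one w hw'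
      rw [h0, zero_sub, norm_neg, norm_one] at this
      linarith
    exact mul_ne_zero (mul_ne_zero (pow_ne_zero _ Complex.I_ne_zero) (Complex.exp_ne_zero _))
      (mul_ne_zero hp0 (Complex.exp_ne_zero _))
  refine unimodularEquiv_of_det_eq (isOpen_annulus δ₁) (torus_subset_annulus hδ₁) hφ₁ hfd
    hφ.2.1.2.2 hinj (fun z hz => ?_) fun z hz => ?_
  · obtain ⟨d, hd, -⟩ := hdets z hz
    exact left_ne_zero_of_mul hd
  · obtain ⟨d, hd, h⟩ := hdets z hz
    exact mul_right_cancel₀ (right_ne_zero_of_mul hd) h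

end

end

section
variable {n : ℕ} {δ : ℝ}

/-! ### Uniqueness of the normal form -/

/-- A differentiable map into the torus lifts to the universal covering. -/
theorem exists_lift {χ : (Fin n → ℝ) → (Fin n → ℂ)} (hχ : Differentiable ℝ χ)
    (hT : ∀ θ, χ θ ∈ torus n) :
    ∃ X : (Fin n → ℝ) → (Fin n → ℝ), Differentiable ℝ X ∧ ∀ θ, cover (X θ) = χ θ := by
  have hsc : IsSimplyConnected (univ : Set (Fin n → ℝ)) := by
    have : ContractibleSpace (univ : Set (Fin n → ℝ)) :=
      convex_univ.contractibleSpace univ_nonempty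
    exact inferInstanceAs (SimplyConnectedSpace (univ : Set (Fin n → ℝ)))
  have hχj : ∀ j, Differentiable ℝ fun θ => χ θ j := differentiable_pi.1 hχ
  have h : ∀ j, ∃ f : (Fin n → ℝ) → ℂ, Continuous f ∧ ∀ θ, Complex.exp (f θ) = χ θ j := fun j => by
    obtain ⟨f, hf, hfe⟩ := Complex.exists_continuousOn_eqOn_exp_comp hsc isOpen_univ
      (g := fun θ => χ θ j) (hχj j).continuous.continuousOn (by
        rintro ⟨θ, -, h0⟩
        have := hT θ j
        simp only at h0
        rw [h0, norm_zero] at this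
        exact zero_ne_one this)
    exact ⟨f, continuousOn_univ.1 hf, fun θ => hfe (mem_univ θ)⟩
  choose f hfc hfe using h
  have hfd : ∀ j, Differentiable ℝ (f j) := fun j θ => by
    have h1 : ∀ᶠ y in 𝓝 θ, dist (f j y) (f j θ) < Real.pi :=
      Metric.tendsto_nhds.1 (hfc j).continuousAt Real.pi Real.pi_pos
    have h2 : DifferentiableAt ℝ
        (fun y => f j θ + Complex.log (χ y j * Complex.exp (-f j θ))) θ := by
      have h0 : χ θ j * Complex.exp (-f j θ) ∈ Complex.slitPlane := by
        rw [← hfe, ← Complex.exp_add, add_neg_cancel, Complex.exp_zero]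
        exact Complex.one_mem_slitPlane
      have h3 := (Complex.hasStrictDerivAt_log h0).hasDerivAt.differentiableAt.restrictScalars ℝ
      exact (DifferentiableAt.comp (f := fun y => χ y j * Complex.exp (-f j θ)) θ h3
        ((hχj j θ).mul_const _)).const_add _
    refine h2.congr_of_eventuallyEq ?_
    filter_upwards [h1] with y hy
    rw [dist_eq_norm] at hy
    have h3 := abs_lt.1 ((Complex.abs_im_le_norm _).trans_lt hy)
    rw [← hfe, ← Complex.exp_add, ← sub_eq_add_neg, Complex.log_exp h3.1 h3.2.le]
    ring
  refine ⟨fun θ j => (f j θ).im, differentiable_pi.2 fun j =>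
    Complex.imCLM.differentiable.comp (hfd j), fun θ => funext fun j => ?_⟩
  have h1 : (f j θ).re = 0 := by
    have := hT θ j
    rwa [← hfe, Complex.norm_exp, Real.exp_eq_one_iff] at this
  rw [← hfe, cover]
  congr 1
  exact Complex.ext (by simp [h1]) (by simp)

/-- Two unimodularly equivalent embedded tori differ by a change of parameters, which transforms
the coefficients of the pullbacks of `Ω` into each other. -/
theorem exists_reparametrization {φ ψ : (Fin n → ℂ) → (Fin n → ℂ)} {U : Set (Fin n → ℂ)}
    (hU : IsOpen U) (hT : torus n ⊆ U) (hφ : DifferentiableOn ℂ φ U) (hinj : InjOn φ (torus n))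
    (hdet : ∀ z ∈ U, (fderiv ℂ φ z).det ≠ 0)
    (hψ : Differentiable ℝ fun θ : Fin n → ℝ => ψ (cover θ)) (hinj' : InjOn ψ (torus n))
    (h : UnimodularEquiv (φ '' torus n) (ψ '' torus n)) :
    ∃ X : (Fin n → ℝ) → (Fin n → ℝ), IsLatticeBijective X ∧ Differentiable ℝ X ∧
      ∀ θ, pullbackCoeff ψ θ = pullbackCoeff φ (X θ) * (fderiv ℝ X θ).det := by
  obtain ⟨Φ, hM, hΦd, hΦd', hΩ, hΦ⟩ := h
  obtain ⟨V, hV, hTV, hVU, hiV⟩ := exists_biholomorphic_near_torus hU hT hφ hinj hdet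
  obtain ⟨e, hes, hef, hed⟩ := exists_biholomorphic hV (hφ.mono hVU) hiV
    fun z hz => hdet z (hVU hz)
  -- every point of the second torus is the image of a unique point of the first
  have hpt : ∀ θ, ∃ z ∈ torus n, ψ (cover θ) = Φ (φ z) := fun θ => by
    have h1 : ψ (cover θ) ∈ Φ '' (φ '' torus n) := hΦ ▸ mem_image_of_mem ψ (cover_mem_torus θ)
    obtain ⟨_, ⟨z, hz, rfl⟩, h2⟩ := h1
    exact ⟨z, hz, h2.symm⟩
  have hinv : ∀ z ∈ torus n, e.symm (Φ.symm (Φ (φ z))) = z := fun z hz => by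
    rw [Φ.left_inv (hM (mem_image_of_mem _ hz)), ← hef, e.left_inv (hes ▸ hTV hz)]
  set χ : (Fin n → ℝ) → (Fin n → ℂ) := fun θ => e.symm (Φ.symm (ψ (cover θ))) with hχ
  have hχT : ∀ θ, χ θ ∈ torus n := fun θ => by
    obtain ⟨z, hz, h1⟩ := hpt θ
    rw [hχ]; simp only [h1, hinv z hz, hz]
  have hχψ : ∀ θ, Φ (φ (χ θ)) = ψ (cover θ) := fun θ => by
    obtain ⟨z, hz, h1⟩ := hpt θ
    rw [hχ]; simp only [h1, hinv z hz]
  have hχd : Differentiable ℝ χ := fun θ => by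
    obtain ⟨z, hz, h1⟩ := hpt θ
    have h2 : ψ (cover θ) ∈ Φ.target := h1 ▸ Φ.map_source (hM (mem_image_of_mem _ hz))
    have h3 : Φ.symm (ψ (cover θ)) ∈ e.target := by
      rw [h1, Φ.left_inv (hM (mem_image_of_mem _ hz)), ← hef]
      exact e.map_source (hes ▸ hTV hz)
    have h4 := (hed.differentiableAt (e.open_target.mem_nhds h3)).restrictScalars ℝ
    have h5 := (hΦd'.differentiableAt (Φ.open_target.mem_nhds h2)).restrictScalars ℝ
    exact h4.comp θ (h5.comp θ (hψ θ))
  obtain ⟨X, hXd, hX⟩ := exists_lift hχd hχT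
  refine ⟨X, ⟨fun x m => ?_, fun x y m hxy => ?_, fun y => ?_⟩, hXd, fun θ => ?_⟩
  · refine cover_eq_iff.1 ?_
    rw [hX, hX]
    simp only [hχ, cover_add_lat]
  · refine cover_eq_iff.1 (hinj' (cover_mem_torus _) (cover_mem_torus _) ?_)
    rw [← hχψ, ← hχψ, ← hX, ← hX, hxy, cover_add_lat]
  · have h1 : Φ (φ (cover y)) ∈ ψ '' torus n :=
      hΦ ▸ mem_image_of_mem _ (mem_image_of_mem _ (cover_mem_torus y))
    obtain ⟨z, hz, h2⟩ := h1
    obtain ⟨x, rfl⟩ := exists_cover_eq hz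
    refine ⟨x, cover_eq_iff.1 ?_⟩
    rw [hX]
    simp only [hχ, h2, hinv _ (cover_mem_torus y)]
  · have h1 : (fun θ => ψ (cover θ)) = fun θ => Φ (φ (cover (X θ))) := by
      funext θ; rw [hX, hχψ]
    have hφd : DifferentiableAt ℝ (fun x => φ (cover x)) (X θ) :=
      ((hφ.differentiableAt (hU.mem_nhds (hT (cover_mem_torus (X θ))))).restrictScalars ℝ).comp
        (X θ) (((differentiable_ccover _).hasFDerivAt.restrictScalars ℝ).comp (X θ)
          (hasFDerivAt_toC (X θ))).differentiableAt
    have hsrc : φ (cover (X θ)) ∈ Φ.source := hM (mem_image_of_mem _ (cover_mem_torus _))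
    have h2 : HasFDerivAt (fun θ => Φ (φ (cover (X θ)))) _ θ :=
      HasFDerivAt.comp (f := fun θ => φ (cover (X θ))) θ
        ((hΦd.differentiableAt (Φ.open_source.mem_nhds hsrc)).hasFDerivAt.restrictScalars ℝ)
        (HasFDerivAt.comp (f := X) (g := fun x => φ (cover x)) θ hφd.hasFDerivAt
          (hXd θ).hasFDerivAt)
    rw [pullbackCoeff_eq_det, pullbackCoeff_eq_det, h1, h2.fderiv, dmat_comp_left, dmat_comp,
      (Omega_compLinearMap_eq_iff _).1 (hΩ _ hsrc), one_mul]

/-- The measure of the set of parameters that `A` maps, modulo `2π`, into `[A b, A s)`. -/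
theorem integral_lt_indicator {A : ℝ → ℝ} (hA : StrictMono A)
    (hper : ∀ t, A (t + 2 * Real.pi) = A t + 2 * Real.pi) {b s : ℝ} (hbs : b ≤ s)
    (hsb : s ≤ b + 2 * Real.pi) :
    ∫ t in (0 : ℝ)..(2 * Real.pi),
      (if toIcoMod Real.two_pi_pos (A b) (A t) < A s then (1 : ℝ) else 0) = s - b := by
  have hp : Periodic (fun t => if toIcoMod Real.two_pi_pos (A b) (A t) < A s then (1 : ℝ) else 0)
      (2 * Real.pi) := fun t => by
    simp only [hper, toIcoMod_add_right]
  have h1 := hp.intervalIntegral_add_eq 0 b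
  rw [zero_add] at h1
  have hself : ∀ t ∈ Ico b (b + 2 * Real.pi), toIcoMod Real.two_pi_pos (A b) (A t) = A t :=
    fun t ht => by
      rw [toIcoMod_eq_self, ← hper]
      exact ⟨hA.monotone ht.1, hA ht.2⟩
  rw [h1, intervalIntegral.integral_of_le (by linarith), ← integral_Ico_eq_integral_Ioc]
  have h2 : ∫ t in Ico b (b + 2 * Real.pi),
      (if toIcoMod Real.two_pi_pos (A b) (A t) < A s then (1 : ℝ) else 0) =
      ∫ t in Ico b (b + 2 * Real.pi), (Iio s).indicator (fun _ => (1 : ℝ)) t := by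
    refine setIntegral_congr_fun measurableSet_Ico fun t ht => ?_
    simp only [hself t ht, indicator, mem_Iio, hA.lt_iff_lt]
  rw [h2, setIntegral_indicator measurableSet_Iio, Ico_inter_Iio, min_eq_right hsb]
  simp [hbs]

/-- A lift of a circle homeomorphism is determined, up to a translation of the parameter, by the
image of the Lebesgue measure. -/
theorem exists_translate_eq {A A' : ℝ → ℝ} (hA : StrictMono A) (hA' : StrictMono A')
    (hAper : ∀ t, A (t + 2 * Real.pi) = A t + 2 * Real.pi)
    (hAper' : ∀ t, A' (t + 2 * Real.pi) = A' t + 2 * Real.pi) (hc : Continuous A')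
    (h : ∀ v : ℝ → ℝ, Periodic v (2 * Real.pi) → ∫ t in (0 : ℝ)..(2 * Real.pi), v (A t) =
      ∫ t in (0 : ℝ)..(2 * Real.pi), v (A' t)) : ∃ b, ∀ t, A' (t + b) = A t := by
  have hp : Periodic (fun s => A' s - s) (2 * Real.pi) := fun s => by
    simp only [hAper']; ring
  have hperz : ∀ (m : ℤ), A' (0 + m * (2 * Real.pi)) = A' 0 + m * (2 * Real.pi) := fun m => by
    have := hp.int_mul m 0
    linarith
  have hs : Surjective A' := fun b => by
    refine mem_range_of_exists_le_of_exists_ge hc ?_ ?_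
    · obtain ⟨m, hm'⟩ := exists_int_lt ((b - A' 0) / (2 * Real.pi))
      rw [lt_div_iff₀ Real.two_pi_pos] at hm'
      exact ⟨0 + m * (2 * Real.pi), by rw [hperz]; linarith⟩
    · obtain ⟨m, hm'⟩ := exists_int_gt ((b - A' 0) / (2 * Real.pi))
      rw [div_lt_iff₀ Real.two_pi_pos] at hm'
      exact ⟨0 + m * (2 * Real.pi), by rw [hperz]; linarith⟩
  obtain ⟨b, hb⟩ := hs (A 0)
  have key : ∀ s ∈ Icc 0 (2 * Real.pi), A' (s + b) = A s := fun s hs' => by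
    obtain ⟨s₂, hs₂⟩ := hs (A s)
    have hb₁ : b ≤ s₂ := by
      rw [← hA'.le_iff_le, hb, hs₂]
      exact hA.monotone hs'.1
    have hb₂ : s₂ ≤ b + 2 * Real.pi := by
      rw [← hA'.le_iff_le, hAper', hb, hs₂, ← hAper, zero_add]
      exact hA.monotone hs'.2
    have h1 := integral_lt_indicator hA hAper hs'.1 (by simpa using hs'.2)
    have h2 := integral_lt_indicator hA' hAper' hb₁ hb₂
    rw [hb, hs₂] at h2
    have h3 := h (fun y => if toIcoMod Real.two_pi_pos (A 0) y < A s then (1 : ℝ) else 0)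
      fun y => by simp only [toIcoMod_add_right]
    rw [h1, h2] at h3
    rw [← hs₂]
    congr 1
    linarith
  refine ⟨b, fun t => ?_⟩
  have hpd : Periodic (fun t => A' (t + b) - A t) (2 * Real.pi) := fun t => by
    simp only [hAper]
    rw [add_right_comm, hAper']
    ring
  obtain ⟨y, hy, hye⟩ := hpd.exists_mem_Ico₀ Real.two_pi_pos t
  have h1 := key y ⟨hy.1, hy.2.le⟩
  have h2 : A' (t + b) - A t = A' (y + b) - A y := hye
  rw [h1, sub_self] at h2
  linarith

end

section
variable {n : ℕ} {δ : ℝ}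

theorem meanVolume_eq (φ : (Fin n → ℂ) → (Fin n → ℂ)) :
    meanVolume φ = (∫ x in box n, ‖pullbackCoeff φ x‖) / (2 * Real.pi) ^ n := by
  rw [meanVolume, totalVolume, setIntegral_congr_set box_ae_eq_Icc]

section
variable [NeZero n]

theorem norm_pullbackCoeff_eq_and {ε r c : ℝ} {φ : (Fin n → ℂ) → (Fin n → ℂ)}
    {a p : (Fin n → ℂ) → ℂ} (hφ : IsNearIdentity ε r φ) (hr : 0 < r)
    (hpol : IsPolarJacobian (r / 2) c (fun w => φ (ccover w)) a p) (x : Fin n → ℝ) :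
    0 < (p (toC x)).re ∧ pullbackCoeff φ x = Complex.I ^ (n - 1) * ((p (toC x)).re *
      Complex.exp (Complex.I * ((∑ j, x j + Real.pi / 2 + (a (toC x)).re : ℝ) : ℂ))) := by
  have hx := toC_mem_strip (half_pos hr) x
  have hx' := toC_mem_strip hr x
  have hd : DifferentiableAt ℂ (fun w => φ (ccover w)) (toC x) :=
    DifferentiableAt.comp _ (hφ.1.differentiableAt ((isOpen_annulus _).mem_nhds
      (ccover_mem_annulus.2 hx'))) (differentiable_ccover _)
  constructor
  · have h1 := (Complex.abs_re_le_norm _).trans (hpol.mod_near_one _ hx)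
    rw [Complex.sub_re, Complex.one_re] at h1
    linarith [(abs_le.1 h1).1]
  · have h1 : pullbackCoeff φ x = (fderiv ℂ (fun w => φ (ccover w)) (toC x)).det := by
      rw [pullbackCoeff_eq_det, ← det_dmat_fderiv_comp_toC hd]
      rfl
    have h2 : p (toC x) = ((p (toC x)).re : ℂ) := Complex.ext (by simp) (by simp [hpol.mod_im])
    have h3 : a (toC x) = ((a (toC x)).re : ℂ) := Complex.ext (by simp) (by simp [hpol.arg_im])
    have h4 : Complex.I ^ n = Complex.I ^ (n - 1) * Complex.exp (Complex.I * (Real.pi / 2)) := by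
      rw [mul_comm Complex.I, Complex.exp_pi_div_two_mul_I, ← pow_succ,
        Nat.sub_add_cancel (Nat.pos_of_ne_zero (NeZero.ne n))]
    rw [h1, hpol.det_eq _ hx, h4, h2, h3]
    push_cast
    rw [Complex.ofReal_re, Complex.ofReal_re, mul_add, mul_add, Complex.exp_add, Complex.exp_add]
    simp only [toC]
    ring

/-- The phase `t + l t` of a normal form is a lift of a circle homeomorphism, and the image under
the argument of `φ^*Ω` of the volume of the torus is, up to a half turn, the image of the Lebesgue
measure under this phase. -/
theorem HasNormalForm.phase {ε r c ρ : ℝ} {φ : (Fin n → ℂ) → (Fin n → ℂ)}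
    {a p : (Fin n → ℂ) → ℂ} {l : ℝ → ℝ} (hφ : IsNearIdentity ε r φ) (hr : 0 < r)
    (hpol : IsPolarJacobian (r / 2) c (fun w => φ (ccover w)) a p) (hc : c ≤ 1 / 4)
    (h : HasNormalForm 1 (φ '' torus n) ρ l) :
    StrictMono (fun t => t + l t) ∧ ∃ m₀ : ℤ, ∀ v : ℝ → ℝ, Periodic v (2 * Real.pi) →
      ∫ x in box n, v (∑ j, x j + Real.pi / 2 + (a (toC x)).re) * ‖pullbackCoeff φ x‖ =
        (2 * Real.pi) ^ (n - 1) *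
          (ρ * ∫ t in (0 : ℝ)..(2 * Real.pi), v (t + l t - m₀ * Real.pi)) := by
  obtain ⟨hρ, hlc, hlp, -, g, hg, hemb, heq⟩ := h
  have hr2 := half_pos hr
  set μ : (Fin n → ℝ) → ℝ := fun x => ∑ j, x j + Real.pi / 2 + (a (toC x)).re with hμ
  have hP := norm_pullbackCoeff_eq_and hφ hr hpol
  have hN : ∀ x, ‖pullbackCoeff φ x‖ = (p (toC x)).re := fun x => by
    rw [(hP x).2, norm_mul, norm_mul, norm_pow, Complex.norm_I, one_pow, one_mul,
      mul_comm Complex.I, Complex.norm_exp_ofReal_mul_I, mul_one, Complex.norm_real,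
      Real.norm_of_nonneg (hP x).1.le]
  have hdetφ : ∀ z ∈ annulus n (r / 2), (fderiv ℂ φ z).det ≠ 0 := fun z hz h0 => by
    have hz0 : ∀ j, z j ≠ 0 := fun j h0 => by
      have := (hz j).1
      rw [h0, norm_zero] at this
      exact absurd this (not_lt.2 (Real.exp_pos _).le)
    obtain ⟨w, rfl⟩ : ∃ w, ccover w = z := ⟨_, exists_ccover_eq hz0⟩
    have hw := ccover_mem_annulus.1 hz
    have h1 : (fderiv ℂ (fun w => φ (ccover w)) w).det =
        (fderiv ℂ φ (ccover w)).det * (fderiv ℂ ccover w).det := by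
      rw [← det_comp_complex, ← fderiv_comp w (hφ.1.differentiableAt ((isOpen_annulus _).mem_nhds
        (annulus_mono (by linarith) hz))) (differentiable_ccover w)]
      rfl
    rw [h0, zero_mul, hpol.det_eq w hw] at h1
    have hp0 : p w ≠ 0 := fun h0 => by
      have := hpol.mod_near_one w hw
      rw [h0, zero_sub, norm_neg, norm_one] at this
      linarith
    exact mul_ne_zero (mul_ne_zero (pow_ne_zero _ Complex.I_ne_zero) (Complex.exp_ne_zero _))
      (mul_ne_zero hp0 (Complex.exp_ne_zero _)) h1
  obtain ⟨X, hX, hXd, hXdet⟩ := exists_reparametrization (isOpen_annulus (r / 2))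
    (torus_subset_annulus hr2) (hφ.1.mono (annulus_mono (by linarith))) hφ.2.1.2.2 hdetφ
    (hemb.1.differentiable one_ne_zero) hemb.2.2 heq
  set L : ℝ → ℝ := fun t => t + l t with hL
  have hLper : ∀ t, L (t + 2 * Real.pi) = L t + 2 * Real.pi := fun t => by
    simp only [hL, hlp t]; ring
  have hLc : Continuous L := by fun_prop
  have hrel : ∀ θ, (ρ : ℂ) * Complex.exp (((L (∑ j, θ j) - μ (X θ) : ℝ) : ℂ) * Complex.I) =
      (((p (toC (X θ))).re * (fderiv ℝ X θ).det : ℝ) : ℂ) := fun θ => by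
    have h1 := hXdet θ
    rw [pullbackCoeff_normalMap hg, (hP _).2, mul_assoc] at h1
    have h2 := mul_left_cancel₀ (pow_ne_zero _ Complex.I_ne_zero) h1
    have h3 : Complex.exp (((L (∑ j, θ j) - μ (X θ) : ℝ) : ℂ) * Complex.I) =
        Complex.exp (Complex.I * (((∑ j, θ j : ℝ) : ℂ) + (l (∑ j, θ j) : ℂ))) *
          Complex.exp (-(Complex.I * (μ (X θ) : ℂ))) := by
      rw [← Complex.exp_add]
      congr 1
      simp only [hL]
      push_cast
      ring
    rw [h3, ← mul_assoc, h2, hμ, Complex.exp_neg]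
    have := Complex.exp_ne_zero (Complex.I * ((μ (X θ) : ℝ) : ℂ))
    push_cast
    field_simp
  have hsin : ∀ θ, Real.sin (L (∑ j, θ j) - μ (X θ)) = 0 := fun θ => by
    have h1 := congrArg Complex.im (hrel θ)
    rw [Complex.ofReal_im, Complex.im_ofReal_mul, Complex.exp_ofReal_mul_I_im] at h1
    exact (mul_eq_zero.1 h1).resolve_left hρ.ne'
  have habs : ∀ θ, |(fderiv ℝ X θ).det| * (p (toC (X θ))).re = ρ := fun θ => by
    have h1 := congrArg norm (hrel θ)
    rw [norm_mul, Complex.norm_exp_ofReal_mul_I, mul_one, Complex.norm_real, Complex.norm_real,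
      Real.norm_of_nonneg hρ.le, norm_mul, Real.norm_of_nonneg (hP _).1.le, Real.norm_eq_abs] at h1
    rw [h1, mul_comm]
  have hμfd : ∀ x, HasFDerivAt μ ((∑ j, ContinuousLinearMap.proj (R := ℝ) (φ := fun _ => ℝ) j) +
      Complex.reCLM.comp (((fderiv ℂ a (toC x)).restrictScalars ℝ).comp (toCL n))) x := fun x => by
    refine HasFDerivAt.add (HasFDerivAt.add_const _ ?_) ?_
    · exact HasFDerivAt.fun_sum fun j _ => hasFDerivAt_apply j x
    · exact Complex.reCLM.hasFDerivAt.comp x (((hpol.differentiableOn_arg.differentiableAt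
        (isOpen_strip.mem_nhds (toC_mem_strip hr2 x))).hasFDerivAt.restrictScalars ℝ).comp x
          (hasFDerivAt_toC x))
  have hμ0 : ∀ x, fderiv ℝ μ x (Pi.single 0 1) ≠ 0 := fun x h0 => by
    have hball : ball (toC x) (r / 2) ⊆ strip n (r / 2) := fun y hy j => by
      have h1 : ‖y j - toC x j‖ < r / 2 :=
        (norm_le_pi_norm (y - toC x) j).trans_lt (by rwa [← dist_eq_norm])
      have h2 := (Complex.abs_im_le_norm _).trans_lt h1
      simpa [toC] using h2
    have h1 : ‖fderiv ℂ a (toC x)‖ ≤ 2 * c := by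
      refine (norm_fderiv_le_of_bounded hr2 (hpol.differentiableOn_arg.mono hball) fun y hy =>
        hpol.norm_arg_le y (hball hy)).trans (le_of_eq ?_)
      field_simp
    have h2 : toCL n (Pi.single 0 1) = Pi.single 0 1 := by
      funext i
      rw [toCL_apply]
      rcases eq_or_ne i 0 with rfl | hij
      · simp [toC]
      · simp [toC, hij]
    rw [(hμfd x).fderiv] at h0
    simp only [add_apply, sum_apply, ContinuousLinearMap.proj_apply,
      ContinuousLinearMap.comp_apply, ContinuousLinearMap.coe_restrictScalars', h2,
      Complex.reCLM_apply, Finset.sum_pi_single', Finset.mem_univ, if_true] at h0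
    have h3 := (Complex.abs_re_le_norm _).trans ((fderiv ℂ a (toC x)).le_opNorm (Pi.single 0 1))
    rw [Pi.norm_single, norm_one, mul_one] at h3
    linarith [(abs_le.1 h3).1]
  -- the phases differ by a constant multiple of `π`, by connectedness
  have hfc : Continuous fun θ : Fin n → ℝ => L (∑ j, θ j) - μ (X θ) := by
    have h1 : Continuous μ := continuous_iff_continuousAt.2 fun x => (hμfd x).continuousAt
    exact (hLc.comp (by fun_prop)).sub (h1.comp hXd.continuous)
  have hconst : ∀ θ θ' : Fin n → ℝ,
      L (∑ j, θ' j) - μ (X θ') ≤ L (∑ j, θ j) - μ (X θ) := fun θ θ' => by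
    by_contra! hlt
    obtain ⟨m, hm⟩ := Real.sin_eq_zero_iff.1 (hsin θ)
    obtain ⟨m', hm'⟩ := Real.sin_eq_zero_iff.1 (hsin θ')
    rw [← hm, ← hm'] at hlt
    have h1 : m < m' := by exact_mod_cast lt_of_mul_lt_mul_right hlt Real.pi_pos.le
    have h2 : (m : ℝ) + 1 ≤ m' := by exact_mod_cast h1
    obtain ⟨θ'', hθ''⟩ := mem_range_of_exists_le_of_exists_ge hfc (c := (m + 1 / 2) * Real.pi)
      ⟨θ, by rw [← hm]; nlinarith [Real.pi_pos]⟩ ⟨θ', by rw [← hm']; nlinarith [Real.pi_pos]⟩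
    obtain ⟨m'', hm''⟩ := Real.sin_eq_zero_iff.1 (hsin θ'')
    have hθ3 : L (∑ j, θ'' j) - μ (X θ'') = (m + 1 / 2) * Real.pi := hθ''
    rw [← hm''] at hθ3
    have h3 : (m'' : ℝ) = m + 1 / 2 := mul_right_cancel₀ Real.pi_ne_zero hθ3
    have h4 : (2 * m'' : ℤ) = 2 * m + 1 := by
      have : (2 * m'' : ℝ) = 2 * m + 1 := by rw [h3]; ring
      exact_mod_cast this
    omega
  obtain ⟨m₀, hm₀⟩ := Real.sin_eq_zero_iff.1 (hsin 0)
  have hphase : ∀ θ, L (∑ j, θ j) = μ (X θ) + m₀ * Real.pi := fun θ => by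
    have := le_antisymm (hconst 0 θ) (hconst θ 0)
    linarith
  have hsum : ∀ s : ℝ, ∑ j, (Pi.single (0 : Fin n) s : Fin n → ℝ) j = s := fun s => by simp
  have hLd : Differentiable ℝ L := fun s => by
    have h1 : L = fun s => μ (X (Pi.single 0 s)) + m₀ * Real.pi := by
      funext s; rw [← hphase, hsum]
    rw [h1]
    exact ((hμfd _).differentiableAt.comp s ((hXd _).comp s
      (ContinuousLinearMap.single ℝ (fun _ : Fin n => ℝ) 0).differentiableAt)).add_const _
  have hL0 : ∀ s, deriv L s ≠ 0 := fun s h0 => by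
    set θ : Fin n → ℝ := Pi.single 0 s
    have h1 : HasDerivAt L 0 (∑ j, θ j) := by
      rw [hsum, ← h0]; exact (hLd s).hasDerivAt
    have h2 := h1.comp_hasFDerivAt θ (HasFDerivAt.fun_sum (u := Finset.univ) fun j _ =>
      (ContinuousLinearMap.proj (R := ℝ) (φ := fun _ : Fin n => ℝ) j).hasFDerivAt)
    have h3 : HasFDerivAt (fun θ => μ (X θ) + m₀ * Real.pi)
        ((fderiv ℝ μ (X θ)).comp (fderiv ℝ X θ)) θ :=
      (HasFDerivAt.comp θ (hμfd _).differentiableAt.hasFDerivAt (hXd θ).hasFDerivAt).add_const _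
    have h4 : (L ∘ fun θ : Fin n → ℝ => ∑ j, θ j) = fun θ => μ (X θ) + m₀ * Real.pi :=
      funext hphase
    have h5 : HasFDerivAt (L ∘ fun θ : Fin n → ℝ => ∑ j, θ j) _ θ := h2
    rw [h4] at h5
    have h6 := h3.unique h5
    have hdet : (fderiv ℝ X θ).det ≠ 0 := fun h0 => by
      have := habs θ
      rw [h0, abs_zero, zero_mul] at this
      exact hρ.ne this
    obtain ⟨v, hv⟩ := ((fderiv ℝ X θ).toContinuousLinearEquivOfDetNeZero hdet).surjective
      (Pi.single 0 1)
    have h7 := DFunLike.congr_fun h6 v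
    have hv' : fderiv ℝ X θ v = Pi.single 0 1 := hv
    rw [ContinuousLinearMap.comp_apply, hv', zero_smul, zero_apply] at h7
    exact hμ0 _ h7
  have hLm : StrictMono L := by
    have hinj : Injective L := by
      have key : ∀ x y, x < y → L x ≠ L y := fun x y hxy he => by
        obtain ⟨s, -, hs⟩ := exists_deriv_eq_zero hxy hLc.continuousOn he
        exact hL0 s hs
      intro x y he
      by_contra hne
      rcases lt_or_gt_of_ne hne with h1 | h1
      · exact key x y h1 he
      · exact key y x h1 he.symm
    refine (hLc.strictMono_of_inj hinj).resolve_right fun hanti => ?_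
    have h1 := hanti (show (0 : ℝ) < 0 + 2 * Real.pi by linarith [Real.two_pi_pos])
    rw [hLper] at h1
    linarith [Real.two_pi_pos]
  refine ⟨hLm, m₀, fun v hv => ?_⟩
  have hper : ∀ (x : Fin n → ℝ) (m : Fin n → ℤ),
      v (μ (x + lat m)) * ‖pullbackCoeff φ (x + lat m)‖ = v (μ x) * ‖pullbackCoeff φ x‖ :=
    fun x m => by
      have h1 : μ (x + lat m) = μ x + (∑ j, m j : ℤ) * (2 * Real.pi) := by
        simp only [hμ, hpol.arg_periodic, Pi.add_apply, lat, Finset.sum_add_distrib,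
          ← Finset.mul_sum]
        push_cast
        ring
      rw [hN, hN, hpol.mod_periodic, h1]
      congr 1
      exact hv.int_mul _ _
  rw [← integral_box_comp hX (fun θ => (hXd θ).hasFDerivAt)
    (f := fun x => v (μ x) * ‖pullbackCoeff φ x‖) hper]
  have h1 : ∀ θ, |(fderiv ℝ X θ).det| • (v (μ (X θ)) * ‖pullbackCoeff φ (X θ)‖) =
      ρ * v (L (∑ j, θ j) - m₀ * Real.pi) := fun θ => by
    rw [hN, hphase, add_sub_cancel_right, ← habs θ, smul_eq_mul]
    ring
  simp only [h1]
  rw [integral_box_sum (fun s => ρ * v (L s - m₀ * Real.pi)) fun s => by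
    simp only [hLper]
    rw [add_sub_right_comm, hv], intervalIntegral.integral_const_mul]
  simp [hL]

theorem HasNormalForm.eq_meanVolume {ε r c ρ : ℝ} {φ : (Fin n → ℂ) → (Fin n → ℂ)}
    {a p : (Fin n → ℂ) → ℂ} {l : ℝ → ℝ} (hφ : IsNearIdentity ε r φ) (hr : 0 < r)
    (hpol : IsPolarJacobian (r / 2) c (fun w => φ (ccover w)) a p) (hc : c ≤ 1 / 4)
    (h : HasNormalForm 1 (φ '' torus n) ρ l) : ρ = meanVolume φ := by
  obtain ⟨-, m₀, hv⟩ := h.phase hφ hr hpol hc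
  have h1 := hv (fun _ => 1) fun _ => rfl
  simp only [one_mul, intervalIntegral.integral_const, sub_zero, smul_eq_mul, mul_one] at h1
  have h2 : (2 * Real.pi) ^ n = (2 * Real.pi) ^ (n - 1) * (2 * Real.pi) := by
    rw [← pow_succ, Nat.sub_add_cancel (Nat.pos_of_ne_zero (NeZero.ne n))]
  rw [meanVolume_eq, h1, h2]
  have := Real.pi_ne_zero
  field_simp

theorem eq_or_eq_shift_of_periodic {k : ℝ → ℝ} (hk : Periodic k (2 * Real.pi)) (m : ℤ) :
    (fun t => k (t + m * Real.pi)) = k ∨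
      (fun t => k (t + m * Real.pi)) = fun t => k (t + Real.pi) := by
  rcases Int.even_or_odd' m with ⟨j, rfl | rfl⟩
  · left
    funext t
    have := hk.int_mul j t
    rw [← this]
    push_cast
    ring_nf
  · right
    funext t
    have := hk.int_mul j (t + Real.pi)
    rw [← this]
    push_cast
    ring_nf

/-- The function in the normal form is unique up to a half turn. -/
theorem HasNormalForm.unique {ε r c ρ ρ' : ℝ} {φ : (Fin n → ℂ) → (Fin n → ℂ)}
    {a p : (Fin n → ℂ) → ℂ} {k l : ℝ → ℝ} (hφ : IsNearIdentity ε r φ) (hr : 0 < r)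
    (hpol : IsPolarJacobian (r / 2) c (fun w => φ (ccover w)) a p) (hc : c ≤ 1 / 4)
    (h : HasNormalForm 1 (φ '' torus n) ρ l) (h' : HasNormalForm 1 (φ '' torus n) ρ' k) :
    l = k ∨ l = fun t => k (t + Real.pi) := by
  obtain ⟨hm, m, hv⟩ := h.phase hφ hr hpol hc
  obtain ⟨hm', m', hv'⟩ := h'.phase hφ hr hpol hc
  have hρ : ρ = ρ' := (h.eq_meanVolume hφ hr hpol hc).trans (h'.eq_meanVolume hφ hr hpol hc).symm
  subst hρ
  obtain ⟨hρ, hlc, hlp, hl0, -⟩ := h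
  obtain ⟨-, hkc, hkp, hk0, -⟩ := h'
  obtain ⟨b, hb⟩ := exists_translate_eq (A := fun t => t + l t - m * Real.pi)
    (A' := fun t => t + k t - m' * Real.pi) (fun s t hst => sub_lt_sub_right (hm hst) _)
    (fun s t hst => sub_lt_sub_right (hm' hst) _) (fun t => by simp only [hlp t]; ring)
    (fun t => by simp only [hkp t]; ring) (by fun_prop) fun v hvp => by
      have h1 := (hv v hvp).symm.trans (hv' v hvp)
      have h2 := mul_left_cancel₀ (pow_ne_zero _ Real.two_pi_pos.ne') h1
      exact mul_left_cancel₀ hρ.ne' h2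
  -- comparing the means, the translation is by a multiple of `π`
  have h1 : ∀ t, k (t + b) = l t + ((m' - m) * Real.pi - b) := fun t => by
    have : t + b + k (t + b) - m' * Real.pi = t + l t - m * Real.pi := hb t
    linarith
  have h2 : ∫ t in (0 : ℝ)..(2 * Real.pi), k (t + b) = 0 := by
    rw [intervalIntegral.integral_comp_add_right (fun t => k t), zero_add, add_comm (2 * Real.pi),
      hkp.intervalIntegral_add_eq b 0, zero_add, hk0]
  simp only [h1] at h2
  rw [intervalIntegral.integral_add (hlc.intervalIntegrable _ _) (by simp), hl0,
    intervalIntegral.integral_const, zero_add, sub_zero, smul_eq_mul] at h2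
  have h3 := (mul_eq_zero.1 h2).resolve_left Real.two_pi_pos.ne'
  have h4 : l = fun t => k (t + (m' - m : ℤ) * Real.pi) := by
    funext t
    have := h1 t
    rw [h3, add_zero] at this
    rw [← this]
    push_cast
    congr 2
    linarith
  rw [h4]
  exact eq_or_eq_shift_of_periodic hkp (m' - m)

theorem HasNormalForm.of_le {s t : WithTop ℕ∞} (hst : t ≤ s) {M : Set (Fin n → ℂ)} {ρ : ℝ}
    {k : ℝ → ℝ} (h : HasNormalForm s M ρ k) : HasNormalForm t M ρ k := by
  obtain ⟨hρ, hc, hp, h0, g, hg, he, hM⟩ := h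
  exact ⟨hρ, hc, hp, h0, g, hg, ⟨he.1.of_le hst, he.2⟩, hM⟩

end

/-- Every torus close enough to the standard one has a real analytic normal form, unique up to a
half turn. -/
theorem exists_unique_normalForm (n : ℕ) [NeZero n] (hn : 2 ≤ n) : ∃ ε > 0, ∀ (r : ℝ)
    (φ : (Fin n → ℂ) → (Fin n → ℂ)), 0 < r → r < 1 → IsNearIdentity ε r φ →
      ∃ k : ℝ → ℝ, AnalyticOnNhd ℝ k univ ∧ HasNormalForm ω (φ '' torus n) (meanVolume φ) k ∧
        ∀ (ρ : ℝ) (l : ℝ → ℝ), HasNormalForm 1 (φ '' torus n) ρ l ↔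
          ρ = meanVolume φ ∧ (l = k ∨ l = fun t => k (t + Real.pi)) := by
  obtain ⟨c, hc, hcoord⟩ := exists_normal_coordinates n
  obtain ⟨ε, hε, hpolar⟩ := exists_isPolarJacobian n (c := min c (1 / 4)) (by positivity)
  refine ⟨ε, hε, fun r φ hr hr1 hφ => ?_⟩
  obtain ⟨a, p, hpol⟩ := hpolar r φ hr hr1 hφ
  have hpol' : IsPolarJacobian (r / 2) c (fun w => φ (ccover w)) a p :=
    { hpol with
      norm_arg_le := fun w hw => (hpol.norm_arg_le w hw).trans <|
        mul_le_mul_of_nonneg_right (min_le_left _ _) (half_pos hr).le }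
  obtain ⟨δ₁, ρ, K, γ, X, G, hδ₁, hδ₁r, hρ, hKω, hKm, hKper, hKmean, hγω, hγ, hX, hXd, hGd, hGdet,
    hG⟩ := hcoord (r / 2) _ a p (half_pos hr) hpol'
  have hnf := exists_hasNormalForm hφ hpol' hδ₁ hδ₁r hρ hKω hKm hKper hKmean hγω hγ hX hXd hGd
    hGdet hG
  have hnf1 : HasNormalForm 1 (φ '' torus n) ρ fun t => K t - t := hnf.of_le (by simp)
  have hρe := hnf1.eq_meanVolume hφ hr hpol (min_le_right _ _)
  subst hρe
  refine ⟨fun t => K t - t, contDiff_omega_iff_analyticOnNhd.1 (hKω.sub contDiff_id), hnf,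
    fun ρ l => ⟨fun h => ⟨h.eq_meanVolume hφ hr hpol (min_le_right _ _),
      h.unique hφ hr hpol (min_le_right _ _) hnf1⟩, ?_⟩⟩
  rintro ⟨rfl, rfl | rfl⟩
  · exact hnf1
  · exact hnf1.shift hn

/-- Tori with a common normal form are unimodularly equivalent. -/
theorem HasNormalForm.unimodularEquiv [NeZero n] {M N : Set (Fin n → ℂ)} {ρ : ℝ} {k : ℝ → ℝ}
    (h : HasNormalForm 1 M ρ k) (h' : HasNormalForm 1 N ρ k) : UnimodularEquiv M N := by
  obtain ⟨-, -, -, -, g, hg, -, hM⟩ := h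
  obtain ⟨-, -, -, -, g', hg', -, hN⟩ := h'
  exact (hM.trans (unimodularEquiv_normalMap_of_deriv_eq hg hg')).trans hN.symm

theorem HasNormalForm.congr_unimodularEquiv [NeZero n] {s : WithTop ℕ∞} {M N : Set (Fin n → ℂ)}
    {ρ : ℝ} {k : ℝ → ℝ} (h : HasNormalForm s M ρ k) (hMN : UnimodularEquiv M N) :
    HasNormalForm s N ρ k := by
  obtain ⟨hρ, hc, hp, h0, g, hg, he, hM⟩ := h
  exact ⟨hρ, hc, hp, h0, g, hg, he, hMN.symm.trans hM⟩

end

end UnimodularTori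

end

theorem theorem1p3 (n : ℕ) [NeZero n] (hn : 2 ≤ n) :
    ∃ ε₀ : ℝ, 0 < ε₀ ∧
      -- existence of the normal form, and uniqueness of its data up to the shift by `π`
      (∀ (r₀ : ℝ) (φ : (Fin n → ℂ) → (Fin n → ℂ)), 0 < r₀ → r₀ < 1 →
        UnimodularTori.IsNearIdentity ε₀ r₀ φ →
        ∃ k : ℝ → ℝ, AnalyticOnNhd ℝ k Set.univ ∧
          UnimodularTori.HasNormalForm ω (φ '' UnimodularTori.torus n)
            (UnimodularTori.meanVolume φ) k ∧
          ∀ (ρ : ℝ) (l : ℝ → ℝ),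
            UnimodularTori.HasNormalForm 1 (φ '' UnimodularTori.torus n) ρ l ↔
              ρ = UnimodularTori.meanVolume φ ∧ (l = k ∨ l = fun t => k (t + Real.pi))) ∧
      -- completeness of the invariants
      (∀ (r₁ r₂ : ℝ) (φ₁ φ₂ : (Fin n → ℂ) → (Fin n → ℂ)) (k₁ k₂ : ℝ → ℝ),
        0 < r₁ → r₁ < 1 → 0 < r₂ → r₂ < 1 →
        UnimodularTori.IsNearIdentity ε₀ r₁ φ₁ → UnimodularTori.IsNearIdentity ε₀ r₂ φ₂ →
        UnimodularTori.HasNormalForm 1 (φ₁ '' UnimodularTori.torus n)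
          (UnimodularTori.meanVolume φ₁) k₁ →
        UnimodularTori.HasNormalForm 1 (φ₂ '' UnimodularTori.torus n)
          (UnimodularTori.meanVolume φ₂) k₂ →
        (UnimodularTori.UnimodularEquiv (φ₁ '' UnimodularTori.torus n)
            (φ₂ '' UnimodularTori.torus n) ↔
          UnimodularTori.meanVolume φ₁ = UnimodularTori.meanVolume φ₂ ∧
            (k₂ = k₁ ∨ k₂ = fun t => k₁ (t + Real.pi)))) := by
  obtain ⟨ε₀, hε₀, hmain⟩ := UnimodularTori.exists_unique_normalForm n hn
  refine ⟨ε₀, hε₀, hmain, fun r₁ r₂ φ₁ φ₂ k₁ k₂ hr₁ hr₁' hr₂ hr₂' hφ₁ hφ₂ h₁ h₂ => ?_⟩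
  constructor
  · intro h
    obtain ⟨k, -, -, huniq⟩ := hmain r₂ φ₂ hr₂ hr₂' hφ₂
    obtain ⟨hvol, -⟩ := (huniq _ _).1 (h₁.congr_unimodularEquiv h)
    obtain ⟨l, -, -, huniq'⟩ := hmain r₁ φ₁ hr₁ hr₁' hφ₁
    have h₂' := h₂.congr_unimodularEquiv h.symm
    have hper : ∀ t, l (t + Real.pi + Real.pi) = l t := fun t => by
      have := ((huniq' (UnimodularTori.meanVolume φ₁) l).2 ⟨rfl, Or.inl rfl⟩).2.2.1 t
      rwa [add_assoc, ← two_mul]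
    refine ⟨hvol, ?_⟩
    rcases ((huniq' _ _).1 h₁).2 with rfl | rfl <;> rcases ((huniq' _ _).1 h₂').2 with rfl | rfl
    · exact Or.inl rfl
    · exact Or.inr rfl
    · exact Or.inr (funext fun t => (hper t).symm)
    · exact Or.inl rfl
  · rintro ⟨hvol, rfl | rfl⟩
    · exact h₁.unimodularEquiv (hvol ▸ h₂)
    · exact (h₁.shift hn).unimodularEquiv (hvol ▸ h₂)
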